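/- Let $G=(V,E)$ be a finite directed graph with $n=|V|\ge 3$ vertices and $E\subseteq V\times V$. A vertex $w$ is a \emph{strong articulation point} if $G\setminus\{w\}$ is not strongly connected, and an edge $e$ is a \emph{strong bridge} if $(V,E\setminus\{e\})$ is not strongly connected. $G$ is \emph{$2$-edge-connected} if it is strongly connected and has no strong bridge, and \emph{$2$-vertex-connected} if it is strongly connected, $n\ge 3$, and it has no strong articulation point. For $T\subseteq V$, $G$ is \emph{$2$-$T$-connected} if it is $2$-edge-connected and no vertex of $T$ is a strong articulation point. The problem M2TC asks, for a $2$-$T$-connected graph $G=(V,E)$, for a set $F\subseteq E$ of minimum cardinality such that $(V,F)$ is $2$-$T$-connected. A $2$-edge- or $2$-vertex-connected graph is \emph{minimal} if it loses this property on deletion of any single edge. In the graph $G$ with start vertex $u$, a vertex $x$ is a \emph{dominator} of $y$ if $x$ lies on every path from $u$ to $y$. Two spanning trees of $G$ rooted at $u$ (edges directed away from $u$) are \emph{independent} if for every $x\ne u$ the paths from $u$ to $x$ in the two trees have only dominators of $x$ in common. Let $G^R$ be the graph obtained by reversing all edges. \textbf{Algorithm 1.} Input: a $2$-$T$-connected graph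 $G=(V,E)$ and $T$. Output: $(V,E_\alpha)$. \begin{itemize} \item If $T=\emptyset$, let $(V,E_\alpha)$ be a minimal $2$-edge-connected spanning subgraph of $G$. \item If $T=V$, let $(V,E_\alpha)$ be a minimal $2$-vertex-connected spanning subgraph of $G$. \item Otherwise let $(V,E_\alpha)$ be a minimal $2$-edge-connected spanning subgraph of $G$, and then add edges: \begin{itemize} \item if $|T|\le 2$, for each $y\in T$ choose $q\in V\setminus\{y\}$ and add to $E_\alpha$ the edges of a spanning tree of $G\setminus\{y\}$ rooted at $q$ and the reversals of the edges of a spanning tree of $G^R\setminus\{y\}$ rooted at $q$; \item if $|T|>2$, choose $w\in V\setminus T$ and add to $E_\alpha$ the edges of two independent spanning trees of $G$ rooted at $w$ and the reversals of the edges of two independent spanning trees of $G^R$ rooted at $w$. \end{itemize} \end{itemize} \textbf{Theorem.} Let $T \subseteq V$ and let $G=(V,E)$ be a $2$-$T$-connected directed graph with $n\ge 3$ vertices. \begin{enumerate} \item $|E|\ge 2n$. \item Whatever choices are made, the graph $(V,E_\alpha)$ returned by Algorithm 1 has at most $8n$ edges, satisfies $E_\alpha\subseteq E$, is $2$-$T$-connected,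 and $|E_\alpha|\le 4\,|E_O|$ for every optimal solution $E_O$ of M2TC for $G$ and $T$. \item Algorithm 1 can be implemented in polynomial time: there are a program for a random access machine (with addition and truncated subtraction, at unit cost) and a polynomial $p$ such that for all $n\ge 3$ and all $2$-$T$-connected graphs on $n$ numbered vertices, given by $n$, the adjacency matrix and the indicator of $T$, the program halts after at most $p(n)$ steps with a set $E_\alpha$ that is a possible result of Algorithm 1. \end{enumerate} Hence there is a polynomial-time $4$-approximation algorithm for M2TC. -/

import Mathlib

namespace M2TC

/-! ### Finite directed graphs

A directed graph `G = (V, E)` is given by its edge set `E : Finset (V × V)` on a finite type `V`. -/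

section Graphs

variable {V : Type*}

/-- There is a directed walk from `u` to `v` using edges of `E`. -/
def Reach (E : Finset (V × V)) (u v : V) : Prop :=
  Relation.ReflTransGen (fun a b => (a, b) ∈ E) u v

/-- `(V, E)` is strongly connected. -/
def StronglyConnected (E : Finset (V × V)) : Prop :=
  ∀ u v : V, Reach E u v

variable [DecidableEq V]

/-- The edge set of `G ∖ {w}`. -/
def deleteVertex (E : Finset (V × V)) (w : V) : Finset (V × V) :=
  E.filter fun e => e.1 ≠ w ∧ e.2 ≠ w

/-- The edge set of the reverse graph `Gᴿ`. -/
def reverse (E : Finset (V × V)) : Finset (V × V) :=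
  E.image Prod.swap

/-- `w` is a strong articulation point: `G ∖ {w}`, a graph on `V ∖ {w}`, is not strongly
connected. -/
def IsStrongArticulationPoint (E : Finset (V × V)) (w : V) : Prop :=
  ¬ ∀ u v : V, u ≠ w → v ≠ w → Reach (deleteVertex E w) u v

/-- `e` is a strong bridge. -/
def IsStrongBridge (E : Finset (V × V)) (e : V × V) : Prop :=
  e ∈ E ∧ ¬ StronglyConnected (E.erase e)

/-- `(V, E)` is `2`-edge-connected. -/
def TwoEdgeConnected (E : Finset (V × V)) : Prop :=
  StronglyConnected E ∧ ∀ e ∈ E, ¬ IsStrongBridge E e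

/-- `(V, E)` is `2`-vertex-connected. -/
def TwoVertexConnected [Fintype V] (E : Finset (V × V)) : Prop :=
  3 ≤ Fintype.card V ∧ StronglyConnected E ∧ ∀ w : V, ¬ IsStrongArticulationPoint E w

/-- `(V, E)` is `2`-`T`-connected. -/
def TwoTConnected (E : Finset (V × V)) (T : Finset V) : Prop :=
  StronglyConnected E ∧ TwoEdgeConnected E ∧ ∀ w ∈ T, ¬ IsStrongArticulationPoint E w

/-- `F` is the edge set of a minimal `2`-edge-connected spanning subgraph of `(V, E)`. -/
def IsMinimalTwoEdgeConnectedSubgraph (E F : Finset (V × V)) : Prop :=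
  F ⊆ E ∧ TwoEdgeConnected F ∧ ∀ e ∈ F, ¬ TwoEdgeConnected (F.erase e)

/-- `F` is the edge set of a minimal `2`-vertex-connected spanning subgraph of `(V, E)`. -/
def IsMinimalTwoVertexConnectedSubgraph [Fintype V] (E F : Finset (V × V)) : Prop :=
  F ⊆ E ∧ TwoVertexConnected F ∧ ∀ e ∈ F, ¬ TwoVertexConnected (F.erase e)

/-! ### Spanning trees, dominators, independent trees -/

/-- `A` is the edge set of a spanning tree, rooted at `q`, of the graph with vertex set `S` and
edge set `E`: edges point away from the root, the root has indegree `0`, every vertex has indegree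
at most `1`, and all vertices of `S` are reached from `q`. -/
def IsSpanningTree (S : Set V) (E : Finset (V × V)) (q : V) (A : Finset (V × V)) : Prop :=
  q ∈ S ∧ A ⊆ E ∧ (∀ a b : V, (a, b) ∈ A → a ∈ S ∧ b ∈ S) ∧
    (∀ a : V, (a, q) ∉ A) ∧
    (∀ a b v : V, (a, v) ∈ A → (b, v) ∈ A → a = b) ∧
    ∀ v ∈ S, Reach A q v

/-- `p` lists the vertices of a (simple, directed) path from `u` to `v` in `(V, E)`. -/
def IsPath (E : Finset (V × V)) (u v : V) (p : List V) : Prop :=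
  p.head? = some u ∧ p.getLast? = some v ∧ p.Nodup ∧ p.IsChain (fun a b => (a, b) ∈ E)

/-- `x` is a dominator of `y` in the flowgraph `(V, E, u)`. -/
def IsDominator (E : Finset (V × V)) (u x y : V) : Prop :=
  ∀ p : List V, IsPath E u y p → x ∈ p

/-- `A` and `B` are (the edge sets of) two independent spanning trees of the flowgraph
`(V, E, u)`. -/
def AreIndependentTrees (E : Finset (V × V)) (u : V) (A B : Finset (V × V)) : Prop :=
  IsSpanningTree Set.univ E u A ∧ IsSpanningTree Set.univ E u B ∧
    ∀ x : V, x ≠ u → ∀ p r : List V, IsPath A u x p → IsPath B u x r →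
      ∀ z : V, z ∈ p → z ∈ r → IsDominator E u z x

/-! ### The problem M2TC -/

/-- `F` is a feasible solution of M2TC for the graph `(V, E)` and the set `T`. -/
def IsFeasible (E : Finset (V × V)) (T : Finset V) (F : Finset (V × V)) : Prop :=
  F ⊆ E ∧ TwoTConnected F T

/-- `F` is an optimal solution of M2TC for the graph `(V, E)` and the set `T`. -/
def IsOptimal (E : Finset (V × V)) (T : Finset V) (F : Finset (V × V)) : Prop :=
  IsFeasible E T F ∧ ∀ F' : Finset (V × V), IsFeasible E T F' → F.card ≤ F'.card

/-! ### The algorithm -/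

/-- `AlgorithmOutput E T F`: for the input `(V, E)` and `T`, the algorithm can return `(V, F)`.
It is a relation since the algorithm leaves choices open (which minimal subgraph, which vertices
`q` and `w`, which trees); each constructor is one branch of the pseudocode. -/
inductive AlgorithmOutput [Fintype V] (E : Finset (V × V)) (T : Finset V) :
    Finset (V × V) → Prop
  /-- `T = ∅`: a minimal `2`-edge-connected subgraph. -/
  | empty (hT : T = ∅) (F : Finset (V × V))
      (hF : IsMinimalTwoEdgeConnectedSubgraph E F) : AlgorithmOutput E T F
  /-- `T = V`: a minimal `2`-vertex-connected subgraph. -/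
  | full (hT : T ≠ ∅) (hT' : T = Finset.univ) (F : Finset (V × V))
      (hF : IsMinimalTwoVertexConnectedSubgraph E F) : AlgorithmOutput E T F
  /-- `T ≠ ∅`, `T ≠ V`, `|T| ≤ 2`: a minimal `2`-edge-connected subgraph, and for each `y ∈ T`
  the edges of a spanning tree `A y` of `G ∖ {y}` and the reversed edges of a spanning tree `B y`
  of `Gᴿ ∖ {y}`, both rooted at some vertex `q y ≠ y`. -/
  | small (hT : T ≠ ∅) (hT' : T ≠ Finset.univ) (hcard : 0 < T.card ∧ T.card ≤ 2)
      (F : Finset (V × V)) (hF : IsMinimalTwoEdgeConnectedSubgraph E F)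
      (q : V → V) (A B : V → Finset (V × V))
      (hq : ∀ y ∈ T, q y ≠ y)
      (hA : ∀ y ∈ T, IsSpanningTree {y}ᶜ (deleteVertex E y) (q y) (A y))
      (hB : ∀ y ∈ T, IsSpanningTree {y}ᶜ (deleteVertex (reverse E) y) (q y) (B y)) :
      AlgorithmOutput E T (F ∪ T.biUnion fun y => A y ∪ reverse (B y))
  /-- `T ≠ ∅`, `T ≠ V`, `|T| > 2`: a minimal `2`-edge-connected subgraph, the edges of two
  independent trees of `G` and the reversed edges of two independent trees of `Gᴿ`, all rooted at
  some vertex `w ∉ T`. -/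
  | large (hT : T ≠ ∅) (hT' : T ≠ Finset.univ) (hcard : ¬ (0 < T.card ∧ T.card ≤ 2))
      (F : Finset (V × V)) (hF : IsMinimalTwoEdgeConnectedSubgraph E F)
      (w : V) (hw : w ∉ T) (A₁ A₂ B₁ B₂ : Finset (V × V))
      (hA : AreIndependentTrees E w A₁ A₂)
      (hB : AreIndependentTrees (reverse E) w B₁ B₂) :
      AlgorithmOutput E T (F ∪ (A₁ ∪ A₂) ∪ reverse (B₁ ∪ B₂))

end Graphs

/-! ### Running time

A random access machine with addition and truncated subtraction, unit cost per operation, written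
as a structured language. A program is a fixed finite object; it works on natural-number variables
and two-dimensional arrays of natural numbers, which are named by numbers occurring in the
program. There is no multiplication, so that numbers have at most linearly many bits in the number
of steps, and unit cost is polynomially equivalent to Turing machine time. -/

/-- Contents of the variables and of the arrays. -/
structure Store where
  var : ℕ → ℕ
  arr : ℕ → ℕ → ℕ → ℕ

/-- Expressions: constants, variables, array entries, sums and truncated differences. -/
inductive Exp where
  | const (c : ℕ)
  | var (x : ℕ)
  | read (a : ℕ) (i j : Exp)
  | add (e f : Exp)
  | sub (e f : Exp)

/-- The value of an expression. -/
def Exp.eval (s : Store) : Exp → ℕ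
  | .const c => c
  | .var x => s.var x
  | .read a i j => s.arr a (i.eval s) (j.eval s)
  | .add e f => e.eval s + f.eval s
  | .sub e f => e.eval s - f.eval s

/-- The number of operations needed to evaluate an expression. -/
def Exp.cost : Exp → ℕ
  | .const _ => 1
  | .var _ => 1
  | .read _ i j => i.cost + j.cost + 1
  | .add e f => e.cost + f.cost + 1
  | .sub e f => e.cost + f.cost + 1

/-- Assign the value `v` to the variable `x`. -/
def Store.setVar (s : Store) (x v : ℕ) : Store :=
  { s with var := Function.update s.var x v }

/-- Write the value `v` to the entry `(i, j)` of the array `a`. -/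
def Store.setArr (s : Store) (a i j v : ℕ) : Store :=
  { s with arr := fun a' i' j' => if a' = a ∧ i' = i ∧ j' = j then v else s.arr a' i' j' }

/-- Programs. A test succeeds if the value of its expression is not `0`. -/
inductive Prog where
  | skip
  | assign (x : ℕ) (e : Exp)
  | write (a : ℕ) (i j e : Exp)
  | seq (P Q : Prog)
  | ite (b : Exp) (P Q : Prog)
  | loop (b : Exp) (P : Prog)

/-- `Exec P s k s'`: started in `s`, the program `P` halts in `s'` after exactly `k` steps. -/
inductive Exec : Prog → Store → ℕ → Store → Prop
  | skip (s : Store) : Exec .skip s 1 s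
  | assign (x : ℕ) (e : Exp) (s : Store) :
      Exec (.assign x e) s (e.cost + 1) (s.setVar x (e.eval s))
  | write (a : ℕ) (i j e : Exp) (s : Store) :
      Exec (.write a i j e) s (i.cost + j.cost + e.cost + 1)
        (s.setArr a (i.eval s) (j.eval s) (e.eval s))
  | seq {P Q : Prog} {s s' s'' : Store} {k l : ℕ} (hP : Exec P s k s') (hQ : Exec Q s' l s'') :
      Exec (.seq P Q) s (k + l) s''
  | iteTrue {b : Exp} {P Q : Prog} {s s' : Store} {k : ℕ} (hb : b.eval s ≠ 0)
      (hP : Exec P s k s') : Exec (.ite b P Q) s (b.cost + k + 1) s'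
  | iteFalse {b : Exp} {P Q : Prog} {s s' : Store} {k : ℕ} (hb : b.eval s = 0)
      (hQ : Exec Q s k s') : Exec (.ite b P Q) s (b.cost + k + 1) s'
  | loopDone {b : Exp} {P : Prog} {s : Store} (hb : b.eval s = 0) :
      Exec (.loop b P) s (b.cost + 1) s
  | loopStep {b : Exp} {P : Prog} {s s' s'' : Store} {k l : ℕ} (hb : b.eval s ≠ 0)
      (hP : Exec P s k s') (hL : Exec (.loop b P) s' l s'') :
      Exec (.loop b P) s (b.cost + k + 1 + l) s''

/-- The input for a graph on `Fin n` and a vertex set `T`: variable `0` holds `n`, array `0` the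
adjacency matrix, column `0` of array `1` the indicator of `T`; everything else is `0`. -/
def inputStore (n : ℕ) (E : Finset (Fin n × Fin n)) (T : Finset (Fin n)) : Store where
  var x := if x = 0 then n else 0
  arr a i j :=
    if h : i < n then
      if h' : j < n then
        if a = 0 ∧ ((⟨i, h⟩, ⟨j, h'⟩) : Fin n × Fin n) ∈ E then 1
        else if a = 1 ∧ j = 0 ∧ (⟨i, h⟩ : Fin n) ∈ T then 1
        else 0
      else 0
    else 0

/-- The edge set that is read off from array `2` at the end. -/
def outputEdges (n : ℕ) (s : Store) : Finset (Fin n × Fin n) :=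
  Finset.univ.filter fun e => s.arr 2 e.1 e.2 ≠ 0

/-- `P` implements the algorithm in polynomial time: for some polynomial `p`, on every
`2`-`T`-connected graph with `n ≥ 3` vertices, `P` halts after at most `p n` steps and its output
is one that the algorithm can return. -/
def ImplementsInPolynomialTime (P : Prog) : Prop :=
  ∃ p : Polynomial ℕ, ∀ (n : ℕ) (E : Finset (Fin n × Fin n)) (T : Finset (Fin n)),
    3 ≤ n → TwoTConnected E T →
      ∃ (k : ℕ) (s : Store), Exec P (inputStore n E T) k s ∧ k ≤ p.eval n ∧
        AlgorithmOutput E T (outputEdges n s)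

end M2TC

open M2TC

/-!
In a `2`-edge-connected graph every vertex has indegree at least two, so `|E| ≥ 2n`. It therefore
suffices that the output of the algorithm has at most `8n` edges.

A graph is `2`-edge-connected if and only if, for a fixed root `r`, at least two edges enter every
nonempty vertex set without `r`, both in the graph and in its reverse. A minimal
`2`-edge-connected graph is thus the union of a minimal edge set with this property and the
reversal of such a set for the reversed graph. In a minimal set with this property every edge into
`v` enters a tight set, that is, a set entered by exactly two edges. By submodularity the tight
sets that contain `v` are closed under intersection, so all edges into `v` enter the smallest one,
and `v` has indegree at most two. This gives at most `4n` edges.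

If a vertex `y ≠ w` is deleted, two independent spanning trees rooted at `w` together still reach
all the vertices that the whole graph reaches from `w`. Hence such trees of the graph and of its
reverse, with `w` outside `T`, make the output `2`-`T`-connected at the cost of at most `4n` more
edges; for `|T| ≤ 2` the same bound holds for the trees that avoid the vertices of `T`. Together
with spanning trees of the graph and its reverse without `w`, which take care of `y = w`, the
independent trees also show that a minimal `2`-vertex-connected graph has at most `6n` edges.

Independent trees are obtained from low-high orders. In such an order on the siblings in the
dominator tree, every vertex without an incoming edge from its immediate dominator has incoming
edges from the subtrees of an earlier and of a later sibling. One tree selects parents from the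
earlier side and the other from the later side. A low-high order is built greedily, always placing
a vertex that satisfies the earlier half of this condition and whose removal cuts off none of the
vertices still to be placed.

For the running time, all decisions of the algorithm are first-order formulas, with transitive
closure, over a fixed number of binary relations on the vertices. Loop programs that branch on
such formulas compile to the random access machine with a polynomial bound on the number of steps,
so only the input-output behaviour of these programs is left to verify.
-/

namespace M2TC

/-! ### Edge connectivity and cuts -/

section Reachability

variable {V : Type*} {E F : Finset (V × V)} {u v w a b : V}

theorem Reach.refl (E : Finset (V × V)) (u : V) : Reach E u u :=
  Relation.ReflTransGen.refl

theorem Reach.trans (h : Reach E u v) (h' : Reach E v w) : Reach E u w :=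
  Relation.ReflTransGen.trans h h'

theorem Reach.mono (h : E ⊆ F) (hr : Reach E u v) : Reach F u v :=
  Relation.ReflTransGen.mono (fun _ _ hab => h hab) _ _ hr

theorem StronglyConnected.mono (h : E ⊆ F) (hE : StronglyConnected E) : StronglyConnected F :=
  fun u v => (hE u v).mono h

variable [DecidableEq V]

theorem mem_reverse : (a, b) ∈ reverse E ↔ (b, a) ∈ E := by
  simp [reverse]

theorem reverse_reverse (E : Finset (V × V)) : reverse (reverse E) = E := by
  ext ⟨a, b⟩
  simp only [mem_reverse]

theorem card_reverse (E : Finset (V × V)) : (reverse E).card = E.card :=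
  Finset.card_image_of_injective _ Prod.swap_injective

theorem reverse_subset (h : E ⊆ F) : reverse E ⊆ reverse F :=
  Finset.image_subset_image h

theorem reverse_subset_iff : reverse E ⊆ F ↔ E ⊆ reverse F :=
  ⟨fun h => reverse_reverse E ▸ reverse_subset h, fun h => reverse_reverse F ▸ reverse_subset h⟩

theorem erase_reverse (E : Finset (V × V)) (a b : V) :
    (reverse E).erase (a, b) = reverse (E.erase (b, a)) := by
  ext ⟨c, d⟩
  simp only [Finset.mem_erase, mem_reverse, ne_eq, Prod.mk.injEq]
  tauto

theorem reach_reverse : Reach (reverse E) u v ↔ Reach E v u := by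
  unfold Reach
  rw [← Relation.reflTransGen_swap]
  simp only [mem_reverse]

theorem StronglyConnected.reverse (h : StronglyConnected E) :
    StronglyConnected (M2TC.reverse E) :=
  fun u v => reach_reverse.2 (h v u)

theorem mem_deleteVertex : (a, b) ∈ deleteVertex E w ↔ (a, b) ∈ E ∧ a ≠ w ∧ b ≠ w := by
  simp [deleteVertex]

theorem deleteVertex_subset (E : Finset (V × V)) (w : V) : deleteVertex E w ⊆ E :=
  Finset.filter_subset _ _

theorem deleteVertex_mono (h : E ⊆ F) (w : V) : deleteVertex E w ⊆ deleteVertex F w :=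
  Finset.filter_subset_filter _ h

theorem deleteVertex_reverse (E : Finset (V × V)) (w : V) :
    deleteVertex (reverse E) w = reverse (deleteVertex E w) := by
  ext ⟨a, b⟩
  simp only [mem_deleteVertex, mem_reverse]
  tauto

end Reachability

section Connectivity

variable {V : Type*} [DecidableEq V] {E F : Finset (V × V)} {w : V}

theorem twoEdgeConnected_iff :
    TwoEdgeConnected E ↔ StronglyConnected E ∧ ∀ e, StronglyConnected (E.erase e) := by
  refine and_congr_right fun h => ⟨fun h' e => ?_, fun h' e _ hb => hb.2 (h' e)⟩
  by_cases he : e ∈ E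
  · exact not_not.1 fun hc => h' e he ⟨he, hc⟩
  · rwa [Finset.erase_eq_of_notMem he]

theorem TwoEdgeConnected.mono (h : E ⊆ F) (hE : TwoEdgeConnected E) : TwoEdgeConnected F := by
  rw [twoEdgeConnected_iff] at *
  exact ⟨hE.1.mono h, fun e => (hE.2 e).mono (Finset.erase_subset_erase e h)⟩

theorem TwoEdgeConnected.reverse (hE : TwoEdgeConnected E) :
    TwoEdgeConnected (M2TC.reverse E) := by
  rw [twoEdgeConnected_iff] at *
  refine ⟨hE.1.reverse, fun ⟨a, b⟩ => ?_⟩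
  rw [erase_reverse]
  exact (hE.2 _).reverse

theorem not_isStrongArticulationPoint_iff :
    ¬ IsStrongArticulationPoint E w ↔
      ∀ u v : V, u ≠ w → v ≠ w → Reach (deleteVertex E w) u v :=
  not_not

theorem not_isStrongArticulationPoint_mono (h : E ⊆ F) (hE : ¬ IsStrongArticulationPoint E w) :
    ¬ IsStrongArticulationPoint F w := by
  rw [not_isStrongArticulationPoint_iff] at *
  exact fun u v hu hv => (hE u v hu hv).mono (deleteVertex_mono h w)

theorem not_isStrongArticulationPoint_reverse (hE : ¬ IsStrongArticulationPoint E w) :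
    ¬ IsStrongArticulationPoint (reverse E) w := by
  rw [not_isStrongArticulationPoint_iff] at *
  intro u v hu hv
  rw [deleteVertex_reverse, reach_reverse]
  exact hE v u hv hu

variable [Fintype V]

theorem TwoVertexConnected.mono (h : E ⊆ F) (hE : TwoVertexConnected E) : TwoVertexConnected F :=
  ⟨hE.1, hE.2.1.mono h, fun w => not_isStrongArticulationPoint_mono h (hE.2.2 w)⟩

theorem stronglyConnected_of_forall_not_isStrongArticulationPoint (hn : 3 ≤ Fintype.card V)
    (h : ∀ w, ¬ IsStrongArticulationPoint E w) : StronglyConnected E := by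
  intro u v
  obtain ⟨w, hu, hv⟩ := ENat.exists_ne_ne_of_three_le (by simpa using hn) u v
  exact (not_isStrongArticulationPoint_iff.1 (h w) u v hu.symm hv.symm).mono
    (deleteVertex_subset E w)

/-- The detour around the edge `(a, b)` goes through a third vertex `c`: neither a walk avoiding
`b` nor a walk avoiding `a` uses that edge. -/
theorem TwoVertexConnected.reach_erase (h : TwoVertexConnected E) (a b : V) :
    Reach (E.erase (a, b)) a b := by
  by_cases hab : a = b
  · exact hab ▸ Reach.refl _ _
  obtain ⟨c, hca, hcb⟩ := ENat.exists_ne_ne_of_three_le (by simpa using h.1) a b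
  have hsub : ∀ z, z = a ∨ z = b → deleteVertex E z ⊆ E.erase (a, b) := by
    rintro z hz ⟨x, y⟩ hxy
    rw [mem_deleteVertex] at hxy
    simp only [Finset.mem_erase, ne_eq, Prod.mk.injEq]
    grind
  have hac := not_isStrongArticulationPoint_iff.1 (h.2.2 b) a c hab hcb
  have hcb' := not_isStrongArticulationPoint_iff.1 (h.2.2 a) c b hca (Ne.symm hab)
  exact (hac.mono (hsub b (.inr rfl))).trans (hcb'.mono (hsub a (.inl rfl)))

theorem TwoVertexConnected.twoEdgeConnected (h : TwoVertexConnected E) : TwoEdgeConnected E := by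
  rw [twoEdgeConnected_iff]
  refine ⟨h.2.1, fun ⟨a, b⟩ u v => ?_⟩
  refine Relation.ReflTransGen.trans_induction_on (h.2.1 u v) (Reach.refl _)
    (fun {x y} hxy => ?_) fun _ _ => Reach.trans
  by_cases he : (x, y) = (a, b)
  · rw [Prod.mk.injEq] at he
    exact he.1 ▸ he.2 ▸ h.reach_erase x y
  · exact Relation.ReflTransGen.single (Finset.mem_erase.2 ⟨he, hxy⟩)

end Connectivity

section Cuts

variable {V : Type*} [DecidableEq V] {E : Finset (V × V)} {r : V} {k : ℕ}

/-- The set of edges of `E` that enter the vertex set `X`. -/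
def inCut (E : Finset (V × V)) (X : Finset V) : Finset (V × V) :=
  E.filter fun e => e.1 ∉ X ∧ e.2 ∈ X

theorem mem_inCut {X : Finset V} {e : V × V} :
    e ∈ inCut E X ↔ e ∈ E ∧ e.1 ∉ X ∧ e.2 ∈ X :=
  Finset.mem_filter

theorem inCut_erase (E : Finset (V × V)) (X : Finset V) (e : V × V) :
    inCut (E.erase e) X = (inCut E X).erase e :=
  Finset.filter_erase _ _ _

theorem card_inCut_submodular (E : Finset (V × V)) (X Y : Finset V) :
    (inCut E (X ∩ Y)).card + (inCut E (X ∪ Y)).card ≤ (inCut E X).card + (inCut E Y).card := by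
  rw [← Finset.card_union_add_card_inter (inCut E X), ← Finset.card_union_add_card_inter]
  refine add_le_add (Finset.card_le_card fun e => ?_) (Finset.card_le_card fun e => ?_) <;>
    simp only [Finset.mem_union, Finset.mem_inter, mem_inCut] <;> tauto

theorem Reach.inCut_nonempty {x : V} {X : Finset V} (h : Reach E r x) (hr : r ∉ X) (hx : x ∈ X) :
    (inCut E X).Nonempty := by
  induction h with
  | refl => exact absurd hx hr
  | @tail a b _ hab ih =>
    by_cases ha : a ∈ X
    · exact ih ha
    · exact ⟨(a, b), mem_inCut.2 ⟨hab, ha, hx⟩⟩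

/-- The edge form of Menger's condition for `k` edge-disjoint walks from `r` to every vertex: every
nonempty vertex set not containing `r` is entered by at least `k` edges. -/
def IsRootedEdgeConnected (k : ℕ) (r : V) (E : Finset (V × V)) : Prop :=
  ∀ X : Finset V, X.Nonempty → r ∉ X → k ≤ (inCut E X).card

theorem IsRootedEdgeConnected.mono {F : Finset (V × V)} (hEF : E ⊆ F)
    (h : IsRootedEdgeConnected k r E) : IsRootedEdgeConnected k r F :=
  fun X hX hr => (h X hX hr).trans (Finset.card_le_card (Finset.filter_subset_filter _ hEF))

theorem TwoEdgeConnected.isRootedEdgeConnected (h : TwoEdgeConnected E) (r : V) :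
    IsRootedEdgeConnected 2 r E := by
  rintro X ⟨x, hx⟩ hr
  rw [twoEdgeConnected_iff] at h
  obtain ⟨e, he⟩ := (h.1 r x).inCut_nonempty hr hx
  have h2 := (h.2 e r x).inCut_nonempty hr hx
  rw [inCut_erase, ← Finset.card_pos, Finset.card_erase_of_mem he] at h2
  omega

/-- A cut of exactly `k` edges certifies that an edge in it cannot be deleted. -/
theorem IsRootedEdgeConnected.exists_tight_inCut {e : V × V} (h : IsRootedEdgeConnected k r E)
    (he : ¬ IsRootedEdgeConnected k r (E.erase e)) :
    ∃ X : Finset V, r ∉ X ∧ e ∈ inCut E X ∧ (inCut E X).card = k := by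
  unfold IsRootedEdgeConnected at he
  push Not at he
  obtain ⟨X, hX, hr, hlt⟩ := he
  have hk := h X hX hr
  rw [inCut_erase] at hlt
  have heX : e ∈ inCut E X := by
    by_contra hc
    rw [Finset.erase_eq_of_notMem hc] at hlt
    omega
  rw [Finset.card_erase_of_mem heX] at hlt
  exact ⟨X, hr, heX, by omega⟩

theorem IsRootedEdgeConnected.card_inCut_inter {X Y : Finset V} {v : V}
    (h : IsRootedEdgeConnected k r E) (hrX : r ∉ X) (hrY : r ∉ Y) (hvX : v ∈ X) (hvY : v ∈ Y)
    (hX : (inCut E X).card = k) (hY : (inCut E Y).card = k) : (inCut E (X ∩ Y)).card = k := by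
  have hsub := card_inCut_submodular E X Y
  have hinter := h (X ∩ Y) ⟨v, Finset.mem_inter.2 ⟨hvX, hvY⟩⟩ (by simp [hrX])
  have hunion := h (X ∪ Y) ⟨v, Finset.mem_union_left _ hvX⟩ (by simp [hrX, hrY])
  omega

theorem IsRootedEdgeConnected.reach_erase [Finite V] (h : IsRootedEdgeConnected 2 r E)
    (e : V × V) (x : V) : Reach (E.erase e) r x := by
  have := Fintype.ofFinite V
  classical
  by_contra hx
  set X := Finset.univ.filter fun y => ¬ Reach (E.erase e) r y with hX
  have h2 : 2 ≤ (inCut E X).card :=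
    h X ⟨x, by simpa [hX] using hx⟩ (by simpa [hX] using Reach.refl _ _)
  obtain ⟨⟨a, b⟩, hab⟩ : (inCut (E.erase e) X).Nonempty := by
    rw [inCut_erase, ← Finset.card_pos]
    have := Finset.pred_card_le_card_erase (s := inCut E X) (a := e)
    omega
  simp only [hX, mem_inCut, Finset.mem_filter, Finset.mem_univ, true_and, not_not] at hab
  exact hab.2.2 (hab.2.1.tail hab.1)

/-- All edges into `v` enter the smallest tight set that contains `v`, since tight sets containing
`v` are closed under intersection. -/
theorem indegree_le_of_minimal_isRootedEdgeConnected
    (h : Minimal (IsRootedEdgeConnected k r) E) (v : V) :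
    (E.filter fun e => e.2 = v).card ≤ k := by
  have tight : ∀ e ∈ E, e.2 = v →
      ∃ X : Finset V, (r ∉ X ∧ v ∈ X ∧ (inCut E X).card = k) ∧ e.1 ∉ X := by
    rintro e he rfl
    obtain ⟨X, hrX, heX, hX⟩ := h.prop.exists_tight_inCut
      ((Finset.minimal_iff_forall_erase fun _ _ ht hts => ht.mono hts).1 h |>.2 e he)
    exact ⟨X, ⟨hrX, (mem_inCut.1 heX).2.2, hX⟩, (mem_inCut.1 heX).2.1⟩
  rcases (E.filter fun e => e.2 = v).eq_empty_or_nonempty with h0 | ⟨e, he⟩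
  · simp [h0]
  rw [Finset.mem_filter] at he
  obtain ⟨X₀, hX₀, -⟩ := tight e he.1 he.2
  obtain ⟨X, -, hX⟩ := exists_minimal_le_of_wellFoundedLT
    (fun X : Finset V => r ∉ X ∧ v ∈ X ∧ (inCut E X).card = k) X₀ hX₀
  obtain ⟨hrX, hvX, hcard⟩ := hX.prop
  rw [← hcard]
  refine Finset.card_le_card fun f hf => ?_
  rw [Finset.mem_filter] at hf
  obtain ⟨Y, ⟨hrY, hvY, hY⟩, hfY⟩ := tight f hf.1 hf.2
  have hXY : X ⊆ Y := Finset.inter_eq_left.1 <| hX.eq_of_le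
    ⟨by simp [hrX], Finset.mem_inter.2 ⟨hvX, hvY⟩,
      h.prop.card_inCut_inter hrX hrY hvX hvY hcard hY⟩ Finset.inter_subset_left
  exact mem_inCut.2 ⟨hf.1, fun hc => hfY (hXY hc), hf.2 ▸ hvX⟩

theorem twoEdgeConnected_union_reverse [Finite V] {A B : Finset (V × V)}
    (hA : IsRootedEdgeConnected 2 r A) (hB : IsRootedEdgeConnected 2 r B) :
    TwoEdgeConnected (A ∪ reverse B) := by
  have key : ∀ e, StronglyConnected ((A ∪ reverse B).erase e) := by
    rintro ⟨a, b⟩ u v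
    have hur := hB.reach_erase (b, a) u
    rw [← reach_reverse, ← erase_reverse] at hur
    exact (hur.mono (Finset.erase_subset_erase _ Finset.subset_union_right)).trans
      ((hA.reach_erase (a, b) v).mono (Finset.erase_subset_erase _ Finset.subset_union_left))
  exact twoEdgeConnected_iff.2 ⟨(key (r, r)).mono (Finset.erase_subset _ _), key⟩

theorem IsMinimalTwoEdgeConnectedSubgraph.minimal {F : Finset (V × V)}
    (h : IsMinimalTwoEdgeConnectedSubgraph E F) : Minimal TwoEdgeConnected F :=
  (Finset.minimal_iff_forall_erase fun _ _ ht hts => ht.mono hts).2 h.2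

variable [Fintype V]

theorem card_le_mul_of_indegree_le (h : ∀ v, (E.filter fun e => e.2 = v).card ≤ k) :
    E.card ≤ k * Fintype.card V := by
  rw [Finset.card_eq_sum_card_fiberwise (f := Prod.snd) (t := Finset.univ) (by simp)]
  calc _ ≤ ∑ _v : V, k := Finset.sum_le_sum fun v _ => h v
    _ = _ := by simp [mul_comm]

theorem mul_card_le_of_le_indegree (h : ∀ v, k ≤ (E.filter fun e => e.2 = v).card) :
    k * Fintype.card V ≤ E.card := by
  rw [Finset.card_eq_sum_card_fiberwise (f := Prod.snd) (s := E) (t := Finset.univ) (by simp)]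
  calc _ = ∑ _v : V, k := by simp [mul_comm]
    _ ≤ _ := Finset.sum_le_sum fun v _ => h v

theorem IsMinimalTwoEdgeConnectedSubgraph.card_le {F : Finset (V × V)}
    (h : IsMinimalTwoEdgeConnectedSubgraph E F) : F.card ≤ 4 * Fintype.card V := by
  rcases F.eq_empty_or_nonempty with h0 | ⟨⟨r, -⟩, -⟩
  · simp [h0]
  obtain ⟨A, hAF, hA⟩ := exists_minimal_le_of_wellFoundedLT (IsRootedEdgeConnected 2 r) F
    (h.2.1.isRootedEdgeConnected r)
  obtain ⟨B, hBF, hB⟩ := exists_minimal_le_of_wellFoundedLT (IsRootedEdgeConnected 2 r) (reverse F)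
    (h.2.1.reverse.isRootedEdgeConnected r)
  have hF : A ∪ reverse B = F := h.minimal.eq_of_le
    (twoEdgeConnected_union_reverse hA.prop hB.prop)
    (Finset.union_subset hAF (reverse_subset_iff.2 hBF))
  have hAcard := card_le_mul_of_indegree_le (indegree_le_of_minimal_isRootedEdgeConnected hA)
  have hBcard := card_le_mul_of_indegree_le (indegree_le_of_minimal_isRootedEdgeConnected hB)
  have hunion := Finset.card_union_le A (reverse B)
  rw [hF, card_reverse] at hunion
  omega

theorem TwoEdgeConnected.two_mul_card_le [Nontrivial V] (h : TwoEdgeConnected E) :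
    2 * Fintype.card V ≤ E.card := by
  refine mul_card_le_of_le_indegree fun v => ?_
  obtain ⟨r, hr⟩ := exists_ne v
  refine (h.isRootedEdgeConnected r {v} (by simp) (by simpa using hr)).trans
    (Finset.card_le_card fun e => ?_)
  simp only [mem_inCut, Finset.mem_filter, Finset.mem_singleton]
  tauto

end Cuts

/-! ### Dominators -/

section Paths

variable {V : Type*} {E : Finset (V × V)} {u v : V} {p : List V}

theorem IsPath.reflTransGen_of_mem {R : V → V → Prop} {z : V} (hp : IsPath E u v p)
    (hR : ∀ a b, (a, b) ∈ E → R a b) (hz : z ∈ p) : Relation.ReflTransGen R z v := by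
  refine hp.2.2.2.backwards_induction (Relation.ReflTransGen R · v) p
    (fun a b hab hb => .head (hR a b hab) hb) (fun hne => ?_) z hz
  rw [(List.getLast_eq_iff_getLast?_eq_some hne).2 hp.2.1]

theorem IsPath.reach (hp : IsPath E u v p) : Reach E u v :=
  hp.reflTransGen_of_mem (fun _ _ hab => hab) (List.mem_of_mem_head? hp.1)

theorem exists_isPath_of_reach (h : Reach E u v) : ∃ p, IsPath E u v p := by
  induction h using Relation.ReflTransGen.head_induction_on with
  | refl => exact ⟨[v], by simp [IsPath]⟩
  | @head a b hab _ ih =>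
    obtain ⟨p, hhead, hlast, hnodup, hchain⟩ := ih
    by_cases ha : a ∈ p
    · obtain ⟨l, l', rfl⟩ := List.append_of_mem ha
      exact ⟨a :: l', rfl, by simpa [List.getLast?_append] using hlast,
        (List.nodup_append.1 hnodup).2.1, hchain.right_of_append⟩
    · refine ⟨a :: p, rfl, by simp [List.getLast?_cons, hlast], List.nodup_cons.2 ⟨ha, hnodup⟩,
        hchain.cons fun c hc => ?_⟩
      rw [hhead, Option.mem_some_iff] at hc
      exact hc ▸ hab

theorem IsPath.deleteVertex [DecidableEq V] {y : V} (hp : IsPath E u v p) (hy : y ∉ p) :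
    IsPath (deleteVertex E y) u v p :=
  ⟨hp.1, hp.2.1, hp.2.2.1, hp.2.2.2.imp_of_mem_imp fun _ _ ha hb hab =>
    mem_deleteVertex.2 ⟨hab, fun h => hy (h ▸ ha), fun h => hy (h ▸ hb)⟩⟩

end Paths

section Dominators

variable {V : Type*} (E : Finset (V × V)) (u : V)

/-- There is a walk from `u` to `y` in `(V, E)` that avoids `z`. -/
def ReachAvoiding (z y : V) : Prop :=
  u ≠ z ∧ Relation.ReflTransGen (fun a b => (a, b) ∈ E ∧ b ≠ z) u y

/-- `z` lies on every walk from `u` to `y`. This is `IsDominator` with walks in place of paths. -/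
def Dominates (z y : V) : Prop :=
  ¬ ReachAvoiding E u z y

/-- `z` is a dominator of `y` other than `y`. -/
def StrictlyDominates (z y : V) : Prop :=
  z ≠ y ∧ Dominates E u z y

/-- `c` and `x` have the same strict dominators. For vertices reachable from `u` this says that
they are siblings in the dominator tree (or equal), without naming their common parent. -/
def AreSiblings (c x : V) : Prop :=
  ∀ z, StrictlyDominates E u z c ↔ StrictlyDominates E u z x

/-- Some edge enters `x` from a strict dominator of `x`. -/
def HasDominatingPred (x : V) : Prop :=
  ∃ p, (p, x) ∈ E ∧ StrictlyDominates E u p x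

/-- `(c, x)` is a derived edge: an edge enters `x` from a vertex dominated by `c`, a sibling of `x`
in the dominator tree. -/
def DerivedEdge (c x : V) : Prop :=
  c ≠ x ∧ AreSiblings E u c x ∧ ∃ p, (p, x) ∈ E ∧ Dominates E u c p

variable {E u} {a b c d x y z : V}

theorem ReachAvoiding.ne (h : ReachAvoiding E u z y) : y ≠ z := by
  rcases Relation.ReflTransGen.cases_tail h.2 with h' | ⟨b, -, hb⟩
  · exact h' ▸ h.1
  · exact hb.2

theorem reachAvoiding_root (h : u ≠ z) : ReachAvoiding E u z u :=
  ⟨h, Relation.ReflTransGen.refl⟩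

theorem ReachAvoiding.tail (h : ReachAvoiding E u z a) (hab : (a, b) ∈ E) (hb : b ≠ z) :
    ReachAvoiding E u z b :=
  ⟨h.1, h.2.tail ⟨hab, hb⟩⟩

theorem ReachAvoiding.induction {P : V → Prop} (h : ReachAvoiding E u z y) (root : P u)
    (tail : ∀ a b, ReachAvoiding E u z a → P a → (a, b) ∈ E → b ≠ z → P b) : P y := by
  obtain ⟨hne, h⟩ := h
  induction h with
  | refl => exact root
  | tail hab hbc ih => exact tail _ _ ⟨hne, hab⟩ ih hbc.1 hbc.2

theorem Dominates.refl (y : V) : Dominates E u y y :=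
  fun h => h.ne rfl

theorem dominates_root (y : V) : Dominates E u u y :=
  fun h => h.1 rfl

theorem Dominates.eq_root (h : Dominates E u z u) : z = u :=
  not_not.1 fun hc => h (reachAvoiding_root (Ne.symm hc))

theorem Dominates.of_edge (h : Dominates E u z b) (hab : (a, b) ∈ E) (hb : z ≠ b) :
    Dominates E u z a :=
  fun h' => h (h'.tail hab hb.symm)

theorem Dominates.trans (h : Dominates E u c d) (h' : Dominates E u d y) : Dominates E u c y := by
  intro hc
  have key : ReachAvoiding E u c d ∨ ReachAvoiding E u d y := by
    refine hc.induction (P := fun y => _ ∨ ReachAvoiding E u d y) ?_ fun a b ha ih hab hb => ?_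
    · by_cases hd : u = d
      · exact .inl (hd ▸ reachAvoiding_root hc.1)
      · exact .inr (reachAvoiding_root hd)
    · refine ih.imp_right fun had => ?_
      by_contra hbd
      obtain rfl : b = d := not_not.1 fun hne => hbd (had.tail hab hne)
      exact h (ha.tail hab hb)
  exact key.elim h h'

theorem Dominates.antisymm (hr : Reach E u c) (h : Dominates E u c d) (h' : Dominates E u d c) :
    c = d := by
  by_contra hne
  have key : ∀ y, Reach E u y → ReachAvoiding E u c y ∧ ReachAvoiding E u d y := by
    intro y hy
    induction hy with
    | refl =>
      refine ⟨reachAvoiding_root ?_, reachAvoiding_root ?_⟩ <;> rintro rfl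
      · exact hne h'.eq_root.symm
      · exact hne h.eq_root
    | @tail a b _ hab ih =>
      refine ⟨ih.1.tail hab ?_, ih.2.tail hab ?_⟩ <;> rintro rfl
      · exact h' (ih.2.tail hab hne)
      · exact h (ih.1.tail hab (Ne.symm hne))
  exact (key c hr).1.ne rfl

theorem Dominates.comparable (hr : Reach E u y) (h : Dominates E u c y) (h' : Dominates E u d y) :
    Dominates E u c d ∨ Dominates E u d c := by
  induction hr with
  | refl => exact .inl (h.eq_root ▸ dominates_root _)
  | @tail a b _ hab ih =>
    by_cases hc : c = b
    · exact .inr (hc ▸ h')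
    by_cases hd : d = b
    · exact .inl (hd ▸ h)
    exact ih (h.of_edge hab hc) (h'.of_edge hab hd)

theorem Dominates.mem_of_isPath {p : List V} (h : Dominates E u z x) (hp : IsPath E u x p) :
    z ∈ p := by
  classical
  by_contra hz
  refine h ⟨fun hu => hz (hu ▸ List.mem_of_mem_head? hp.1), ?_⟩
  exact Relation.ReflTransGen.mono (fun a b hab => (mem_deleteVertex.1 hab).imp_right And.right) _ _
    (hp.deleteVertex hz).reach

theorem exists_reachAvoiding_edge (h : Reach E u y) (hy : u ≠ y) :
    ∃ a, ReachAvoiding E u y a ∧ (a, y) ∈ E := by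
  by_contra! hneg
  suffices ∀ x, Reach E u x → ReachAvoiding E u y x from (this y h).ne rfl
  intro x hx
  induction hx with
  | refl => exact reachAvoiding_root hy
  | tail _ hab ih => exact ih.tail hab fun hb => hneg _ ih (hb ▸ hab)

theorem StrictlyDominates.irrefl (x : V) : ¬ StrictlyDominates E u x x :=
  fun h => h.1 rfl

theorem StrictlyDominates.trans (hr : ∀ x, Reach E u x) (h : StrictlyDominates E u a b)
    (h' : StrictlyDominates E u b c) : StrictlyDominates E u a c := by
  refine ⟨?_, h.2.trans h'.2⟩
  rintro rfl
  exact h.1 (h.2.antisymm (hr _) h'.2)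

theorem isStrictOrder_strictlyDominates (hr : ∀ x, Reach E u x) :
    IsStrictOrder V (StrictlyDominates E u) where
  irrefl := StrictlyDominates.irrefl
  trans _ _ _ := StrictlyDominates.trans hr

theorem strictlyDominates_root (hx : x ≠ u) : StrictlyDominates E u u x :=
  ⟨hx.symm, dominates_root x⟩

theorem not_strictlyDominates_root : ¬ StrictlyDominates E u z u :=
  fun h => h.1 h.2.eq_root

theorem AreSiblings.symm (h : AreSiblings E u c x) : AreSiblings E u x c :=
  fun z => (h z).symm

theorem AreSiblings.trans (h : AreSiblings E u c x) (h' : AreSiblings E u x y) :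
    AreSiblings E u c y :=
  fun z => (h z).trans (h' z)

theorem AreSiblings.ne_root (h : AreSiblings E u c x) (hx : x ≠ u) : c ≠ u := by
  rintro rfl
  exact not_strictlyDominates_root ((h c).2 (strictlyDominates_root hx))

theorem AreSiblings.eq_of_dominates_left (h : AreSiblings E u c d) (hcd : Dominates E u c d) :
    c = d :=
  not_not.1 fun hne => StrictlyDominates.irrefl c ((h c).2 ⟨hne, hcd⟩)

theorem AreSiblings.eq_of_dominates (hr : ∀ x, Reach E u x) (h : AreSiblings E u c d)
    (hc : Dominates E u c y) (hd : Dominates E u d y) : c = d :=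
  (hc.comparable (hr y) hd).elim h.eq_of_dominates_left
    fun hdc => (h.symm.eq_of_dominates_left hdc).symm

theorem DerivedEdge.ne_root (h : DerivedEdge E u c x) : c ≠ u := by
  by_cases hx : x = u
  · exact hx ▸ h.1
  · exact h.2.1.ne_root hx

theorem exists_derivedEdge_of_edge [Finite V] (hr : ∀ x, Reach E u x) (hpx : (a, x) ∈ E)
    (hxa : ¬ Dominates E u x a) (hax : ¬ StrictlyDominates E u a x) :
    ∃ c, Dominates E u c a ∧ DerivedEdge E u c x := by
  have := isStrictOrder_strictlyDominates hr
  obtain ⟨c, ⟨hca, hcx⟩, hmin⟩ :=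
    (Finite.wellFounded_of_trans_of_irrefl (StrictlyDominates E u)).has_min
      {d | Dominates E u d a ∧ ¬ StrictlyDominates E u d x} ⟨a, Dominates.refl a, hax⟩
  have hne : c ≠ x := fun h => hxa (h ▸ hca)
  refine ⟨c, hca, hne, fun z => ⟨fun hz => ?_, fun hz => ?_⟩, a, hpx, hca⟩
  · by_contra hzx
    exact hmin z ⟨hz.2.trans hca, hzx⟩ hz
  · have hza : Dominates E u z a := hz.2.of_edge hpx hz.1
    refine ⟨fun h => hcx (h ▸ hz), ?_⟩
    rcases hza.comparable (hr a) hca with hzc | hcz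
    · exact hzc
    · exact absurd ⟨hne, hcz.trans hz.2⟩ hcx

/-- Follow a walk from `u` to some `x ∈ X`, avoiding `z` if possible: the first edge after which
the walk is dominated by a sibling of `x` in `X` gives a dominating predecessor or a derived
edge. -/
theorem exists_hasDominatingPred_or_derivedEdge [Finite V] (hr : ∀ x, Reach E u x) {X : Set V}
    (hX : X.Nonempty) (hu : u ∉ X) (z : V) :
    (∃ y ∈ X, HasDominatingPred E u y) ∨
      ∃ y ∈ X, ∃ c, c ∉ X ∧ c ≠ z ∧ DerivedEdge E u c y := by
  obtain ⟨x, hx⟩ := hX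
  by_contra! hneg
  obtain ⟨hpred, hderived⟩ := hneg
  let P (y : V) : Prop := ∀ c ∈ X, AreSiblings E u c x → ¬ Dominates E u c y
  have root : P u := fun c hc _ h => hu (h.eq_root ▸ hc)
  have step : ∀ a b, (a, b) ∈ E → (Dominates E u z x ∨ ¬ Dominates E u z a) → P a → P b := by
    intro a b hab hz ha c hc hcx hcb
    obtain rfl : c = b := not_not.1 fun hne => ha c hc hcx (hcb.of_edge hab hne)
    obtain ⟨d, hda, hdc⟩ := exists_derivedEdge_of_edge hr hab (ha c hc hcx)
      fun h => hpred c hc ⟨a, hab, h⟩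
    have hdx := hdc.2.1.trans hcx
    have hdX : d ∉ X := fun hd => ha d hd hdx hda
    obtain rfl : d = z := not_not.1 fun hne => hderived c hc d hdX hne hdc
    exact hz.elim (fun hz => hdX (hdx.eq_of_dominates_left hz ▸ hx)) fun hz => hz hda
  suffices P x from this x hx (fun _ => Iff.rfl) (Dominates.refl x)
  by_cases hz : Dominates E u z x
  · refine Relation.ReflTransGen.rec root (fun _ hab ih => step _ _ hab (.inl hz) ih) (hr x)
  · exact (not_not.1 hz).induction root
      fun a b ha ih hab _ => step a b hab (.inr (not_not.2 ha)) ih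

end Dominators

/-! ### Low-high orders -/

section SiblingOrders

variable {V : Type*} (E : Finset (V × V)) (u : V) (lt : V → V → Prop)

/-- The preorder of the dominator tree in which siblings are visited in the order `lt`: `x` is a
proper ancestor of `y`, or the branches of `x` and `y` start at siblings `c` and `c'` with
`lt c c'`. -/
def Precedes (x y : V) : Prop :=
  StrictlyDominates E u x y ∨
    ∃ c c', Dominates E u c x ∧ Dominates E u c' y ∧ AreSiblings E u c c' ∧ lt c c'

/-- `(p, x)` is an edge from a vertex that precedes `x` because it dominates `x` or because it lies
below a smaller sibling of `x`. Every choice of such `p` for all `x ≠ u` yields a spanning tree. -/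
def IsParentCandidate (p x : V) : Prop :=
  (p, x) ∈ E ∧
    (StrictlyDominates E u p x ∨ ∃ c, Dominates E u c p ∧ AreSiblings E u c x ∧ lt c x)

variable {E u lt} {x z : V}

theorem IsParentCandidate.precedes {p : V} (h : IsParentCandidate E u lt p x) :
    Precedes E u lt p x :=
  h.2.imp_right fun ⟨c, hcp, hcx, hlt⟩ => ⟨c, x, hcp, Dominates.refl x, hcx, hlt⟩

variable [IsStrictOrder V lt] (hr : ∀ x, Reach E u x)
include hr

theorem Precedes.irrefl (x : V) : ¬ Precedes E u lt x x := by
  rintro (h | ⟨c, c', hc, hc', hcc', hlt⟩)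
  · exact StrictlyDominates.irrefl x h
  · exact _root_.irrefl c' (hcc'.eq_of_dominates hr hc hc' ▸ hlt)

theorem Precedes.trans {y : V} (hxy : Precedes E u lt x y) (hyz : Precedes E u lt y z) :
    Precedes E u lt x z := by
  rcases hxy with hxy | ⟨c, c', hcx, hcy, hcc', hlt⟩ <;>
    rcases hyz with hyz | ⟨d, d', hdy, hdz, hdd', hlt'⟩
  · exact .inl (hxy.trans hr hyz)
  · rcases hxy.2.comparable (hr y) hdy with hxd | hdx
    · by_cases hne : x = d
      · exact .inr ⟨d, d', hne ▸ Dominates.refl x, hdz, hdd', hlt'⟩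
      · have hxd' := (hdd' x).1 ⟨hne, hxd⟩
        by_cases hdz' : d' = z
        · exact .inl (hdz' ▸ hxd')
        · exact .inl (hxd'.trans hr ⟨hdz', hdz⟩)
    · exact .inr ⟨d, d', hdx, hdz, hdd', hlt'⟩
  · exact .inr ⟨c, c', hcx, hcy.trans hyz.2, hcc', hlt⟩
  · by_cases hne : c' = d
    · subst hne
      exact .inr ⟨c, d', hcx, hdz, hcc'.trans hdd', _root_.trans hlt hlt'⟩
    rcases hcy.comparable (hr y) hdy with hc'd | hdc'
    · exact .inr ⟨c, c', hcx, ((hdd' c').1 ⟨hne, hc'd⟩).2.trans hdz, hcc', hlt⟩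
    · exact .inr ⟨d, d', ((hcc' d).2 ⟨Ne.symm hne, hdc'⟩).2.trans hcx, hdz, hdd', hlt'⟩

theorem isStrictOrder_precedes : IsStrictOrder V (Precedes E u lt) where
  irrefl := Precedes.irrefl hr
  trans _ _ _ := Precedes.trans hr

theorem strictlyDominates_of_precedes_of_precedes_swap (h : Precedes E u lt z x)
    (h' : Precedes E u (Function.swap lt) z x) : StrictlyDominates E u z x := by
  rcases h with h | ⟨c, c', hcz, hcx, hcc', hlt⟩
  · exact h
  rcases h' with h | ⟨d, d', hdz, hdx, hdd', hgt⟩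
  · exact h
  exfalso
  by_cases hne : c = d
  · subst hne
    exact asymm hlt ((hcc'.symm.trans hdd').eq_of_dominates hr hcx hdx ▸ hgt)
  rcases hcz.comparable (hr z) hdz with hcd | hdc
  · have hcx' := ((hdd' c).1 ⟨hne, hcd⟩).2.trans hdx
    exact irrefl c' (hcc'.eq_of_dominates hr hcx' hcx ▸ hlt)
  · have hdx' := ((hcc' d).1 ⟨Ne.symm hne, hdc⟩).2.trans hcx
    exact irrefl d' (hdd'.eq_of_dominates hr hdx' hdx ▸ hgt)

end SiblingOrders

section ParentTrees

variable {V : Type*} [Fintype V] [DecidableEq V] {E : Finset (V × V)} {u : V}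
  {lt : V → V → Prop} {a b : V → V}

/-- The edge set of the tree with root `u` in which the parent of `x ≠ u` is `a x`; the value of
`a` at `u` plays no role. -/
def parentTree (u : V) (a : V → V) : Finset (V × V) :=
  (Finset.univ.erase u).image fun x => (a x, x)

theorem mem_parentTree {p x : V} : (p, x) ∈ parentTree u a ↔ x ≠ u ∧ p = a x := by
  simp only [parentTree, Finset.mem_image, Finset.mem_erase, Finset.mem_univ, and_true,
    Prod.mk.injEq]
  constructor
  · rintro ⟨y, hy, rfl, rfl⟩
    exact ⟨hy, rfl⟩
  · rintro ⟨hx, rfl⟩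
    exact ⟨x, hx, rfl, rfl⟩

variable [IsStrictOrder V lt] (hr : ∀ x, Reach E u x)
  (ha : ∀ x, x ≠ u → IsParentCandidate E u lt (a x) x)
include hr ha

theorem isSpanningTree_parentTree : IsSpanningTree Set.univ E u (parentTree u a) := by
  refine ⟨trivial, ?_, fun _ _ _ => ⟨trivial, trivial⟩, fun p hp => (mem_parentTree.1 hp).1 rfl,
    fun p q x hp hq => (mem_parentTree.1 hp).2.trans (mem_parentTree.1 hq).2.symm, ?_⟩
  · rintro ⟨p, x⟩ hpx
    obtain ⟨hx, rfl⟩ := mem_parentTree.1 hpx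
    exact (ha x hx).1
  · have := isStrictOrder_precedes (lt := lt) hr
    intro x _
    induction x using
      (Finite.wellFounded_of_trans_of_irrefl (Precedes E u lt)).induction with
    | _ x ih =>
      by_cases hx : x = u
      · exact hx ▸ Reach.refl _ _
      · exact Relation.ReflTransGen.tail (ih _ (ha x hx).precedes trivial)
          (mem_parentTree.2 ⟨hx, rfl⟩)

theorem eq_or_precedes_of_isPath_parentTree {x z : V} {p : List V}
    (hp : IsPath (parentTree u a) u x p) (hz : z ∈ p) : z = x ∨ Precedes E u lt z x := by
  have := isStrictOrder_precedes (lt := lt) hr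
  have hzx : Relation.ReflTransGen (Precedes E u lt) z x := by
    refine hp.reflTransGen_of_mem (fun c d hcd => ?_) hz
    obtain ⟨hd, rfl⟩ := mem_parentTree.1 hcd
    exact (ha d hd).precedes
  rw [Relation.reflTransGen_iff_eq_or_transGen, Relation.transGen_eq_self] at hzx
  exact hzx.imp_left Eq.symm

theorem areIndependentTrees_parentTree
    (hb : ∀ x, x ≠ u → IsParentCandidate E u (Function.swap lt) (b x) x) :
    AreIndependentTrees E u (parentTree u a) (parentTree u b) := by
  refine ⟨isSpanningTree_parentTree hr ha, isSpanningTree_parentTree hr hb,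
    fun x _ p r hp hr' z hzp hzr q hq => Dominates.mem_of_isPath ?_ hq⟩
  rcases eq_or_precedes_of_isPath_parentTree hr ha hp hzp with rfl | hlt
  · exact Dominates.refl z
  rcases eq_or_precedes_of_isPath_parentTree hr hb hr' hzr with rfl | hgt
  · exact Dominates.refl z
  exact (strictlyDominates_of_precedes_of_precedes_swap hr hlt hgt).2

end ParentTrees

section LowHighOrders

variable {V : Type*} (Rt : V → Prop) (D : V → V → Prop)

/-- `y` is reached, along `D` and within `W`, from a vertex of `W` with `Rt`. In a flow graph, `Rt`
is `HasDominatingPred` and `D` is `DerivedEdge`. -/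
def RootReachable (W : Set V) (y : V) : Prop :=
  ∃ h ∈ W, Rt h ∧ Relation.ReflTransGen (fun a b => D a b ∧ b ∈ W) h y

/-- `v` has `Rt` or a `D`-predecessor that is placed already, `U` being the set of vertices still to
be placed. -/
def IsLow (U : Set V) (v : V) : Prop :=
  Rt v ∨ ∃ c, c ∉ U ∧ D c v

/-- `v` can be the next vertex of a low-high order: it is low, and the vertices remaining after it
stay reachable from those with `Rt`. -/
def Placeable (U : Set V) (v : V) : Prop :=
  IsLow Rt D U v ∧ ∀ x ∈ U \ {v}, RootReachable Rt D (U \ {v}) x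

/-- The vertices of `U` that are cut off from those with `Rt` by removing `v`. -/
def shadow (U : Set V) (v : V) : Set V :=
  {y | y ∈ U \ {v} ∧ ¬ RootReachable Rt D (U \ {v}) y}

variable {Rt D} {U W : Set V} {a b v x y z : V}

theorem RootReachable.of_root (hy : y ∈ W) (h : Rt y) : RootReachable Rt D W y :=
  ⟨y, hy, h, Relation.ReflTransGen.refl⟩

theorem RootReachable.tail (h : RootReachable Rt D W a) (hab : D a b) (hb : b ∈ W) :
    RootReachable Rt D W b :=
  let ⟨r, hr, hRt, hra⟩ := h
  ⟨r, hr, hRt, hra.tail ⟨hab, hb⟩⟩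

theorem RootReachable.induction {P : V → Prop} (h : RootReachable Rt D W y)
    (root : ∀ x ∈ W, Rt x → P x)
    (tail : ∀ a b, RootReachable Rt D W a → P a → D a b → b ∈ W → P b) : P y := by
  obtain ⟨r, hr, hRt, hry⟩ := h
  induction hry with
  | refl => exact root r hr hRt
  | tail hra hab ih => exact tail _ _ ⟨r, hr, hRt, hra⟩ ih hab.1 hab.2

theorem RootReachable.mem (h : RootReachable Rt D W y) : y ∈ W :=
  h.induction (fun _ hx _ => hx) fun _ _ _ _ _ hb => hb

/-- A walk to `v` that stays in `U` and is cut when it first meets `v` or `x`. -/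
theorem RootReachable.sdiff_singleton_or (hvx : v ≠ x) (h : RootReachable Rt D U v) :
    RootReachable Rt D (U \ {x}) v ∨ RootReachable Rt D (U \ {v}) x := by
  suffices key : ∀ w, RootReachable Rt D U w →
      (RootReachable Rt D (U \ {x}) v ∨ RootReachable Rt D (U \ {v}) x) ∨
      RootReachable Rt D (U \ {x}) w ∧ RootReachable Rt D (U \ {v}) w from
    (key v h).resolve_right fun hv => hv.2.mem.2 rfl
  intro w hw
  refine hw.induction (P := fun w => _ ∨ RootReachable Rt D (U \ {x}) w ∧
    RootReachable Rt D (U \ {v}) w) (fun r hr hRt => ?_) fun a b _ ih hab hb => ?_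
  · by_cases hrv : r = v
    · exact .inl (.inl (.of_root ⟨hrv ▸ hr, hvx⟩ (hrv ▸ hRt)))
    by_cases hrx : r = x
    · exact .inl (.inr (.of_root ⟨hrx ▸ hr, hvx.symm⟩ (hrx ▸ hRt)))
    exact .inr ⟨.of_root ⟨hr, hrx⟩ hRt, .of_root ⟨hr, hrv⟩ hRt⟩
  · refine ih.elim .inl fun ⟨hax, hav⟩ => ?_
    by_cases hbv : b = v
    · exact .inl (.inl (hax.tail (hbv ▸ hab) ⟨hbv ▸ hb, hvx⟩))
    by_cases hbx : b = x
    · exact .inl (.inr (hav.tail (hbx ▸ hab) ⟨hbx ▸ hb, hvx.symm⟩))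
    exact .inr ⟨hax.tail hab ⟨hb, hbx⟩, hav.tail hab ⟨hb, hbv⟩⟩

theorem RootReachable.sdiff_singleton_of_mem_shadow (hx : x ∈ shadow Rt D U v)
    (h : RootReachable Rt D (U \ {v}) y) : RootReachable Rt D (U \ {x}) y := by
  have hne : ∀ w, RootReachable Rt D (U \ {v}) w → w ≠ x := fun w hw h => hx.2 (h ▸ hw)
  exact h.induction (fun r hr hRt => .of_root ⟨hr.1, hne r (.of_root hr hRt)⟩ hRt)
    fun a b ha ih hab hb => ih.tail hab ⟨hb.1, hne b (ha.tail hab hb)⟩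

theorem shadow_ssubset_of_mem_shadow (hv : RootReachable Rt D U v) (hx : x ∈ shadow Rt D U v) :
    shadow Rt D U x ⊂ shadow Rt D U v := by
  refine ⟨fun y hy => ⟨⟨hy.1.1, ?_⟩, fun h => hy.2 (h.sdiff_singleton_of_mem_shadow hx)⟩,
    fun h => (h hx).1.2 rfl⟩
  rintro rfl
  exact (hv.sdiff_singleton_or (Ne.symm hx.1.2)).elim hy.2 hx.2

/-- Take a low vertex with smallest shadow. Were the shadow nonempty, some edge would enter it from
a vertex other than `v`; that vertex is placed, so the edge ends in a low vertex, whose shadow is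
smaller. -/
theorem exists_placeable [Finite V] (hU : U.Nonempty)
    (hcut : ∀ X ⊆ U, X.Nonempty → ∀ z,
      (∃ y ∈ X, Rt y) ∨ ∃ y ∈ X, ∃ c, c ∉ X ∧ c ≠ z ∧ D c y)
    (hreach : ∀ x ∈ U, RootReachable Rt D U x) : ∃ v ∈ U, Placeable Rt D U v := by
  obtain ⟨w, hw⟩ := hU
  obtain ⟨r, hrU, hRt, -⟩ := hreach w hw
  obtain ⟨v, ⟨hvU, hlow⟩, hmin⟩ := exists_minimalFor_of_wellFoundedLT
    (fun v => v ∈ U ∧ IsLow Rt D U v) (shadow Rt D U) ⟨r, hrU, .inl hRt⟩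
  suffices hempty : shadow Rt D U v = ∅ from
    ⟨v, hvU, hlow, fun x hx => by_contra fun h => Set.notMem_empty x (hempty ▸ ⟨hx, h⟩)⟩
  by_contra hne
  obtain ⟨x, hx, hRt⟩ | ⟨x, hx, c, hc, hcv, hcx⟩ :=
    hcut (shadow Rt D U v) (fun y hy => hy.1.1) (Set.nonempty_iff_ne_empty.2 hne) v
  · exact hx.2 (.of_root hx.1 hRt)
  have hcU : c ∉ U := fun hcU => hc ⟨⟨hcU, hcv⟩, fun h => hx.2 (h.tail hcx hx.1)⟩
  have hss := shadow_ssubset_of_mem_shadow (hreach v hvU) hx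
  exact hss.2 (hmin ⟨hx.1.1, .inr ⟨c, hcU, hcx⟩⟩ hss.1)

variable (Rt D) in
/-- The state of the construction of a low-high order: `lt` orders the vertices placed so far, all
vertices but those of `U` and the root `u`. Every placed vertex has `Rt`, or it has both a smaller
and a larger `D`-predecessor, where the vertices of `U` count as larger. -/
structure IsPartialLowHighOrder (u : V) (U : Set V) (lt : V → V → Prop) : Prop where
  root_notMem : u ∉ U
  reachable : ∀ x ∈ U, RootReachable Rt D U x
  isStrictOrder : IsStrictOrder V lt
  placed : ∀ x y, lt x y → x ∉ U ∧ x ≠ u ∧ y ∉ U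
  low : ∀ x, x ∉ U → x ≠ u → Rt x ∨ ∃ c, D c x ∧ lt c x
  high : ∀ x, x ∉ U → x ≠ u → Rt x ∨ ∃ c, D c x ∧ (lt x c ∨ c ∈ U)

/-- The order `lt` with `v` put after all vertices that are neither in `U` nor equal to `u`. -/
def placeLast (u : V) (U : Set V) (lt : V → V → Prop) (v : V) (c x : V) : Prop :=
  lt c x ∨ x = v ∧ c ∉ U ∧ c ≠ u

variable {u : V} {lt : V → V → Prop}

theorem IsPartialLowHighOrder.isStrictOrder_placeLast (h : IsPartialLowHighOrder Rt D u U lt)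
    (hv : v ∈ U) : IsStrictOrder V (placeLast u U lt v) where
  irrefl := by
    rintro x (hx | ⟨rfl, hx, -⟩)
    · exact h.isStrictOrder.irrefl x hx
    · exact hx hv
  trans := by
    rintro x y z (hxy | ⟨rfl, -, -⟩) (hyz | ⟨rfl, hy, -⟩)
    · exact .inl (h.isStrictOrder.trans _ _ _ hxy hyz)
    · exact .inr ⟨rfl, (h.placed _ _ hxy).1, (h.placed _ _ hxy).2.1⟩
    · exact absurd hv (h.placed _ _ hyz).1
    · exact absurd hv hy

theorem RootReachable.exists_pred (h : RootReachable Rt D U v) :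
    Rt v ∨ ∃ c ∈ U \ {v}, D c v := by
  suffices ∀ w, RootReachable Rt D U w → w = v → Rt v ∨ ∃ c ∈ U \ {v}, D c v from this v h rfl
  intro w hw
  refine hw.induction (P := fun w => w = v → _) (fun r _ hRt hrv => .inl (hrv ▸ hRt))
    fun a b ha ih hab _ hbv => ?_
  by_cases hav : a = v
  · exact ih hav
  · exact .inr ⟨a, ⟨ha.mem, hav⟩, hbv ▸ hab⟩

theorem IsPartialLowHighOrder.place (h : IsPartialLowHighOrder Rt D u U lt)
    (hD : ∀ c x, D c x → c ≠ u) (hv : v ∈ U) (hp : Placeable Rt D U v) :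
    IsPartialLowHighOrder Rt D u (U \ {v}) (placeLast u U lt v) where
  root_notMem hu := h.root_notMem hu.1
  reachable := hp.2
  isStrictOrder := h.isStrictOrder_placeLast hv
  placed := by
    rintro x y (hxy | ⟨rfl, hx, hxu⟩)
    · obtain ⟨hx, hxu, hy⟩ := h.placed _ _ hxy
      exact ⟨fun hx' => hx hx'.1, hxu, fun hy' => hy hy'.1⟩
    · exact ⟨fun hx' => hx hx'.1, hxu, fun hy => hy.2 rfl⟩
  low x hx hxu := by
    by_cases hxv : x = v
    · subst hxv
      exact hp.1.imp_right fun ⟨c, hc, hcx⟩ => ⟨c, hcx, .inr ⟨rfl, hc, hD _ _ hcx⟩⟩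
    · exact (h.low x (fun hxU => hx ⟨hxU, hxv⟩) hxu).imp_right
        fun ⟨c, hcx, hlt⟩ => ⟨c, hcx, .inl hlt⟩
  high x hx hxu := by
    by_cases hxv : x = v
    · subst hxv
      exact (h.reachable x hv).exists_pred.imp_right fun ⟨c, hc, hcx⟩ => ⟨c, hcx, .inr hc⟩
    · have hxU : x ∉ U := fun hxU => hx ⟨hxU, hxv⟩
      refine (h.high x hxU hxu).imp_right fun ⟨c, hcx, hc⟩ => ⟨c, hcx, ?_⟩
      rcases hc with hlt | hc
      · exact .inl (.inl hlt)
      by_cases hcv : c = v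
      · exact .inl (.inr ⟨hcv, hxU, hxu⟩)
      · exact .inr ⟨hc, hcv⟩

theorem IsPartialLowHighOrder.exists_total [Finite V] (h : IsPartialLowHighOrder Rt D u U lt)
    (hD : ∀ c x, D c x → c ≠ u)
    (hcut : ∀ X : Set V, X.Nonempty → u ∉ X → ∀ z,
      (∃ y ∈ X, Rt y) ∨ ∃ y ∈ X, ∃ c, c ∉ X ∧ c ≠ z ∧ D c y) :
    ∃ lt', IsPartialLowHighOrder Rt D u ∅ lt' := by
  induction U using WellFoundedLT.induction generalizing lt with
  | _ U ih =>
    rcases U.eq_empty_or_nonempty with rfl | hU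
    · exact ⟨lt, h⟩
    · obtain ⟨v, hv, hp⟩ := exists_placeable hU
        (fun X hXU hX => hcut X hX fun hu => h.root_notMem (hXU hu)) h.reachable
      exact ih _ (Set.sdiff_singleton_ssubset.2 hv) (h.place hD hv hp)

theorem isPartialLowHighOrder_empty
    (hcut : ∀ X : Set V, X.Nonempty → u ∉ X → ∀ z,
      (∃ y ∈ X, Rt y) ∨ ∃ y ∈ X, ∃ c, c ∉ X ∧ c ≠ z ∧ D c y) :
    IsPartialLowHighOrder Rt D u {u}ᶜ fun _ _ => False where
  root_notMem hu := hu rfl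
  reachable x hx := by
    by_contra hneg
    obtain ⟨y, hy, hRt⟩ | ⟨y, hy, c, hc, hcu, hcy⟩ :=
      hcut {y | y ≠ u ∧ ¬ RootReachable Rt D {u}ᶜ y} ⟨x, hx, hneg⟩ (fun hu => hu.1 rfl) u
    · exact hy.2 (.of_root hy.1 hRt)
    · exact hc ⟨hcu, fun h => hy.2 (h.tail hcy hy.1)⟩
  isStrictOrder := { irrefl := fun _ h => h, trans := fun _ _ _ h => h.elim }
  placed _ _ h := h.elim
  low _ hx hxu := absurd hxu hx
  high _ hx hxu := absurd hxu hx

theorem IsPartialLowHighOrder.exists_isParentCandidate {E : Finset (V × V)}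
    (h : IsPartialLowHighOrder (HasDominatingPred E u) (DerivedEdge E u) u ∅ lt) (hx : x ≠ u) :
    (∃ p, IsParentCandidate E u lt p x) ∧
      ∃ p, IsParentCandidate E u (Function.swap lt) p x := by
  constructor
  · rcases h.low x (Set.notMem_empty x) hx with ⟨p, hpx, hp⟩ | ⟨c, ⟨-, hc, p, hpx, hp⟩, hlt⟩
    · exact ⟨p, hpx, .inl hp⟩
    · exact ⟨p, hpx, .inr ⟨c, hp, hc, hlt⟩⟩
  · rcases h.high x (Set.notMem_empty x) hx with ⟨p, hpx, hp⟩ | ⟨c, ⟨-, hc, p, hpx, hp⟩, hgt⟩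
    · exact ⟨p, hpx, .inl hp⟩
    · exact ⟨p, hpx, .inr ⟨c, hp, hc, hgt.resolve_right (Set.notMem_empty c)⟩⟩

theorem exists_areIndependentTrees [Finite V] {E : Finset (V × V)}
    (hr : ∀ x, Reach E u x) : ∃ A B, AreIndependentTrees E u A B := by
  classical
  have := Fintype.ofFinite V
  have hcut := fun (X : Set V) (hX : X.Nonempty) (hu : u ∉ X) =>
    exists_hasDominatingPred_or_derivedEdge hr hX hu
  obtain ⟨lt, h⟩ :=
    (isPartialLowHighOrder_empty hcut).exists_total (fun _ _ => DerivedEdge.ne_root) hcut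
  have := h.isStrictOrder
  choose! a ha using fun x hx => (h.exists_isParentCandidate (x := x) hx).1
  choose! b hb using fun x hx => (h.exists_isParentCandidate (x := x) hx).2
  exact ⟨_, _, areIndependentTrees_parentTree hr ha hb⟩

end LowHighOrders

section LeastParents

variable {V : Type*} [Fintype V] [LinearOrder V]

open Classical in
/-- The edges from the least possible parent of each vertex other than `u` to that vertex. -/
noncomputable def leastParentTree (E : Finset (V × V)) (u : V) (lt : V → V → Prop) :
    Finset (V × V) :=
  Finset.univ.filter fun e => e.2 ≠ u ∧ IsLeast {v | IsParentCandidate E u lt v e.2} e.1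

variable {E : Finset (V × V)} {u : V} {lt : V → V → Prop}

theorem mem_leastParentTree {p x : V} : (p, x) ∈ leastParentTree E u lt ↔
    x ≠ u ∧ IsLeast {v | IsParentCandidate E u lt v x} p := by
  simp [leastParentTree]

omit [Fintype V] in
theorem exists_isLeast [Finite V] {s : Set V} (hs : s.Nonempty) : ∃ a, IsLeast s a :=
  Set.exists_min_image s id s.toFinite hs

theorem exists_leastParentTree_eq_parentTree
    (h : ∀ x, x ≠ u → ∃ p, IsParentCandidate E u lt p x) : ∃ a : V → V,
      (∀ x, x ≠ u → IsParentCandidate E u lt (a x) x) ∧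
        leastParentTree E u lt = parentTree u a := by
  choose! a ha using fun x hx => exists_isLeast (s := {v | IsParentCandidate E u lt v x}) (h x hx)
  refine ⟨a, fun x hx => (ha x hx).1, Finset.ext fun ⟨p, x⟩ => ?_⟩
  rw [mem_leastParentTree, mem_parentTree]
  exact and_congr_right fun hx => ⟨fun hp => hp.unique (ha x hx), fun hp => hp ▸ ha x hx⟩

theorem IsPartialLowHighOrder.areIndependentTrees_leastParentTree (hr : ∀ x, Reach E u x)
    (h : IsPartialLowHighOrder (HasDominatingPred E u) (DerivedEdge E u) u ∅ lt) :
    AreIndependentTrees E u (leastParentTree E u lt)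
      (leastParentTree E u (Function.swap lt)) := by
  have := h.isStrictOrder
  obtain ⟨a, ha, hA⟩ := exists_leastParentTree_eq_parentTree (lt := lt)
    fun x hx => (h.exists_isParentCandidate (x := x) hx).1
  obtain ⟨b, hb, hB⟩ := exists_leastParentTree_eq_parentTree (lt := Function.swap lt)
    fun x hx => (h.exists_isParentCandidate (x := x) hx).2
  rw [hA, hB]
  exact areIndependentTrees_parentTree hr ha hb

end LeastParents

/-! ### Trees and certificates -/

section SpanningTrees

variable {V : Type*} {S : Set V} {E A C : Finset (V × V)} {q y : V}

theorem IsSpanningTree.card_le [Fintype V] (h : IsSpanningTree S E q A) :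
    A.card ≤ Fintype.card V := by
  rw [← Finset.card_univ]
  refine Finset.card_le_card_of_injOn Prod.snd (fun _ _ => Finset.mem_coe.2 (Finset.mem_univ _)) ?_
  rintro ⟨a, v⟩ ha ⟨b, w⟩ hb (rfl : v = w)
  rw [h.2.2.2.2.1 a b v ha hb]

variable [DecidableEq V]

theorem IsSpanningTree.reach_deleteVertex (h : IsSpanningTree {y}ᶜ (deleteVertex E y) q A)
    (hAC : A ⊆ C) {x : V} (hx : x ≠ y) : Reach (deleteVertex C y) q x := by
  refine (h.2.2.2.2.2 x hx).mono ?_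
  rintro ⟨a, b⟩ hab
  exact mem_deleteVertex.2 ⟨hAC hab, h.2.2.1 a b hab⟩

theorem not_reach_erase_of_minimal {a v : V}
    (hA : Minimal (fun A => ∀ x ∈ S, Reach A q x) A) (hav : (a, v) ∈ A) :
    ¬ Reach (A.erase (a, v)) q v := by
  intro hv
  refine hA.not_prop_of_lt (Finset.erase_ssubset hav) fun x hx => ?_
  have hqx := hA.prop x hx
  clear hx
  induction hqx with
  | refl => exact Reach.refl _ _
  | @tail b c _ hbc ih =>
    by_cases hne : (b, c) = (a, v)
    · obtain ⟨-, rfl⟩ := Prod.mk.inj hne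
      exact hv
    · exact Relation.ReflTransGen.tail ih (Finset.mem_erase.2 ⟨hne, hbc⟩)

omit [DecidableEq V] in
/-- If two edges entered `v`, the first visit to `v` would use only one of them. -/
theorem eq_of_mem_of_mem_of_minimal {a b v : V}
    (hA : Minimal (fun A => ∀ x ∈ S, Reach A q x) A) (hv : v ∈ S) (ha : (a, v) ∈ A)
    (hb : (b, v) ∈ A) : a = b := by
  classical
  by_cases hqv : q = v
  · exact absurd (hqv ▸ Reach.refl _ _) (not_reach_erase_of_minimal hA ha)
  obtain ⟨p, hp, hpv⟩ := exists_reachAvoiding_edge (hA.prop v hv) hqv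
  have eq_first : ∀ c, (c, v) ∈ A → c = p := by
    intro c hc
    by_contra hne
    refine not_reach_erase_of_minimal hA hc (Relation.ReflTransGen.tail (b := p) ?_ ?_)
    · exact Relation.ReflTransGen.mono (fun x y hxy => Finset.mem_erase.2
        ⟨fun h => hxy.2 (Prod.mk.inj h).2, hxy.1⟩) _ _ hp.2
    · exact Finset.mem_erase.2 ⟨fun h => hne (Prod.mk.inj h).1.symm, hpv⟩
  exact (eq_first a ha).trans (eq_first b hb).symm

omit [DecidableEq V] in
theorem isSpanningTree_of_minimal (hq : q ∈ S) (hE : ∀ a b, (a, b) ∈ E → a ∈ S ∧ b ∈ S)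
    (hAE : A ⊆ E) (hA : Minimal (fun A => ∀ v ∈ S, Reach A q v) A) : IsSpanningTree S E q A := by
  classical
  exact ⟨hq, hAE, fun a b hab => hE a b (hAE hab),
    fun _ ha => not_reach_erase_of_minimal hA ha (Reach.refl _ _),
    fun a _ v ha hb => eq_of_mem_of_mem_of_minimal hA (hE a v (hAE ha)).2 ha hb, hA.prop⟩

theorem exists_isSpanningTree (hq : q ≠ y) (h : ∀ x, x ≠ y → Reach (deleteVertex E y) q x) :
    ∃ A, IsSpanningTree {y}ᶜ (deleteVertex E y) q A := by
  obtain ⟨A, hAE, hA⟩ := exists_minimal_le_of_wellFoundedLT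
    (fun A => ∀ v ∈ ({y}ᶜ : Set V), Reach A q v) (deleteVertex E y) h
  exact ⟨A, isSpanningTree_of_minimal hq (fun a b hab => (mem_deleteVertex.1 hab).2) hAE hA⟩

end SpanningTrees

section Certificates

variable {V : Type*} [DecidableEq V] {E F A B A₁ A₂ B₁ B₂ C : Finset (V × V)} {q u w x y : V}

theorem not_isDominator_of_reach_deleteVertex (hx : x ≠ y) (h : Reach (deleteVertex E y) u x) :
    ¬ IsDominator E u y x := by
  intro hd
  obtain ⟨p, hp⟩ := exists_isPath_of_reach h
  have hpE : IsPath E u x p :=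
    ⟨hp.1, hp.2.1, hp.2.2.1, hp.2.2.2.imp fun _ _ hab => deleteVertex_subset E y hab⟩
  rcases Relation.ReflTransGen.cases_head
    (hp.reflTransGen_of_mem (fun _ _ hab => hab) (hd p hpE)) with hyx | ⟨c, hyc, -⟩
  · exact hx hyx.symm
  · exact (mem_deleteVertex.1 hyc).2.1 rfl

theorem AreIndependentTrees.union_subset (h : AreIndependentTrees E u A B) : A ∪ B ⊆ E :=
  Finset.union_subset h.1.2.1 h.2.1.2.1

theorem AreIndependentTrees.card_union_le [Fintype V] (h : AreIndependentTrees E u A B) :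
    (A ∪ B).card ≤ 2 * Fintype.card V := by
  have := Finset.card_union_le A B
  have := h.1.card_le
  have := h.2.1.card_le
  omega

theorem AreIndependentTrees.reach_deleteVertex (h : AreIndependentTrees E u A B)
    (hE : ∀ x, x ≠ y → Reach (deleteVertex E y) u x) (hx : x ≠ y) :
    Reach (deleteVertex (A ∪ B) y) u x := by
  by_cases hxu : x = u
  · exact hxu ▸ Reach.refl _ _
  obtain ⟨p, hp⟩ := exists_isPath_of_reach (h.1.2.2.2.2.2 x trivial)
  obtain ⟨r, hr⟩ := exists_isPath_of_reach (h.2.1.2.2.2.2.2 x trivial)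
  by_cases hyp : y ∈ p
  · have hyr : y ∉ r := fun hyr => not_isDominator_of_reach_deleteVertex hx (hE x hx)
      (h.2.2 x hxu p r hp hr y hyp hyr)
    exact (hr.deleteVertex hyr).reach.mono (deleteVertex_mono Finset.subset_union_right y)
  · exact (hp.deleteVertex hyp).reach.mono (deleteVertex_mono Finset.subset_union_left y)

theorem not_isStrongArticulationPoint_of_reach
    (h : ∀ x, x ≠ y → Reach (deleteVertex E y) u x)
    (h' : ∀ x, x ≠ y → Reach (deleteVertex (reverse E) y) u x) :
    ¬ IsStrongArticulationPoint E y := by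
  rw [not_isStrongArticulationPoint_iff]
  intro a b ha hb
  have hau := h' a ha
  rw [deleteVertex_reverse, reach_reverse] at hau
  exact hau.trans (h b hb)

theorem not_isStrongArticulationPoint_of_areIndependentTrees
    (hA : AreIndependentTrees E u A₁ A₂) (hB : AreIndependentTrees (reverse E) u B₁ B₂)
    (hAC : A₁ ∪ A₂ ⊆ C) (hBC : reverse (B₁ ∪ B₂) ⊆ C) (hy : y ≠ u)
    (hE : ¬ IsStrongArticulationPoint E y) : ¬ IsStrongArticulationPoint C y := by
  refine not_isStrongArticulationPoint_of_reach (u := u)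
    (fun x hx => (hA.reach_deleteVertex (fun x hx => ?_) hx).mono (deleteVertex_mono hAC y))
    (fun x hx => (hB.reach_deleteVertex (fun x hx => ?_) hx).mono
      (deleteVertex_mono (reverse_subset_iff.1 hBC) y))
  · exact not_isStrongArticulationPoint_iff.1 hE u x hy.symm hx
  · exact not_isStrongArticulationPoint_iff.1 (not_isStrongArticulationPoint_reverse hE) u x
      hy.symm hx

theorem not_isStrongArticulationPoint_of_isSpanningTree
    (hA : IsSpanningTree {y}ᶜ (deleteVertex E y) q A)
    (hB : IsSpanningTree {y}ᶜ (deleteVertex (reverse E) y) q B)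
    (hAC : A ⊆ C) (hBC : reverse B ⊆ C) : ¬ IsStrongArticulationPoint C y :=
  not_isStrongArticulationPoint_of_reach (fun _ => hA.reach_deleteVertex hAC)
    (fun _ => hB.reach_deleteVertex (reverse_subset_iff.1 hBC))

variable [Fintype V]

theorem exists_card_le_forall_ne_not_isStrongArticulationPoint (hF : StronglyConnected F) (w : V) :
    ∃ C ⊆ F, C.card ≤ 4 * Fintype.card V ∧
      ∀ y, y ≠ w → ¬ IsStrongArticulationPoint F y → ¬ IsStrongArticulationPoint C y := by
  obtain ⟨A₁, A₂, hA⟩ := exists_areIndependentTrees (hF w)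
  obtain ⟨B₁, B₂, hB⟩ := exists_areIndependentTrees (hF.reverse w)
  refine ⟨A₁ ∪ A₂ ∪ reverse (B₁ ∪ B₂),
    Finset.union_subset hA.union_subset (reverse_subset_iff.2 hB.union_subset), ?_,
    fun y => not_isStrongArticulationPoint_of_areIndependentTrees hA hB Finset.subset_union_left
      Finset.subset_union_right⟩
  have := Finset.card_union_le (A₁ ∪ A₂) (reverse (B₁ ∪ B₂))
  have := hA.card_union_le
  have := hB.card_union_le
  rw [card_reverse] at *
  omega

theorem exists_card_le_not_isStrongArticulationPoint (hq : q ≠ w)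
    (hw : ¬ IsStrongArticulationPoint F w) :
    ∃ C ⊆ F, C.card ≤ 2 * Fintype.card V ∧ ¬ IsStrongArticulationPoint C w := by
  obtain ⟨A, hA⟩ := exists_isSpanningTree hq fun x hx =>
    not_isStrongArticulationPoint_iff.1 hw q x hq hx
  obtain ⟨B, hB⟩ := exists_isSpanningTree hq fun x hx =>
    not_isStrongArticulationPoint_iff.1 (not_isStrongArticulationPoint_reverse hw) q x hq hx
  refine ⟨A ∪ reverse B, Finset.union_subset (hA.2.1.trans (deleteVertex_subset _ _))
      (reverse_subset_iff.2 (hB.2.1.trans (deleteVertex_subset _ _))), ?_,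
    not_isStrongArticulationPoint_of_isSpanningTree hA hB Finset.subset_union_left
      Finset.subset_union_right⟩
  have := Finset.card_union_le A (reverse B)
  have := hA.card_le
  have := hB.card_le
  rw [card_reverse] at *
  omega

theorem IsMinimalTwoVertexConnectedSubgraph.minimal
    (h : IsMinimalTwoVertexConnectedSubgraph E F) : Minimal TwoVertexConnected F :=
  (Finset.minimal_iff_forall_erase fun _ _ ht hts => ht.mono hts).2 h.2

theorem IsMinimalTwoVertexConnectedSubgraph.card_le
    (h : IsMinimalTwoVertexConnectedSubgraph E F) : F.card ≤ 6 * Fintype.card V := by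
  obtain ⟨hn, hF, hart⟩ := h.2.1
  have : Nontrivial V := Fintype.one_lt_card_iff_nontrivial.1 (by omega)
  obtain ⟨w, q, hwq⟩ := exists_pair_ne V
  obtain ⟨C, hCF, hCcard, hC⟩ := exists_card_le_forall_ne_not_isStrongArticulationPoint hF w
  obtain ⟨D, hDF, hDcard, hD⟩ := exists_card_le_not_isStrongArticulationPoint hwq.symm (hart w)
  have hCD : ∀ y, ¬ IsStrongArticulationPoint (C ∪ D) y := by
    intro y
    by_cases hy : y = w
    · exact hy ▸ not_isStrongArticulationPoint_mono Finset.subset_union_right hD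
    · exact not_isStrongArticulationPoint_mono Finset.subset_union_left (hC y hy (hart y))
  have hFCD : C ∪ D = F := h.minimal.eq_of_le
    ⟨hn, stronglyConnected_of_forall_not_isStrongArticulationPoint hn hCD, hCD⟩
    (Finset.union_subset hCF hDF)
  have := Finset.card_union_le C D
  rw [hFCD] at this
  omega

theorem AlgorithmOutput.card_le {T : Finset V} (h : AlgorithmOutput E T F) :
    F.card ≤ 8 * Fintype.card V := by
  cases h with
  | empty hT F hF => exact hF.card_le.trans (by omega)
  | full hT hT' F hF => exact hF.card_le.trans (by omega)
  | small hT hT' hcard F hF q A B hq hA hB =>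
    have htrees : (T.biUnion fun y => A y ∪ reverse (B y)).card ≤
        T.card * (2 * Fintype.card V) := by
      refine Finset.card_biUnion_le_card_mul _ _ _ fun y hy => ?_
      have := Finset.card_union_le (A y) (reverse (B y))
      have := (hA y hy).card_le
      have := (hB y hy).card_le
      rw [card_reverse] at *
      omega
    have := Nat.mul_le_mul_right (2 * Fintype.card V) hcard.2
    have := Finset.card_union_le F (T.biUnion fun y => A y ∪ reverse (B y))
    have := hF.card_le
    omega
  | large hT hT' hcard F hF w hw A₁ A₂ B₁ B₂ hA hB =>
    have := Finset.card_union_le (F ∪ (A₁ ∪ A₂)) (reverse (B₁ ∪ B₂))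
    have := Finset.card_union_le F (A₁ ∪ A₂)
    have := hA.card_union_le
    have := hB.card_union_le
    have := hF.card_le
    rw [card_reverse] at *
    omega

theorem AlgorithmOutput.isFeasible {T : Finset V} (h : AlgorithmOutput E T F)
    (hE : TwoTConnected E T) : IsFeasible E T F := by
  cases h with
  | empty hT F hF => exact ⟨hF.1, hF.2.1.1, hF.2.1, by simp [hT]⟩
  | full hT hT' F hF =>
    exact ⟨hF.1, hF.2.1.2.1, hF.2.1.twoEdgeConnected, fun w _ => hF.2.1.2.2 w⟩
  | small hT hT' hcard F hF q A B hq hA hB =>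
    have hconn : TwoEdgeConnected (F ∪ T.biUnion fun y => A y ∪ reverse (B y)) :=
      hF.2.1.mono Finset.subset_union_left
    refine ⟨Finset.union_subset hF.1 (Finset.biUnion_subset.2 fun y hy => ?_), hconn.1, hconn,
      fun y hy => ?_⟩
    · exact Finset.union_subset ((hA y hy).2.1.trans (deleteVertex_subset _ _))
        (reverse_subset_iff.2 ((hB y hy).2.1.trans (deleteVertex_subset _ _)))
    · have hsub := (Finset.subset_biUnion_of_mem (fun y => A y ∪ reverse (B y)) hy).trans
        (Finset.subset_union_right (s₁ := F))
      exact not_isStrongArticulationPoint_of_isSpanningTree (hA y hy) (hB y hy)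
        (Finset.subset_union_left.trans hsub) (Finset.subset_union_right.trans hsub)
  | large hT hT' hcard F hF w hw A₁ A₂ B₁ B₂ hA hB =>
    have hconn : TwoEdgeConnected (F ∪ (A₁ ∪ A₂) ∪ reverse (B₁ ∪ B₂)) :=
      hF.2.1.mono (Finset.subset_union_left.trans Finset.subset_union_left)
    refine ⟨Finset.union_subset (Finset.union_subset hF.1 hA.union_subset)
      (reverse_subset_iff.2 hB.union_subset), hconn.1, hconn, fun y hy => ?_⟩
    exact not_isStrongArticulationPoint_of_areIndependentTrees hA hB
      (Finset.subset_union_right.trans Finset.subset_union_left) Finset.subset_union_right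
      (fun h => hw (h ▸ hy)) (hE.2.2 y hy)

end Certificates

/-! ### Execution on the random access machine -/

section Execution

/-- `P` halts in `s'` within `b` steps when started in `s`. -/
def Runs (P : Prog) (s : Store) (b : ℕ) (s' : Store) : Prop :=
  ∃ k ≤ b, Exec P s k s'

variable {P Q : Prog} {s s' s'' : Store} {b c : ℕ}

theorem Runs.mono (h : Runs P s b s') (hbc : b ≤ c) : Runs P s c s' :=
  let ⟨k, hk, hP⟩ := h
  ⟨k, hk.trans hbc, hP⟩

theorem Runs.seq (h : Runs P s b s') (h' : Runs Q s' c s'') : Runs (.seq P Q) s (b + c) s'' :=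
  let ⟨k, hk, hP⟩ := h
  let ⟨l, hl, hQ⟩ := h'
  ⟨k + l, add_le_add hk hl, .seq hP hQ⟩

theorem Runs.iteTrue {e : Exp} (he : e.eval s ≠ 0) (h : Runs P s b s') :
    Runs (.ite e P Q) s (e.cost + b + 1) s' :=
  let ⟨_, hk, hP⟩ := h
  ⟨_, by omega, .iteTrue he hP⟩

theorem Runs.iteFalse {e : Exp} (he : e.eval s = 0) (h : Runs Q s b s') :
    Runs (.ite e P Q) s (e.cost + b + 1) s' :=
  let ⟨_, hk, hQ⟩ := h
  ⟨_, by omega, .iteFalse he hQ⟩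

theorem Runs.loopStep {e : Exp} (he : e.eval s ≠ 0) (h : Runs P s b s')
    (h' : Runs (.loop e P) s' c s'') : Runs (.loop e P) s (e.cost + b + 1 + c) s'' :=
  let ⟨_, hk, hP⟩ := h
  let ⟨_, hl, hL⟩ := h'
  ⟨_, by omega, .loopStep he hP hL⟩

theorem runs_skip (s : Store) : Runs .skip s 1 s :=
  ⟨1, le_rfl, .skip s⟩

theorem runs_assign (x : ℕ) (e : Exp) (s : Store) :
    Runs (.assign x e) s (e.cost + 1) (s.setVar x (e.eval s)) :=
  ⟨_, le_rfl, .assign x e s⟩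

theorem runs_write (a : ℕ) (i j e : Exp) (s : Store) :
    Runs (.write a i j e) s (i.cost + j.cost + e.cost + 1)
      (s.setArr a (i.eval s) (j.eval s) (e.eval s)) :=
  ⟨_, le_rfl, .write a i j e s⟩

theorem Store.setVar_var (s : Store) (x v y : ℕ) :
    (s.setVar x v).var y = if y = x then v else s.var y :=
  Function.update_apply ..

@[simp] theorem Store.setVar_var_self (s : Store) (x v : ℕ) : (s.setVar x v).var x = v :=
  Function.update_self ..

theorem Store.setArr_arr (s : Store) (a i j v a' i' j' : ℕ) :
    (s.setArr a i j v).arr a' i' j' = if a' = a ∧ i' = i ∧ j' = j then v else s.arr a' i' j' :=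
  rfl

/-- `s'` agrees with `s` on the variables below `x` and the arrays below `a`. -/
structure Frame (x a : ℕ) (s s' : Store) : Prop where
  var : ∀ y < x, s'.var y = s.var y
  arr : ∀ b < a, s'.arr b = s.arr b

variable {x a x' a' : ℕ}

theorem Frame.refl (x a : ℕ) (s : Store) : Frame x a s s :=
  ⟨fun _ _ => rfl, fun _ _ => rfl⟩

theorem Frame.trans (h : Frame x a s s') (h' : Frame x a s' s'') : Frame x a s s'' :=
  ⟨fun y hy => (h'.var y hy).trans (h.var y hy), fun b hb => (h'.arr b hb).trans (h.arr b hb)⟩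

theorem Frame.mono (h : Frame x' a' s s') (hx : x ≤ x') (ha : a ≤ a') : Frame x a s s' :=
  ⟨fun y hy => h.var y (hy.trans_le hx), fun b hb => h.arr b (hb.trans_le ha)⟩

theorem frame_setVar {y v : ℕ} (hy : x ≤ y) : Frame x a s (s.setVar y v) :=
  ⟨fun z hz => by rw [Store.setVar_var, if_neg (by omega)], fun _ _ => rfl⟩

theorem frame_setArr {b i j v : ℕ} (hb : a ≤ b) : Frame x a s (s.setArr b i j v) :=
  ⟨fun _ _ => rfl, fun c hc => by
    funext i' j'
    rw [Store.setArr_arr, if_neg (by omega)]⟩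

/-- Run `P` for the values `0, …, n - 1` of the variable `x`, where `n` is the value of the
variable `0`. -/
def forVar (x : ℕ) (P : Prog) : Prog :=
  .seq (.assign x (.const 0)) (.loop (.sub (.var 0) (.var x))
    (.seq P (.assign x (.add (.var x) (.const 1)))))

/-- `Rep X t` says that the store `t` represents the abstract state `X`. If one run of the body
takes `X` to `f X i`, then the loop computes the left fold of `f`. -/
theorem runs_forVar {σ : Type*} {n : ℕ} {Rep : σ → Store → Prop} {f : σ → Fin n → σ} {X : σ}
    (hx : 0 < x) (hn : s.var 0 = n) (hX : Rep X s)
    (hRep : ∀ X t v, Rep X t → Rep X (t.setVar x v))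
    (hP : ∀ (i : Fin n) X t, Frame x a s t → t.var x = i → Rep X t →
      ∃ t', Runs P t c t' ∧ Frame (x + 1) a t t' ∧ Rep (f X i) t') :
    ∃ s', Runs (forVar x P) s (n * (c + 8) + 6) s' ∧ Frame x a s s' ∧
      Rep ((List.finRange n).foldl f X) s' := by
  suffices key : ∀ d i X t, i + d = n → Frame x a s t → t.var x = i → Rep X t →
      ∃ t', Runs (.loop (.sub (.var 0) (.var x))
        (.seq P (.assign x (.add (.var x) (.const 1))))) t (d * (c + 8) + 4) t' ∧
        Frame x a s t' ∧ Rep (((List.finRange n).drop i).foldl f X) t' by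
    obtain ⟨s', hrun, hs'⟩ := key n 0 X (s.setVar x 0) (zero_add n) (frame_setVar le_rfl)
      (s.setVar_var_self x 0) (hRep X s 0 hX)
    exact ⟨s', ((runs_assign x (.const 0) s).seq hrun).mono (by simp only [Exp.cost]; omega), hs'⟩
  intro d
  induction d with
  | zero =>
    intro i X t hi ht hti hXt
    have htest : (Exp.sub (.var 0) (.var x)).eval t = 0 := by
      simp only [Exp.eval, ht.var 0 hx]
      omega
    rw [List.drop_of_length_le (by simpa using hi.ge)]
    exact ⟨t, ⟨_, by simp only [Exp.cost]; omega, .loopDone htest⟩, ht, hXt⟩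
  | succ d ih =>
    intro i X t hi ht hti hXt
    obtain ⟨t₁, hrun₁, ht₁, hXt₁⟩ := hP ⟨i, by omega⟩ X t ht hti hXt
    have hti₁ : t₁.var x = i := (ht₁.var x (by omega)).trans hti
    obtain ⟨t₂, hrun₂, ht₂, hXt₂⟩ := ih (i + 1) _ (t₁.setVar x (i + 1)) (by omega)
      ((ht.trans (ht₁.mono (by omega) le_rfl)).trans (frame_setVar le_rfl))
      (Store.setVar_var_self ..) (hRep _ _ _ hXt₁)
    have htest : (Exp.sub (.var 0) (.var x)).eval t ≠ 0 := by
      simp only [Exp.eval, ht.var 0 hx]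
      omega
    have hincr := runs_assign x (.add (.var x) (.const 1)) t₁
    simp only [Exp.eval, hti₁] at hincr
    rw [List.drop_eq_getElem_cons (by simp; omega), List.getElem_finRange, List.foldl_cons]
    refine ⟨t₂, (Runs.loopStep htest (hrun₁.seq hincr) hrun₂).mono ?_, ht₂, hXt₂⟩
    simp only [Exp.cost]
    linarith

end Execution

section FoldInvariants

theorem foldl_finRange_induction {n : ℕ} {σ : Type*} {f : σ → Fin n → σ} {X : σ}
    {P : ℕ → σ → Prop} (zero : P 0 X) (succ : ∀ (i : Fin n) Y, P i Y → P (i + 1) (f Y i)) :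
    P n ((List.finRange n).foldl f X) := by
  suffices ∀ i ≤ n, P i (((List.finRange n).take i).foldl f X) by
    simpa [List.take_of_length_le] using this n le_rfl
  intro i
  induction i with
  | zero => exact fun _ => zero
  | succ i ih =>
    intro hi
    rw [← List.take_concat_get' _ i (by simpa using hi), List.foldl_append]
    simpa using succ ⟨i, hi⟩ _ (ih (by omega))

end FoldInvariants

section Saturation

variable {n : ℕ} (R : Fin n → Fin n → Prop)

/-- One test of the reachability computation: add `b` to the set `X` of vertices reached so far if
`a` belongs to it and `R a b`. -/
def relax (a : Fin n) (X : Set (Fin n)) (b : Fin n) : Set (Fin n) :=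
  {c | c ∈ X ∨ a ∈ X ∧ R a b ∧ c = b}

/-- Relax all pairs once, in lexicographic order. -/
def relaxAll (X : Set (Fin n)) : Set (Fin n) :=
  (List.finRange n).foldl (fun X a => (List.finRange n).foldl (relax R a) X) X

variable {R} {X : Set (Fin n)} {a b : Fin n}

theorem foldl_relax (a : Fin n) (X : Set (Fin n)) :
    (List.finRange n).foldl (relax R a) X = {c | c ∈ X ∨ a ∈ X ∧ R a c} := by
  have key := foldl_finRange_induction (f := relax R a) (X := X)
    (P := fun i Y => Y = {c | c ∈ X ∨ a ∈ X ∧ R a c ∧ (c : ℕ) < i}) (by simp) (by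
      rintro i _ rfl
      ext c
      simp only [relax, Set.mem_ofPred_eq, Nat.lt_succ_iff_lt_or_eq, ← Fin.ext_iff]
      grind)
  simpa using key

theorem subset_relaxAll (X : Set (Fin n)) : X ⊆ relaxAll R X :=
  foldl_finRange_induction (P := fun _ Y => X ⊆ Y) subset_rfl fun a Y hY => by
    rw [foldl_relax]
    exact hY.trans fun c hc => Or.inl hc

theorem mem_relaxAll_of_rel (ha : a ∈ X) (hab : R a b) : b ∈ relaxAll R X := by
  refine (foldl_finRange_induction (P := fun i Y => X ⊆ Y ∧ ((a : ℕ) < i → b ∈ Y))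
    ⟨subset_rfl, by simp⟩ fun i Y ⟨hXY, hb⟩ => ?_).2 a.2
  rw [foldl_relax]
  refine ⟨hXY.trans fun c hc => Or.inl hc, fun hai => ?_⟩
  obtain hai | hai := Nat.lt_succ_iff_lt_or_eq.1 hai
  · exact Or.inl (hb hai)
  · obtain rfl := Fin.ext hai
    exact Or.inr ⟨hXY ha, hab⟩

theorem relaxAll_subset {S : Set (Fin n)} (hX : X ⊆ S)
    (hS : ∀ a ∈ S, ∀ b, R a b → b ∈ S) : relaxAll R X ⊆ S :=
  foldl_finRange_induction (P := fun _ Y => Y ⊆ S) hX fun a Y hY => by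
    rw [foldl_relax]
    rintro c (hc | ⟨ha, hac⟩)
    exacts [hY hc, hS a (hY ha) c hac]

/-- The sets grow with each round until they are closed under `R`, so that `n` rounds suffice. -/
theorem relaxAll_iterate_succ (X : Set (Fin n)) :
    relaxAll R ((relaxAll R)^[n] X) = (relaxAll R)^[n] X := by
  have hsucc (m : ℕ) : (relaxAll R)^[m] X ⊆ (relaxAll R)^[m + 1] X := by
    rw [Function.iterate_succ_apply']
    exact subset_relaxAll _
  have hcard (m : ℕ) : ((relaxAll R)^[m] X).ncard ≤ n := by
    simpa using Set.ncard_le_card ((relaxAll R)^[m] X)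
  have hstable := Nat.stabilises_of_monotone (f := fun m => ((relaxAll R)^[m] X).ncard)
    (monotone_nat_of_le_succ fun m => Set.ncard_le_ncard (hsucc m)) hcard
    (fun m hm => by
      have heq := Set.eq_of_subset_of_ncard_le (hsucc m) hm.ge
      rw [Function.iterate_succ_apply', heq, ← Function.iterate_succ_apply' (relaxAll R)]) n.le_succ
  rw [← Function.iterate_succ_apply' (relaxAll R)]
  exact (Set.eq_of_subset_of_ncard_le (hsucc n) hstable.le).symm

theorem mem_foldl_relaxAll_iff {x y : Fin n} :
    y ∈ (List.finRange n).foldl (fun X _ => relaxAll R X) {x} ↔ Relation.ReflTransGen R x y := by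
  rw [List.foldl_const, List.length_finRange]
  constructor
  · intro hy
    refine (?_ : (relaxAll R)^[n] {x} ⊆ {y | Relation.ReflTransGen R x y}) hy
    exact Function.Iterate.rec (· ⊆ {y | Relation.ReflTransGen R x y})
      (Set.singleton_subset_iff.2 .refl) (fun X hX => relaxAll_subset hX fun _ ha _ => .tail ha) n
  · intro h
    induction h with
    | refl => exact Function.Iterate.rec (x ∈ ·) rfl (fun X hX => subset_relaxAll X hX) n
    | tail _ hab ih =>
      rw [← relaxAll_iterate_succ]
      exact mem_relaxAll_of_rel ih hab

end Saturation

/-! ### Loop programs with reachability tests -/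

section LoopPrograms

variable {n k : ℕ}

/-- A valuation extended by a value for a new last variable. -/
def push (env : Fin k → Fin n) (v : Fin n) : Fin (k + 1) → Fin n :=
  Fin.snoc (α := fun _ => Fin n) env v

@[simp] theorem push_castSucc (env : Fin k → Fin n) (v : Fin n) (i : Fin k) :
    push env v i.castSucc = env i :=
  Fin.snoc_castSucc (α := fun _ => Fin n) ..

@[simp] theorem push_last (env : Fin k → Fin n) (v : Fin n) : push env v (Fin.last k) = v :=
  Fin.snoc_last (α := fun _ => Fin n) ..

/-- The number of relations that loop programs work on. -/
abbrev numRel : ℕ := 6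

/-- The state of a loop program: `numRel` binary relations on `Fin n`. -/
abbrev State (n : ℕ) : Type := Fin numRel → Fin n → Fin n → Prop

/-- First-order formulas with reflexive transitive closure, in `k` free variables, about the
order of `Fin n` and the relations of a state. -/
inductive Formula : ℕ → Type
  | rel {k : ℕ} (a : Fin numRel) (x y : Fin k) : Formula k
  | lt {k : ℕ} (x y : Fin k) : Formula k
  | not {k : ℕ} (φ : Formula k) : Formula k
  | and {k : ℕ} (φ ψ : Formula k) : Formula k
  | ex {k : ℕ} (φ : Formula (k + 1)) : Formula k
  | reach {k : ℕ} (φ : Formula (k + 2)) (x y : Fin k) : Formula k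

/-- The truth of a formula in a state, under a valuation of its free variables. -/
def Formula.Realize (B : State n) : {k : ℕ} → Formula k → (Fin k → Fin n) → Prop
  | _, .rel a x y, env => B a (env x) (env y)
  | _, .lt x y, env => env x < env y
  | _, .not φ, env => ¬ φ.Realize B env
  | _, .and φ ψ, env => φ.Realize B env ∧ ψ.Realize B env
  | _, .ex φ, env => ∃ v, φ.Realize B (push env v)
  | _, .reach φ x y, env =>
    Relation.ReflTransGen (fun a b => φ.Realize B (push (push env a) b)) (env x) (env y)

/-- Programs with loops over all elements of `Fin n` that modify a state. -/
inductive LoopProgram : ℕ → Type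
  | skip {k : ℕ} : LoopProgram k
  | write {k : ℕ} (a : Fin numRel) (x y : Fin k) (b : Bool) : LoopProgram k
  | seq {k : ℕ} (P Q : LoopProgram k) : LoopProgram k
  | ite {k : ℕ} (φ : Formula k) (P Q : LoopProgram k) : LoopProgram k
  | all {k : ℕ} (P : LoopProgram (k + 1)) : LoopProgram k

open Classical in
/-- The state in which a loop program ends. -/
noncomputable def LoopProgram.eval :
    {k : ℕ} → LoopProgram k → (Fin k → Fin n) → State n → State n
  | _, .skip, _, B => B
  | _, .write a x y b, env, B => fun a' i j =>
      if a' = a ∧ i = env x ∧ j = env y then b = true else B a' i j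
  | _, .seq P Q, env, B => Q.eval env (P.eval env B)
  | _, .ite φ P Q, env, B => if φ.Realize B env then P.eval env B else Q.eval env B
  | _, .all P, env, B => (List.finRange n).foldl (fun B v => P.eval (push env v) B) B

end LoopPrograms

section Compilation

/-- The test of the pair of vertices in the variables `3 * k + 2` and `3 * k + 5`, where `P`
computes whether they are adjacent. Column `0` of the array `numRel + k` marks the vertices reached
so far. -/
def relaxStep (k : ℕ) (P : Prog) : Prog :=
  .seq P (.ite (.var (3 * k + 9))
    (.ite (.read (numRel + k) (.var (3 * k + 2)) (.const 0))
      (.write (numRel + k) (.var (3 * k + 5)) (.const 0) (.const 1)) .skip) .skip)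

/-- The program that evaluates a formula. With `k` free variables, the `i`-th one is kept in the
variable `3 * i + 2`, the result is put into `3 * k + 3`, and `3 * k + 1` counts the rounds of a
reachability computation. -/
def Formula.compile : {k : ℕ} → Formula k → Prog
  | k, .rel a x y => .assign (3 * k + 3) (.read a (.var (3 * x + 2)) (.var (3 * y + 2)))
  | k, .lt x y => .assign (3 * k + 3) (.sub (.var (3 * y + 2)) (.var (3 * x + 2)))
  | k, .not φ => .seq φ.compile (.assign (3 * k + 3) (.sub (.const 1) (.var (3 * k + 3))))
  | k, .and φ ψ => .seq φ.compile (.ite (.var (3 * k + 3)) ψ.compile .skip)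
  | k, .ex φ => .seq (.assign (3 * k + 3) (.const 0)) (forVar (3 * k + 2)
      (.seq φ.compile (.ite (.var (3 * k + 6)) (.assign (3 * k + 3) (.const 1)) .skip)))
  | k, .reach φ x y =>
    .seq (forVar (3 * k + 2) (.write (numRel + k) (.var (3 * k + 2)) (.const 0) (.const 0)))
    (.seq (.write (numRel + k) (.var (3 * x + 2)) (.const 0) (.const 1))
    (.seq (forVar (3 * k + 1) (forVar (3 * k + 2) (forVar (3 * k + 5) (relaxStep k φ.compile))))
    (.assign (3 * k + 3) (.read (numRel + k) (.var (3 * y + 2)) (.const 0)))))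

/-- The program that carries out a loop program. -/
def LoopProgram.compile : {k : ℕ} → LoopProgram k → Prog
  | _, .skip => .skip
  | _, .write a x y b =>
    .write a (.var (3 * x + 2)) (.var (3 * y + 2)) (.const (if b then 1 else 0))
  | _, .seq P Q => .seq P.compile Q.compile
  | k, .ite φ P Q => .seq φ.compile (.ite (.var (3 * k + 3)) P.compile Q.compile)
  | k, .all P => forVar (3 * k + 2) P.compile

variable {n k x a : ℕ} {B : State n} {env : Fin k → Fin n} {s s' : Store}

/-- The store `s` represents the state `B` and the valuation `env`. -/
structure Represents (B : State n) (env : Fin k → Fin n) (s : Store) : Prop where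
  size : s.var 0 = n
  env : ∀ i : Fin k, s.var (3 * i + 2) = env i
  arr : ∀ (a : Fin numRel) (i j : Fin n), s.arr a i j ≠ 0 ↔ B a i j

theorem Represents.frame (h : Represents B env s) (hf : Frame x a s s') (hx : 3 * k + 1 ≤ x)
    (ha : numRel ≤ a) : Represents B env s' where
  size := (hf.var 0 (by omega)).trans h.size
  env i := (hf.var _ (by omega)).trans (h.env i)
  arr b i j := by
    rw [hf.arr b (b.2.trans_le ha)]
    exact h.arr b i j

theorem Represents.push (h : Represents B env s) {v : Fin n} (hv : s.var (3 * k + 2) = v) :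
    Represents B (push env v) s where
  size := h.size
  env := Fin.lastCases (by simpa using hv) fun i => by simpa using h.env i
  arr := h.arr

theorem Represents.of_push {v : Fin n} (h : Represents B (M2TC.push env v) s) :
    Represents B env s where
  size := h.size
  env i := by simpa using h.env i.castSucc
  arr := h.arr

/-- The compiled formula computes the truth value within `b n` steps on `Fin n`. -/
def Formula.Correct (φ : Formula k) (b : ℕ → ℕ) : Prop :=
  ∀ (n : ℕ) (B : State n) (env : Fin k → Fin n) (s : Store), Represents B env s →
    ∃ s', Runs φ.compile s (b n) s' ∧ Frame (3 * k + 1) (numRel + k) s s' ∧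
      (s'.var (3 * k + 3) ≠ 0 ↔ φ.Realize B env)

/-- The compiled program changes the represented state as specified within `b n` steps on
`Fin n`. -/
def LoopProgram.Correct (P : LoopProgram k) (b : ℕ → ℕ) : Prop :=
  ∀ (n : ℕ) (B : State n) (env : Fin k → Fin n) (s : Store), Represents B env s →
    ∃ s', Runs P.compile s (b n) s' ∧ Frame (3 * k + 1) 0 s s' ∧ Represents (P.eval env B) env s'

variable {b c : ℕ → ℕ}

theorem Formula.correct_rel (a : Fin numRel) (x y : Fin k) :
    (Formula.rel a x y).Correct fun _ => 4 := by
  refine fun n B env s hs => ⟨_, runs_assign .., frame_setVar (by omega), ?_⟩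
  rw [Store.setVar_var_self]
  simp only [Exp.eval, hs.env]
  exact hs.arr a (env x) (env y)

theorem Formula.correct_lt (x y : Fin k) : (Formula.lt x y).Correct fun _ => 4 := by
  refine fun n B env s hs => ⟨_, runs_assign .., frame_setVar (by omega), ?_⟩
  rw [Store.setVar_var_self]
  simp only [Exp.eval, hs.env, Formula.Realize, Fin.lt_def]
  omega

theorem Formula.Correct.not {φ : Formula k} (hφ : φ.Correct b) :
    φ.not.Correct fun n => b n + 4 := by
  intro n B env s hs
  obtain ⟨s', hrun, hf, hsat⟩ := hφ n B env s hs
  refine ⟨_, hrun.seq (runs_assign ..), hf.trans (frame_setVar (by omega)), ?_⟩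
  rw [Store.setVar_var_self]
  simp only [Exp.eval, Formula.Realize, ← hsat]
  omega

theorem Formula.Correct.and {φ ψ : Formula k} (hφ : φ.Correct b) (hψ : ψ.Correct c) :
    (φ.and ψ).Correct fun n => b n + (c n + 3) := by
  intro n B env s hs
  obtain ⟨s', hrun, hf, hsat⟩ := hφ n B env s hs
  by_cases h : φ.Realize B env
  · obtain ⟨t, hrun', hf', hsat'⟩ := hψ n B env s' (hs.frame hf le_rfl (by omega))
    exact ⟨t, (hrun.seq (hrun'.iteTrue (e := .var _) (hsat.2 h))).mono
      (by simp only [Exp.cost]; omega), hf.trans hf', by simp [Formula.Realize, hsat', h]⟩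
  · have h0 : s'.var (3 * k + 3) = 0 := not_not.1 (mt hsat.1 h)
    exact ⟨s', (hrun.seq ((runs_skip s').iteFalse (e := .var _) h0)).mono
      (by simp only [Exp.cost]; omega), hf, by simp [Formula.Realize, h, h0]⟩

theorem foldl_or (l : List (Fin n)) (p : Fin n → Prop) (q : Prop) :
    l.foldl (fun q v => q ∨ p v) q ↔ q ∨ ∃ v ∈ l, p v := by
  induction l generalizing q with
  | nil => simp
  | cons v l ih => simp [ih, or_assoc]

theorem Formula.Correct.ex {φ : Formula (k + 1)} (hφ : φ.Correct b) :
    φ.ex.Correct fun n => n * (b n + 12) + 8 := by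
  intro n B env s hs
  obtain ⟨s', hrun, hf, hsat⟩ := runs_forVar (x := 3 * k + 2) (a := numRel + k) (c := b n + 4)
    (s := s.setVar (3 * k + 3) 0)
    (P := .seq φ.compile (.ite (.var (3 * k + 6)) (.assign (3 * k + 3) (.const 1)) .skip))
    (Rep := fun q t => t.var (3 * k + 3) ≠ 0 ↔ q) (X := False)
    (f := fun q v => q ∨ φ.Realize B (push env v)) (by omega)
    ((Store.setVar_var ..).trans hs.size) (by simp)
    (fun q t v ht => by rwa [Store.setVar_var, if_neg (by omega)]) (by
      intro v q t hft htv hq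
      have ht := (hs.frame (frame_setVar (a := numRel) (by omega)) le_rfl le_rfl).frame hft
        (by omega) (by omega)
      obtain ⟨t', hrun, hf, hsat⟩ := hφ n B (push env v) t (ht.push htv)
      have hres : t'.var (3 * k + 3) = t.var (3 * k + 3) := hf.var _ (by omega)
      by_cases h : φ.Realize B (push env v)
      · exact ⟨_, (hrun.seq ((runs_assign ..).iteTrue (e := .var _) (hsat.2 h))).mono le_rfl,
          (hf.mono (by omega) (by omega)).trans (frame_setVar (by omega)), by simp [Exp.eval, h]⟩
      · exact ⟨t', (hrun.seq ((runs_skip t').iteFalse (e := .var _) (not_not.1 (mt hsat.1 h)))).mono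
          (by simp only [Exp.cost]; omega), hf.mono (by omega) (by omega), by simp [hres, hq, h]⟩)
  refine ⟨s', ((runs_assign ..).seq hrun).mono (by simp only [Exp.cost]; linarith),
    (frame_setVar (by omega)).trans (hf.mono (by omega) le_rfl), ?_⟩
  rw [hsat, foldl_or]
  simp [Formula.Realize]

/-- The binary relation that a formula defines in its last two variables. -/
def Formula.binaryRel (φ : Formula (k + 2)) (B : State n) (env : Fin k → Fin n) (u v : Fin n) :
    Prop :=
  φ.Realize B (M2TC.push (M2TC.push env u) v)

/-- Column `0` of the array `a` is the indicator of `X`. -/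
def Marks (a : ℕ) (X : Set (Fin n)) (s : Store) : Prop :=
  ∀ v : Fin n, s.arr a v 0 ≠ 0 ↔ v ∈ X

theorem Marks.congr {X : Set (Fin n)} (h : Marks a X s) (ha : s'.arr a = s.arr a) :
    Marks a X s' := fun v => by rw [ha, h]

theorem Marks.setArr {X Y : Set (Fin n)} {v : Fin n} {m : ℕ} (h : Marks a X s)
    (hY : ∀ w, w ∈ Y ↔ if w = v then m ≠ 0 else w ∈ X) : Marks a Y (s.setArr a v 0 m) := by
  intro w
  simp only [Store.setArr_arr, true_and, and_true, ← Fin.ext_iff, hY]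
  split_ifs
  exacts [Iff.rfl, h w]

section Reachability

variable {φ : Formula (k + 2)} {X : Set (Fin n)}

theorem Formula.Correct.runs_relaxStep (hφ : φ.Correct b) {u v : Fin n} (hs : Represents B env s)
    (hu : s.var (3 * k + 2) = u) (hv : s.var (3 * k + 5) = v) (hX : Marks (numRel + k) X s) :
    ∃ s', Runs (relaxStep k φ.compile) s (b n + 10) s' ∧ Frame (3 * k + 6) (numRel + k) s s' ∧
      Marks (numRel + k) (relax (φ.binaryRel B env) u X v) s' := by
  obtain ⟨t, hrun, hf, hsat⟩ := hφ n B _ s ((hs.push hu).push hv)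
  replace hsat : t.var (3 * k + 9) ≠ 0 ↔ φ.binaryRel B env u v := hsat
  have htX : Marks (numRel + k) X t := hX.congr (hf.arr _ (by omega))
  have htu : t.var (3 * k + 2) = u := (hf.var _ (by omega)).trans hu
  have htv : t.var (3 * k + 5) = v := (hf.var _ (by omega)).trans hv
  have hread : (Exp.read (numRel + k) (.var (3 * k + 2)) (.const 0)).eval t ≠ 0 ↔ u ∈ X := by
    simp only [Exp.eval, htu]
    exact htX u
  replace hf : Frame (3 * k + 6) (numRel + k) s t := hf.mono (by omega) (by omega)
  by_cases hR : φ.binaryRel B env u v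
  · by_cases hmem : u ∈ X
    · have hw := runs_write (numRel + k) (.var (3 * k + 5)) (.const 0) (.const 1) t
      simp only [Exp.eval, htv] at hw
      refine ⟨_, hrun.seq ((hw.iteTrue (hread.2 hmem)).iteTrue (e := .var _) (hsat.2 hR)),
        hf.trans (frame_setArr le_rfl), htX.setArr fun w => ?_⟩
      simp only [relax, Set.mem_ofPred_eq]
      grind
    · have htest := not_not.1 (mt hread.1 hmem)
      exact ⟨t, (hrun.seq (((runs_skip t).iteFalse htest).iteTrue (e := .var _) (hsat.2 hR))).mono
        (by simp only [Exp.cost]; omega), hf, by simpa [relax, hmem] using htX⟩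
  · have htest := not_not.1 (mt hsat.1 hR)
    exact ⟨t, (hrun.seq ((runs_skip t).iteFalse (e := .var _) htest)).mono
      (by simp only [Exp.cost]; omega), hf, by simpa [relax, hR] using htX⟩

theorem Formula.Correct.runs_relaxAll (hφ : φ.Correct b) (hs : Represents B env s)
    (hX : Marks (numRel + k) X s) :
    ∃ s', Runs (forVar (3 * k + 2) (forVar (3 * k + 5) (relaxStep k φ.compile))) s
        (n * (n * (b n + 18) + 14) + 6) s' ∧
      Frame (3 * k + 2) (numRel + k) s s' ∧
      Marks (numRel + k) (relaxAll (φ.binaryRel B env) X) s' :=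
  runs_forVar (by omega) hs.size hX (fun _ _ _ => id) fun _ _ _ hft htu hX => by
    have ht := hs.frame hft (by omega) (by omega)
    obtain ⟨t', hrun, hf, hX'⟩ := runs_forVar (by omega) ht.size hX (fun _ _ _ => id)
      fun _ _ _ hft htv hX => hφ.runs_relaxStep (ht.frame hft (by omega) (by omega))
        ((hft.var _ (by omega)).trans htu) htv hX
    exact ⟨t', hrun, hf.mono (by omega) le_rfl, hX'⟩

theorem Formula.Correct.runs_saturate (hφ : φ.Correct b) (hs : Represents B env s)
    (hX : Marks (numRel + k) X s) :
    ∃ s', Runs (forVar (3 * k + 1) (forVar (3 * k + 2) (forVar (3 * k + 5)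
        (relaxStep k φ.compile)))) s (n * (n * (n * (b n + 18) + 14) + 14) + 6) s' ∧
      Frame (3 * k + 1) (numRel + k) s s' ∧
      Marks (numRel + k)
        ((List.finRange n).foldl (fun X _ => relaxAll (φ.binaryRel B env) X) X) s' :=
  runs_forVar (by omega) hs.size hX (fun _ _ _ => id) fun _ _ _ hft _ hX =>
    hφ.runs_relaxAll (hs.frame hft (by omega) (by omega)) hX

theorem runs_clearMarks (hs : Represents B env s) :
    ∃ s', Runs (forVar (3 * k + 2)
        (.write (numRel + k) (.var (3 * k + 2)) (.const 0) (.const 0))) s (n * 12 + 6) s' ∧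
      Frame (3 * k + 2) (numRel + k) s s' ∧ Marks (numRel + k) (∅ : Set (Fin n)) s' := by
  obtain ⟨s', hrun, hf, hX⟩ := runs_forVar (x := 3 * k + 2) (a := numRel + k) (c := 4)
    (P := .write (numRel + k) (.var (3 * k + 2)) (.const 0) (.const 0))
    (Rep := Marks (numRel + k)) (X := {v : Fin n | s.arr (numRel + k) v 0 ≠ 0})
    (f := fun X v => X \ {v}) (by omega) hs.size (fun _ => Iff.rfl) (fun _ _ _ => id)
    (fun v X t _ htv hX => by
      have hw := runs_write (numRel + k) (.var (3 * k + 2)) (.const 0) (.const 0) t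
      simp only [Exp.eval, htv] at hw
      exact ⟨_, hw, frame_setArr le_rfl, hX.setArr fun w => by by_cases h : w = v <;> simp [h]⟩)
  refine ⟨s', hrun, hf, ?_⟩
  have hempty := foldl_finRange_induction (f := fun X v => X \ {v})
    (X := {v : Fin n | s.arr (numRel + k) v 0 ≠ 0}) (P := fun i Y => ∀ v ∈ Y, i ≤ (v : ℕ))
    (by simp) (by
      intro i Y hY v ⟨hv, hvi⟩
      exact (hY v hv).lt_of_ne fun h => hvi (Fin.ext h.symm))
  rwa [Set.eq_empty_of_forall_notMem fun v hv => (hempty v hv).not_gt v.2] at hX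

theorem Formula.Correct.reach (hφ : φ.Correct b) (x y : Fin k) :
    (Formula.reach φ x y).Correct
      fun n => n * (n * (n * (b n + 18) + 14) + 14) + n * 12 + 20 := by
  intro n B env s hs
  obtain ⟨s₁, hrun₁, hf₁, hX₁⟩ := runs_clearMarks hs
  have hs₁ := hs.frame hf₁ (by omega) (by omega)
  have hrun₂ := runs_write (numRel + k) (.var (3 * x + 2)) (.const 0) (.const 1) s₁
  simp only [Exp.eval, hs₁.env] at hrun₂
  have hf₂ : Frame (3 * k + 1) (numRel + k) s₁ (s₁.setArr (numRel + k) (env x) 0 1) :=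
    frame_setArr le_rfl
  have hs₂ := hs₁.frame hf₂ le_rfl (by omega)
  obtain ⟨s₃, hrun₃, hf₃, hX₃⟩ := hφ.runs_saturate hs₂
    (hX₁.setArr (Y := {env x}) fun w => by simp)
  have hs₃ := hs₂.frame hf₃ le_rfl (by omega)
  refine ⟨_, (hrun₁.seq (hrun₂.seq (hrun₃.seq (runs_assign ..)))).mono ?_,
    (((hf₁.mono (by omega) le_rfl).trans hf₂).trans hf₃).trans (frame_setVar (by omega)), ?_⟩
  · simp only [Exp.cost]
    omega
  · rw [Store.setVar_var_self]
    simp only [Exp.eval, hs₃.env]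
    exact (hX₃ (env y)).trans mem_foldl_relaxAll_iff

end Reachability

theorem Formula.exists_correct (φ : Formula k) :
    ∃ p : Polynomial ℕ, φ.Correct fun n => p.eval n := by
  induction φ with
  | rel a x y => exact ⟨4, by simpa using correct_rel a x y⟩
  | lt x y => exact ⟨4, by simpa using correct_lt x y⟩
  | not φ ih =>
    obtain ⟨p, hp⟩ := ih
    exact ⟨p + 4, by simpa using hp.not⟩
  | and φ ψ ih ih' =>
    obtain ⟨p, hp⟩ := ih
    obtain ⟨q, hq⟩ := ih'
    exact ⟨p + (q + 3), by simpa using hp.and hq⟩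
  | ex φ ih =>
    obtain ⟨p, hp⟩ := ih
    exact ⟨.X * (p + 12) + 8, by simpa using hp.ex⟩
  | reach φ x y ih =>
    obtain ⟨p, hp⟩ := ih
    exact ⟨.X * (.X * (.X * (p + 18) + 14) + 14) + .X * 12 + 20, by simpa using hp.reach x y⟩

theorem LoopProgram.correct_skip : (LoopProgram.skip (k := k)).Correct fun _ => 1 :=
  fun _ _ _ s hs => ⟨s, runs_skip s, .refl .., hs⟩

theorem LoopProgram.correct_write (a : Fin numRel) (x y : Fin k) (v : Bool) :
    (LoopProgram.write a x y v).Correct fun _ => 4 := by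
  refine fun n B env s hs => ⟨_, runs_write .., frame_setArr (Nat.zero_le _), hs.size, hs.env,
    fun a' i j => ?_⟩
  simp only [Store.setArr_arr, Exp.eval, hs.env, LoopProgram.eval, ← Fin.ext_iff]
  split_ifs
  exacts [by simp_all, by simp_all, hs.arr a' i j]

theorem LoopProgram.Correct.seq {P Q : LoopProgram k} (hP : P.Correct b) (hQ : Q.Correct c) :
    (P.seq Q).Correct fun n => b n + c n := by
  intro n B env s hs
  obtain ⟨s', hrun, hf, hs'⟩ := hP n B env s hs
  obtain ⟨s'', hrun', hf', hs''⟩ := hQ n _ env s' hs'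
  exact ⟨s'', hrun.seq hrun', hf.trans hf', hs''⟩

theorem LoopProgram.Correct.ite {φ : Formula k} {P Q : LoopProgram k} {d : ℕ → ℕ}
    (hφ : φ.Correct d) (hP : P.Correct b) (hQ : Q.Correct c) :
    (LoopProgram.ite φ P Q).Correct fun n => d n + (b n + c n + 2) := by
  intro n B env s hs
  obtain ⟨t, hrun, hf, hsat⟩ := hφ n B env s hs
  have ht := hs.frame hf le_rfl (by omega)
  replace hf : Frame (3 * k + 1) 0 s t := hf.mono le_rfl (Nat.zero_le _)
  by_cases h : φ.Realize B env
  · obtain ⟨s', hrun', hf', hs'⟩ := hP n B env t ht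
    exact ⟨s', (hrun.seq (hrun'.iteTrue (e := .var _) (hsat.2 h))).mono
      (by simp only [Exp.cost]; omega), hf.trans hf', by simpa [LoopProgram.eval, h] using hs'⟩
  · obtain ⟨s', hrun', hf', hs'⟩ := hQ n B env t ht
    exact ⟨s', (hrun.seq (hrun'.iteFalse (e := .var _) (not_not.1 (mt hsat.1 h)))).mono
      (by simp only [Exp.cost]; omega), hf.trans hf', by simpa [LoopProgram.eval, h] using hs'⟩

theorem LoopProgram.Correct.all {P : LoopProgram (k + 1)} (hP : P.Correct b) :
    P.all.Correct fun n => n * (b n + 8) + 6 := by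
  intro n B env s hs
  obtain ⟨s', hrun, hf, hs'⟩ := runs_forVar (x := 3 * k + 2) (a := 0) (P := P.compile)
    (Rep := fun B t => Represents B env t) (by omega) hs.size hs
    (fun B t v ht => ht.frame (frame_setVar (a := numRel) (by omega)) le_rfl le_rfl)
    fun v B t _ htv ht => by
      obtain ⟨t', hrun, hf, ht'⟩ := hP n B (push env v) t (ht.push htv)
      exact ⟨t', hrun, hf.mono (by omega) le_rfl, ht'.of_push⟩
  exact ⟨s', hrun, hf.mono (by omega) le_rfl, hs'⟩

theorem LoopProgram.exists_correct (P : LoopProgram k) :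
    ∃ p : Polynomial ℕ, P.Correct fun n => p.eval n := by
  induction P with
  | skip => exact ⟨1, by simpa using correct_skip⟩
  | write a x y v => exact ⟨4, by simpa using correct_write a x y v⟩
  | seq P Q ih ih' =>
    obtain ⟨p, hp⟩ := ih
    obtain ⟨q, hq⟩ := ih'
    exact ⟨p + q, by simpa using hp.seq hq⟩
  | ite φ P Q ih ih' =>
    obtain ⟨r, hr⟩ := φ.exists_correct
    obtain ⟨p, hp⟩ := ih
    obtain ⟨q, hq⟩ := ih'
    exact ⟨r + (p + q + 2), by simpa using Correct.ite hr hp hq⟩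
  | all P ih =>
    obtain ⟨p, hp⟩ := ih
    exact ⟨.X * (p + 8) + 6, by simpa using hp.all⟩

end Compilation

/-! ### Graph properties as formulas -/

section Edges

variable {n : ℕ}

open Classical in
/-- The edge set with adjacency relation `R`. -/
noncomputable def edgesOf (R : Fin n → Fin n → Prop) : Finset (Fin n × Fin n) :=
  Finset.univ.filter fun e => R e.1 e.2

/-- The adjacency relation of an edge set, which is the inverse of `edgesOf`. -/
def memRel (F : Finset (Fin n × Fin n)) : Fin n → Fin n → Prop := fun x y => (x, y) ∈ F

@[simp] theorem mem_edgesOf {R : Fin n → Fin n → Prop} {x y : Fin n} :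
    (x, y) ∈ edgesOf R ↔ R x y := by
  simp [edgesOf]

@[simp] theorem edgesOf_memRel (F : Finset (Fin n × Fin n)) : edgesOf (memRel F) = F := by
  ext ⟨x, y⟩
  simp [memRel]

@[simp] theorem memRel_edgesOf (R : Fin n → Fin n → Prop) : memRel (edgesOf R) = R := by
  funext x y
  simp [memRel]

theorem edgesOf_swap (R : Fin n → Fin n → Prop) :
    edgesOf (Function.swap R) = reverse (edgesOf R) := by
  ext ⟨x, y⟩
  simp [mem_reverse, Function.swap]

/-- The relation number `r.1` of a state, reversed if `r.2` is true. This lets one formula speak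
about a graph and about its reverse. -/
def oriented (B : State n) (r : Fin numRel × Bool) : Fin n → Fin n → Prop :=
  if r.2 then Function.swap (B r.1) else B r.1

@[simp] theorem oriented_false (B : State n) (a : Fin numRel) : oriented B (a, false) = B a := rfl

@[simp] theorem oriented_true (B : State n) (a : Fin numRel) :
    oriented B (a, true) = Function.swap (B a) := rfl

theorem oriented_update {a : Fin numRel} {r : Fin numRel × Bool} (h : r.1 ≠ a) (B : State n)
    (R : Fin n → Fin n → Prop) : oriented (Function.update B a R) r = oriented B r := by
  rw [oriented, oriented, Function.update_of_ne h]

end Edges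

namespace Formula

section Connectives

variable {n k : ℕ}

/-- Disjunction. -/
def or (φ ψ : Formula k) : Formula k := not (and (not φ) (not ψ))

/-- Universal quantification over the last variable. -/
def all (φ : Formula (k + 1)) : Formula k := not (ex (not φ))

/-- Implication. -/
def imp (φ ψ : Formula k) : Formula k := not (and φ (not ψ))

/-- Equality, expressed by the linear order. -/
def eq (x y : Fin k) : Formula k := and (not (lt x y)) (not (lt y x))

/-- Inequality. -/
def ne (x y : Fin k) : Formula k := not (eq x y)

/-- Adjacency in the relation `oriented B r`. -/
def edge (r : Fin numRel × Bool) (x y : Fin k) : Formula k :=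
  if r.2 then rel r.1 y x else rel r.1 x y

/-- The formula that `x` is the least vertex with a property, which is expressed by `φ` for `x` and
by `ψ` for a new last variable. -/
def least (x : Fin k) (φ : Formula k) (ψ : Formula (k + 1)) : Formula k :=
  and φ (all (imp ψ (not (lt (Fin.last k) x.castSucc))))

variable {B : State n} {env : Fin k → Fin n}

@[simp] theorem realize_rel {a : Fin numRel} {x y : Fin k} :
    (rel a x y).Realize B env ↔ B a (env x) (env y) := Iff.rfl

@[simp] theorem realize_lt {x y : Fin k} : (lt x y).Realize B env ↔ env x < env y := Iff.rfl

@[simp] theorem realize_not {φ : Formula k} : (not φ).Realize B env ↔ ¬ φ.Realize B env := Iff.rfl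

@[simp] theorem realize_and {φ ψ : Formula k} :
    (and φ ψ).Realize B env ↔ φ.Realize B env ∧ ψ.Realize B env := Iff.rfl

@[simp] theorem realize_ex {φ : Formula (k + 1)} :
    (ex φ).Realize B env ↔ ∃ v, φ.Realize B (push env v) := Iff.rfl

@[simp] theorem realize_reach {φ : Formula (k + 2)} {x y : Fin k} :
    (reach φ x y).Realize B env ↔ Relation.ReflTransGen
      (fun a b => φ.Realize B (push (push env a) b)) (env x) (env y) := Iff.rfl

@[simp] theorem realize_or {φ ψ : Formula k} :
    (or φ ψ).Realize B env ↔ φ.Realize B env ∨ ψ.Realize B env := by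
  simp only [or, realize_not, realize_and]
  tauto

@[simp] theorem realize_all {φ : Formula (k + 1)} :
    (all φ).Realize B env ↔ ∀ v, φ.Realize B (push env v) := by
  simp [all]

@[simp] theorem realize_imp {φ ψ : Formula k} :
    (imp φ ψ).Realize B env ↔ (φ.Realize B env → ψ.Realize B env) := by
  simp [imp]

@[simp] theorem realize_eq {x y : Fin k} : (eq x y).Realize B env ↔ env x = env y := by
  simp only [eq, realize_and, realize_not, realize_lt, not_lt]
  exact ⟨fun h => le_antisymm h.2 h.1, fun h => ⟨h.ge, h.le⟩⟩

@[simp] theorem realize_ne {x y : Fin k} : (ne x y).Realize B env ↔ env x ≠ env y := by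
  simp [ne]

@[simp] theorem realize_edge {r : Fin numRel × Bool} {x y : Fin k} :
    (edge r x y).Realize B env ↔ oriented B r (env x) (env y) := by
  obtain ⟨a, _ | _⟩ := r <;> simp [edge, Function.swap]

theorem realize_least {x : Fin k} {φ : Formula k} {ψ : Formula (k + 1)} {Q : Fin n → Prop}
    (hφ : φ.Realize B env ↔ Q (env x)) (hψ : ∀ v, ψ.Realize B (push env v) ↔ Q v) :
    (least x φ ψ).Realize B env ↔ IsLeast {v | Q v} (env x) := by
  simp [least, hφ, hψ, IsLeast, mem_lowerBounds]

end Connectives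

section Connectivity

variable {n k : ℕ}

/-- Reachability of `v` from `u` without the edge `(i, j)`. -/
def reachErase (r : Fin numRel × Bool) (i j u v : Fin k) : Formula k :=
  reach (and (not (and (eq (Fin.last k).castSucc i.castSucc.castSucc)
    (eq (Fin.last (k + 1)) j.castSucc.castSucc)))
    (edge r (Fin.last k).castSucc (Fin.last (k + 1)))) u v

/-- The edge between the last two variables exists and avoids the vertex `z`. -/
def edgeDelete (r : Fin numRel × Bool) (z : Fin k) : Formula (k + 2) :=
  and (edge r (Fin.last k).castSucc (Fin.last (k + 1)))
    (and (ne (Fin.last k).castSucc z.castSucc.castSucc)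
      (ne (Fin.last (k + 1)) z.castSucc.castSucc))

/-- `2`-edge-connectedness. -/
def twoEdgeConnected (r : Fin numRel × Bool) : Formula k :=
  all (all (all (all (reachErase r (Fin.last k).castSucc.castSucc.castSucc
    (Fin.last (k + 1)).castSucc.castSucc (Fin.last (k + 2)).castSucc (Fin.last (k + 3))))))

/-- `2`-vertex-connectedness, on at least three vertices. -/
def twoVertexConnected (r : Fin numRel × Bool) : Formula k :=
  all (all (all (imp (ne (Fin.last (k + 1)).castSucc (Fin.last k).castSucc.castSucc)
    (imp (ne (Fin.last (k + 2)) (Fin.last k).castSucc.castSucc)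
      (reach (edgeDelete r (Fin.last k).castSucc.castSucc) (Fin.last (k + 1)).castSucc
        (Fin.last (k + 2)))))))

/-- Reachability of all vertices other than `y` from `q`. -/
def reachAllNe (r : Fin numRel × Bool) (y q : Fin k) : Formula k :=
  all (imp (ne (Fin.last k) y.castSucc)
    (reach (edge r (Fin.last (k + 1)).castSucc (Fin.last (k + 2))) q.castSucc (Fin.last k)))

variable {B : State n} {env : Fin k → Fin n} {r : Fin numRel × Bool}

@[simp] theorem realize_edgeDelete {z : Fin k} {a b : Fin n} :
    (edgeDelete r z).Realize B (push (push env a) b) ↔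
      (a, b) ∈ deleteVertex (edgesOf (oriented B r)) (env z) := by
  simp [edgeDelete, mem_deleteVertex]

theorem realize_reachErase {i j u v : Fin k} : (reachErase r i j u v).Realize B env ↔
    Reach ((edgesOf (oriented B r)).erase (env i, env j)) (env u) (env v) := by
  simp [reachErase, Reach]

theorem realize_twoEdgeConnected (hn : 0 < n) : (twoEdgeConnected r : Formula k).Realize B env ↔
    TwoEdgeConnected (edgesOf (oriented B r)) := by
  simp only [twoEdgeConnected, realize_all, realize_reachErase, push_castSucc, push_last]
  rw [twoEdgeConnected_iff]
  exact ⟨fun h => ⟨fun u v => (h ⟨0, hn⟩ ⟨0, hn⟩ u v).mono (Finset.erase_subset _ _),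
    fun e => h e.1 e.2⟩, fun h i j => h.2 (i, j)⟩

theorem realize_twoVertexConnected (hn : 3 ≤ n) :
    (twoVertexConnected r : Formula k).Realize B env ↔
      TwoVertexConnected (edgesOf (oriented B r)) := by
  have hcard : 3 ≤ Fintype.card (Fin n) := by simpa using hn
  have hart : (twoVertexConnected r : Formula k).Realize B env ↔
      ∀ w, ¬ IsStrongArticulationPoint (edgesOf (oriented B r)) w := by
    simp [twoVertexConnected, not_isStrongArticulationPoint_iff, Reach]
  rw [hart]
  exact ⟨fun h => ⟨hcard, stronglyConnected_of_forall_not_isStrongArticulationPoint hcard h, h⟩,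
    fun h => h.2.2⟩

theorem realize_reachAllNe {y q : Fin k} : (reachAllNe r y q).Realize B env ↔
    ∀ x ∈ ({env y}ᶜ : Set (Fin n)), Reach (edgesOf (oriented B r)) (env q) x := by
  simp [reachAllNe, Reach]

end Connectivity

section Dominators

variable {n k : ℕ}

/-- `Dominates` for the root `w`. -/
def dominates (r : Fin numRel × Bool) (w z x : Fin k) : Formula k :=
  imp (ne w z) (not (reach (and (edge r (Fin.last k).castSucc (Fin.last (k + 1)))
    (ne (Fin.last (k + 1)) z.castSucc.castSucc)) w x))

/-- `StrictlyDominates` for the root `w`. -/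
def strictlyDominates (r : Fin numRel × Bool) (w z x : Fin k) : Formula k :=
  and (ne z x) (dominates r w z x)

/-- `AreSiblings` for the root `w`. -/
def areSiblings (r : Fin numRel × Bool) (w c x : Fin k) : Formula k :=
  all (and (imp (strictlyDominates r w.castSucc (Fin.last k) c.castSucc)
      (strictlyDominates r w.castSucc (Fin.last k) x.castSucc))
    (imp (strictlyDominates r w.castSucc (Fin.last k) x.castSucc)
      (strictlyDominates r w.castSucc (Fin.last k) c.castSucc)))

/-- `HasDominatingPred` for the root `w`. -/
def hasDominatingPred (r : Fin numRel × Bool) (w x : Fin k) : Formula k :=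
  ex (and (edge r (Fin.last k) x.castSucc)
    (strictlyDominates r w.castSucc (Fin.last k) x.castSucc))

/-- `DerivedEdge` for the root `w`. -/
def derivedEdge (r : Fin numRel × Bool) (w c x : Fin k) : Formula k :=
  and (ne c x) (and (areSiblings r w c x)
    (ex (and (edge r (Fin.last k) x.castSucc) (dominates r w.castSucc c.castSucc (Fin.last k)))))

variable {B : State n} {env : Fin k → Fin n} {r : Fin numRel × Bool} {w c x z : Fin k}

@[simp] theorem realize_dominates : (dominates r w z x).Realize B env ↔
    Dominates (edgesOf (oriented B r)) (env w) (env z) (env x) := by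
  simp [dominates, Dominates, ReachAvoiding]

@[simp] theorem realize_strictlyDominates : (strictlyDominates r w z x).Realize B env ↔
    StrictlyDominates (edgesOf (oriented B r)) (env w) (env z) (env x) := by
  simp [strictlyDominates, StrictlyDominates]

@[simp] theorem realize_areSiblings : (areSiblings r w c x).Realize B env ↔
    AreSiblings (edgesOf (oriented B r)) (env w) (env c) (env x) := by
  simp [areSiblings, AreSiblings, iff_def]

@[simp] theorem realize_hasDominatingPred : (hasDominatingPred r w x).Realize B env ↔
    HasDominatingPred (edgesOf (oriented B r)) (env w) (env x) := by
  simp [hasDominatingPred, HasDominatingPred]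

@[simp] theorem realize_derivedEdge : (derivedEdge r w c x).Realize B env ↔
    DerivedEdge (edgesOf (oriented B r)) (env w) (env c) (env x) := by
  simp [derivedEdge, DerivedEdge]

end Dominators

end Formula

section PlacedOrders

variable {n k : ℕ}

/-- A relation `R` encodes a partially built order: a vertex `v` other than the root is placed once
`R v v` holds. These are the vertices that have not been placed. -/
def unplaced (R : Fin n → Fin n → Prop) (w : Fin n) : Set (Fin n) := {v | v ≠ w ∧ ¬ R v v}

/-- The strict order encoded by a relation whose diagonal marks the placed vertices. -/
def before (R : Fin n → Fin n → Prop) (c x : Fin n) : Prop := c ≠ x ∧ R c x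

theorem before_swap (R : Fin n → Fin n → Prop) :
    before (Function.swap R) = Function.swap (before R) := by
  funext c x
  simp [before, Function.swap, ne_comm]

namespace Formula

/-- `v` has not been placed in the order encoded by the relation number `o`. -/
def isUnplaced (o : Fin numRel) (w v : Fin k) : Formula k := and (ne v w) (not (rel o v v))

/-- `RootReachable` for `y` among the unplaced vertices other than `v`. -/
def isRootReachable (r : Fin numRel × Bool) (o : Fin numRel) (w v y : Fin k) : Formula k :=
  ex (and (and (isUnplaced o w.castSucc (Fin.last k)) (ne (Fin.last k) v.castSucc))
    (and (hasDominatingPred r w.castSucc (Fin.last k))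
      (reach (and
        (derivedEdge r w.castSucc.castSucc.castSucc (Fin.last (k + 1)).castSucc (Fin.last (k + 2)))
        (and (isUnplaced o w.castSucc.castSucc.castSucc (Fin.last (k + 2)))
          (ne (Fin.last (k + 2)) v.castSucc.castSucc.castSucc)))
        (Fin.last k) y.castSucc)))

/-- `IsLow` for the unplaced vertices. -/
def isLow (r : Fin numRel × Bool) (o : Fin numRel) (w v : Fin k) : Formula k :=
  or (hasDominatingPred r w v) (ex (and (not (isUnplaced o w.castSucc (Fin.last k)))
    (derivedEdge r w.castSucc (Fin.last k) v.castSucc)))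

/-- `Placeable` for the unplaced vertices. -/
def placeable (r : Fin numRel × Bool) (o : Fin numRel) (w v : Fin k) : Formula k :=
  and (isLow r o w v)
    (all (imp (and (isUnplaced o w.castSucc (Fin.last k)) (ne (Fin.last k) v.castSucc))
      (isRootReachable r o w.castSucc v.castSucc (Fin.last k))))

/-- `IsParentCandidate` for the order encoded by the oriented relation `o`. -/
def isParentCandidate (r o : Fin numRel × Bool) (w p x : Fin k) : Formula k :=
  and (edge r p x) (or (strictlyDominates r w p x) (ex (and
    (dominates r w.castSucc (Fin.last k) p.castSucc)
    (and (areSiblings r w.castSucc (Fin.last k) x.castSucc)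
      (and (ne (Fin.last k) x.castSucc) (edge o (Fin.last k) x.castSucc))))))

/-- `p` is the least parent candidate of `x`. -/
def isLeastParentCandidate (r o : Fin numRel × Bool) (w p x : Fin k) : Formula k :=
  and (ne x w) (least p (isParentCandidate r o w p x)
    (isParentCandidate r o w.castSucc (Fin.last k) x.castSucc))

variable {B : State n} {env : Fin k → Fin n} {r o : Fin numRel × Bool} {a : Fin numRel}
  {w v p x y : Fin k}

@[simp] theorem realize_isUnplaced :
    (isUnplaced a w v).Realize B env ↔ env v ∈ unplaced (B a) (env w) := by
  simp [isUnplaced, unplaced]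

theorem realize_isRootReachable : (isRootReachable r a w v y).Realize B env ↔
    RootReachable (HasDominatingPred (edgesOf (oriented B r)) (env w))
      (DerivedEdge (edgesOf (oriented B r)) (env w)) (unplaced (B a) (env w) \ {env v})
      (env y) := by
  simp [isRootReachable, RootReachable]

theorem realize_isLow : (isLow r a w v).Realize B env ↔
    IsLow (HasDominatingPred (edgesOf (oriented B r)) (env w))
      (DerivedEdge (edgesOf (oriented B r)) (env w)) (unplaced (B a) (env w)) (env v) := by
  simp [isLow, IsLow]

theorem realize_placeable : (placeable r a w v).Realize B env ↔
    Placeable (HasDominatingPred (edgesOf (oriented B r)) (env w))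
      (DerivedEdge (edgesOf (oriented B r)) (env w)) (unplaced (B a) (env w)) (env v) := by
  simp [placeable, Placeable, realize_isLow, realize_isRootReachable]

theorem realize_isParentCandidate : (isParentCandidate r o w p x).Realize B env ↔
    IsParentCandidate (edgesOf (oriented B r)) (env w) (before (oriented B o)) (env p)
      (env x) := by
  simp [isParentCandidate, IsParentCandidate, before]

theorem realize_isLeastParentCandidate : (isLeastParentCandidate r o w p x).Realize B env ↔
    (env p, env x) ∈
      leastParentTree (edgesOf (oriented B r)) (env w) (before (oriented B o)) := by
  rw [mem_leastParentTree, isLeastParentCandidate, realize_and, realize_ne, realize_least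
    (Q := fun v => IsParentCandidate _ (env w) (before (oriented B o)) v (env x))
    realize_isParentCandidate fun v => by simp [realize_isParentCandidate]]

end Formula

end PlacedOrders

/-! ### Computing by loop programs -/

namespace LoopProgram

variable {n k : ℕ} {env : Fin k → Fin n} {B : State n}

section Loops

theorem all_induction {P : LoopProgram (k + 1)} {Inv : Set (Fin n) → State n → Prop}
    (hempty : Inv ∅ B)
    (hinsert : ∀ D i B, i ∉ D → Inv D B → Inv (insert i D) (P.eval (push env i) B)) :
    Inv Set.univ ((all P).eval env B) := by
  have key := foldl_finRange_induction (f := fun B v => P.eval (push env v) B) (X := B)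
    (P := fun i => Inv {j | (j : ℕ) < i}) (by simpa using hempty) fun i B hB => by
      have hset : {j : Fin n | (j : ℕ) < i + 1} = insert i {j : Fin n | (j : ℕ) < i} := by
        ext j
        simp only [Set.mem_ofPred_eq, Set.mem_insert_iff, Fin.ext_iff]
        omega
      rw [hset]
      exact hinsert _ i B (by simp) hB
  simpa [eval] using key

theorem all_all_induction {P : LoopProgram (k + 2)} {Inv : Set (Fin n × Fin n) → State n → Prop}
    (hempty : Inv ∅ B)
    (hinsert : ∀ D i j B, (i, j) ∉ D → Inv D B →
      Inv (insert (i, j) D) (P.eval (push (push env i) j) B)) :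
    Inv Set.univ ((all (all P)).eval env B) := by
  have outer := all_induction (P := all P) (env := env)
    (Inv := fun D => Inv {e | e.1 ∈ D}) (by simpa using hempty) fun D i B hi hB => by
      have inner := all_induction (P := P) (env := push env i)
        (Inv := fun D' => Inv {e | e.1 ∈ D ∨ e.1 = i ∧ e.2 ∈ D'}) (by simpa using hB)
        fun D' j B hj hB => by
          convert hinsert _ i j B (by simp [hi, hj]) hB using 1
          ext ⟨x, y⟩
          simp only [Set.mem_insert_iff, Set.mem_ofPred_eq, Prod.mk.injEq]
          tauto
      convert inner using 1
      ext e
      simp [or_comm]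
  simpa using outer

theorem eval_seq (P Q : LoopProgram k) : (seq P Q).eval env B = Q.eval env (P.eval env B) := rfl

theorem eval_ite_pos {φ : Formula k} {P Q : LoopProgram k} (h : φ.Realize B env) :
    (ite φ P Q).eval env B = P.eval env B := if_pos h

theorem eval_ite_neg {φ : Formula k} {P Q : LoopProgram k} (h : ¬ φ.Realize B env) :
    (ite φ P Q).eval env B = Q.eval env B := if_neg h

theorem eval_all_ite_unique {φ : Formula (k + 1)} {P : LoopProgram (k + 1)} {q : Fin n}
    (h : ∀ i, φ.Realize B (push env i) ↔ i = q)
    (h' : ∀ i, φ.Realize (P.eval (push env q) B) (push env i) ↔ i = q) :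
    (all (ite φ P skip)).eval env B = P.eval (push env q) B := by
  have key := all_induction (P := ite φ P skip) (env := env) (B := B)
    (Inv := fun D B' => q ∉ D ∧ B' = B ∨ q ∈ D ∧ B' = P.eval (push env q) B) (by simp) ?_
  · simpa using key
  rintro D i B' hi (⟨hq, rfl⟩ | ⟨hq, rfl⟩)
  · obtain rfl | hiq := eq_or_ne i q
    · exact .inr ⟨by simp, eval_ite_pos ((h i).2 rfl)⟩
    · exact .inl ⟨by simp [hq, hiq.symm], eval_ite_neg (mt (h i).1 hiq)⟩
  · have hiq : i ≠ q := fun h => hi (h ▸ hq)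
    exact .inr ⟨by simp [hq], eval_ite_neg (mt (h' i).1 hiq)⟩

end Loops

section Relations

variable {a : Fin numRel}

/-- The program that replaces the relation number `a` by the relation that the formula `φ` defines
in the last two variables. Where `φ` mentions the relation `a`, it sees the pairs that the loop has
already overwritten. -/
def setRel (a : Fin numRel) (φ : Formula (k + 2)) : LoopProgram k :=
  all (all (ite φ (write a (Fin.last k).castSucc (Fin.last (k + 1)) true)
    (write a (Fin.last k).castSucc (Fin.last (k + 1)) false)))

open Classical in
/-- The hypothesis speaks about the moment when `(x, y)` is treated and `D` has been treated. -/
theorem eval_setRel {φ : Formula (k + 2)} {C : Fin n → Fin n → Prop}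
    (hφ : ∀ (D : Set (Fin n × Fin n)) x y, (x, y) ∉ D → (φ.Realize (Function.update B a
      fun x y => if (x, y) ∈ D then C x y else B a x y) (push (push env x) y) ↔ C x y)) :
    (setRel a φ).eval env B = Function.update B a C := by
  have key := all_all_induction (env := env) (B := B)
    (P := ite φ (write a (Fin.last k).castSucc (Fin.last (k + 1)) true)
      (write a (Fin.last k).castSucc (Fin.last (k + 1)) false))
    (Inv := fun D B' => B' = Function.update B a
      fun x y => if (x, y) ∈ D then C x y else B a x y) (by simp) ?_
  · simpa [setRel] using key
  rintro D i j B' hij rfl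
  have hφ := hφ D i j hij
  funext b x y
  obtain rfl | hb := eq_or_ne b a
  · by_cases hxy : x = i ∧ y = j
    · obtain ⟨rfl, rfl⟩ := hxy
      by_cases hC : C x y <;> simp [eval, hφ, hC]
    · by_cases hC : C i j <;> simp [eval, hφ, hC, hxy]
  · by_cases hC : C i j <;> simp [eval, hφ, hC, hb]

theorem eval_write_true {x y : Fin k} {F : Finset (Fin n × Fin n)} :
    (write a x y true).eval env (Function.update B a (memRel F)) =
      Function.update B a (memRel (insert (env x, env y) F)) := by
  funext b i j
  obtain rfl | hb := eq_or_ne b a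
  · by_cases h : i = env x ∧ j = env y <;> simp [eval, h, memRel]
  · simp [eval, hb]

theorem eval_write_false {x y : Fin k} {F : Finset (Fin n × Fin n)} :
    (write a x y false).eval env (Function.update B a (memRel F)) =
      Function.update B a (memRel (F.erase (env x, env y))) := by
  funext b i j
  obtain rfl | hb := eq_or_ne b a
  · by_cases h : i = env x ∧ j = env y <;> simp [eval, h, memRel]
  · simp [eval, hb]

/-- The program that deletes a pair from the relation number `a` if `φ` holds after the
deletion. -/
def tryErase (a : Fin numRel) (φ : Formula k) (x y : Fin k) : LoopProgram k :=
  ite (.rel a x y) (seq (write a x y false) (ite φ skip (write a x y true))) skip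

variable {P : Finset (Fin n × Fin n) → Prop} {F : Finset (Fin n × Fin n)}

open Classical in
theorem eval_tryErase {φ : Formula k} {x y : Fin k}
    (hφ : φ.Realize (Function.update B a (memRel (F.erase (env x, env y)))) env ↔
      P (F.erase (env x, env y))) (hF : P F) :
    (tryErase a φ x y).eval env (Function.update B a (memRel F)) = Function.update B a
      (memRel (if P (F.erase (env x, env y)) then F.erase (env x, env y) else F)) := by
  by_cases hxy : (env x, env y) ∈ F
  · rw [tryErase, eval_ite_pos (by simpa [memRel] using hxy), eval_seq, eval_write_false]
    split_ifs with h
    · exact eval_ite_pos (hφ.2 h)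
    · rw [eval_ite_neg (mt hφ.1 h), eval_write_true, Finset.insert_erase hxy]
  · rw [tryErase, eval_ite_neg (by simpa [memRel] using hxy), Finset.erase_eq_of_notMem hxy,
      if_pos hF]
    rfl

/-- The program that goes once through all pairs and deletes each one from the relation number `a`
if this preserves `φ`. -/
def greedy (a : Fin numRel) (φ : Formula (k + 2)) : LoopProgram k :=
  all (all (tryErase a φ (Fin.last k).castSucc (Fin.last (k + 1))))

/-- One pass suffices: a pair that could not be deleted cannot be deleted later, when there are
fewer pairs. -/
theorem eval_greedy {φ : Formula (k + 2)}
    (hφ : ∀ F x y, φ.Realize (Function.update B a (memRel F)) (push (push env x) y) ↔ P F)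
    (hP : Monotone P) (hB : P (edgesOf (B a))) :
    ∃ A ⊆ edgesOf (B a), Minimal P A ∧
      (greedy a φ).eval env B = Function.update B a (memRel A) := by
  have key := all_all_induction (env := env) (B := B)
    (P := tryErase a φ (Fin.last k).castSucc (Fin.last (k + 1)))
    (Inv := fun D B' => ∃ A ⊆ edgesOf (B a), P A ∧ (∀ e ∈ A, e ∈ D → ¬ P (A.erase e)) ∧
      B' = Function.update B a (memRel A)) ⟨_, subset_rfl, hB, by simp, by simp⟩ ?_
  · obtain ⟨A, hA, hPA, hmin, heval⟩ := key
    exact ⟨A, hA, (Finset.minimal_iff_forall_erase fun _ _ h hst => hP hst h).2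
      ⟨hPA, fun e he => hmin e he trivial⟩, heval⟩
  rintro D i j B' - ⟨A, hA, hPA, hmin, rfl⟩
  have heval := eval_tryErase (x := (Fin.last k).castSucc) (y := Fin.last (k + 1))
    (hφ _ i j) hPA
  simp only [push_castSucc, push_last] at heval
  rw [heval]
  refine ⟨_, ?_, ?_, ?_, rfl⟩
  · split_ifs
    exacts [(Finset.erase_subset _ _).trans hA, hA]
  · split_ifs with h
    exacts [by simpa using h, hPA]
  · split_ifs with h
    · rintro e he (rfl | heD) hPe
      · exact Finset.notMem_erase _ _ he
      · exact hmin e (Finset.mem_of_mem_erase he) heD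
          (hP (Finset.erase_subset_erase _ (Finset.erase_subset _ _)) hPe)
    · rintro e he (rfl | heD)
      exacts [by simpa using h, hmin e he heD]

end Relations

end LoopProgram

section AddingEdges

variable {n k : ℕ} {B B' B'' : State n} {C C' : Finset (Fin n × Fin n)} {env : Fin k → Fin n}

/-- From `B` to `B'` the edges `C` are added to the output, which is the relation number `2`. The
graph and the vertex set, which are the relations number `0` and `1`, stay the same. The remaining
relations are auxiliary. -/
structure AddsEdges (B B' : State n) (C : Finset (Fin n × Fin n)) : Prop where
  graph_eq : B' 0 = B 0
  vertexSet_eq : B' 1 = B 1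
  edgesOf_eq : edgesOf (B' 2) = edgesOf (B 2) ∪ C

theorem AddsEdges.refl (B : State n) : AddsEdges B B ∅ := ⟨rfl, rfl, by simp⟩

theorem AddsEdges.trans (h : AddsEdges B B' C) (h' : AddsEdges B' B'' C') :
    AddsEdges B B'' (C ∪ C') where
  graph_eq := h'.graph_eq.trans h.graph_eq
  vertexSet_eq := h'.vertexSet_eq.trans h.vertexSet_eq
  edgesOf_eq := by rw [h'.edgesOf_eq, h.edgesOf_eq, Finset.union_assoc]

theorem AddsEdges.of_update {a : Fin numRel} {R : Fin n → Fin n → Prop} (ha : 2 < a)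
    (h : AddsEdges (Function.update B a R) B' C) : AddsEdges B B' C where
  graph_eq := by
    rw [h.graph_eq, Function.update_of_ne ((by decide : (0 : Fin numRel) < 2).trans ha).ne]
  vertexSet_eq := by
    rw [h.vertexSet_eq, Function.update_of_ne ((by decide : (1 : Fin numRel) < 2).trans ha).ne]
  edgesOf_eq := by
    rw [h.edgesOf_eq, Function.update_of_ne ha.ne]

namespace LoopProgram

theorem exists_addsEdges_all {P : LoopProgram (k + 1)} {Q : Fin n → Finset (Fin n × Fin n) → Prop}
    (h : ∀ i B', B' 0 = B 0 → B' 1 = B 1 →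
      ∃ C, Q i C ∧ AddsEdges B' (P.eval (push env i) B') C) :
    ∃ C : Fin n → Finset (Fin n × Fin n), (∀ i, Q i (C i)) ∧
      AddsEdges B ((all P).eval env B) (Finset.univ.biUnion C) := by
  have key := all_induction (P := P) (env := env) (B := B)
    (Inv := fun D B' => ∃ C : Fin n → Finset (Fin n × Fin n), (∀ i ∈ D, Q i (C i)) ∧
      (∀ i ∉ D, C i = ∅) ∧ AddsEdges B B' (Finset.univ.biUnion C))
    ⟨fun _ => ∅, by simp, by simp, by convert AddsEdges.refl B; ext; simp⟩ ?_
  · obtain ⟨C, hQ, -, hC⟩ := key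
    exact ⟨C, fun i => hQ i trivial, hC⟩
  rintro D i B' hi ⟨C, hQ, hempty, hC⟩
  obtain ⟨A, hA, hadd⟩ := h i B' hC.graph_eq hC.vertexSet_eq
  refine ⟨Function.update C i A, ?_, ?_, ?_⟩
  · rintro j (rfl | hj)
    · simpa using hA
    · rw [Function.update_of_ne (ne_of_mem_of_not_mem hj hi)]
      exact hQ j hj
  · intro j hj
    rw [Set.mem_insert_iff, not_or] at hj
    rw [Function.update_of_ne hj.1]
    exact hempty j hj.2
  · convert hC.trans hadd using 1
    ext e
    simp only [Finset.mem_biUnion, Finset.mem_univ, true_and, Finset.mem_union,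
      Function.update_apply]
    grind

/-- The program that adds to the output the pairs that satisfy `φ`. -/
def addEdges (φ : Formula (k + 2)) : LoopProgram k :=
  setRel 2 (.or (.rel 2 (Fin.last k).castSucc (Fin.last (k + 1))) φ)

theorem addsEdges_addEdges {φ : Formula (k + 2)}
    (hφ : ∀ R x y, φ.Realize (Function.update B 2 R) (push (push env x) y) ↔ (x, y) ∈ C) :
    AddsEdges B ((addEdges φ).eval env B) C := by
  rw [addEdges, eval_setRel (C := memRel (edgesOf (B 2) ∪ C)) fun D x y hxy => by
    simp [hφ, hxy, memRel]]
  exact ⟨by simp, by simp, by simp⟩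

section SpanningTrees

/-- The program that adds to the output a spanning tree without `y`, rooted at `q`, of the graph
or, if `b` is true, the reversal of such a tree of the reversed graph. -/
def addTree (b : Bool) (y q : Fin k) : LoopProgram k :=
  seq (setRel 3 (.edgeDelete (0, b) y))
  (seq (greedy 3 (.reachAllNe (3, false) y.castSucc.castSucc q.castSucc.castSucc))
    (addEdges (.edge (3, b) (Fin.last k).castSucc (Fin.last (k + 1)))))

theorem exists_addsEdges_addTree {b : Bool} {y q : Fin k} (hq : env q ≠ env y)
    (hr : ∀ x, x ≠ env y →
      Reach (deleteVertex (edgesOf (oriented B (0, b))) (env y)) (env q) x) :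
    ∃ A, IsSpanningTree {env y}ᶜ (deleteVertex (edgesOf (oriented B (0, b))) (env y)) (env q) A ∧
      AddsEdges B ((addTree b y q).eval env B) (if b then reverse A else A) := by
  set E := deleteVertex (edgesOf (oriented B (0, b))) (env y) with hE
  rw [addTree, eval_seq, eval_seq, eval_setRel (C := memRel E) fun D x z _ => by
    rw [Formula.realize_edgeDelete, oriented_update (by decide : (0 : Fin numRel) ≠ 3)]
    simp [memRel, hE]]
  obtain ⟨A, hA, hmin, heval⟩ := eval_greedy (a := 3) (B := Function.update B 3 (memRel E))
    (env := env) (φ := .reachAllNe (3, false) y.castSucc.castSucc q.castSucc.castSucc)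
    (P := fun A => ∀ x ∈ ({env y}ᶜ : Set (Fin n)), Reach A (env q) x)
    (fun F x z => by simp [Formula.realize_reachAllNe])
    (fun F F' hF h x hx => (h x hx).mono hF) (by simpa using hr)
  rw [Function.update_self, edgesOf_memRel] at hA
  rw [heval, Function.update_idem]
  refine ⟨A, isSpanningTree_of_minimal hq (fun a c hac => (mem_deleteVertex.1 hac).2) hA hmin,
    .of_update (by decide) (addsEdges_addEdges fun R x z => ?_)⟩
  rw [Formula.realize_edge, oriented_update (by decide : (3 : Fin numRel) ≠ 2)]
  cases b <;> simp [memRel, mem_reverse, Function.swap]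

/-- `C` consists of a spanning tree of the graph without `y` and the reversal of a spanning tree of
the reversed graph without `y`, with the same root. -/
def IsTreePair (E : Finset (Fin n × Fin n)) (y : Fin n) (C : Finset (Fin n × Fin n)) : Prop :=
  ∃ q A A', q ≠ y ∧ IsSpanningTree {y}ᶜ (deleteVertex E y) q A ∧
    IsSpanningTree {y}ᶜ (deleteVertex (reverse E) y) q A' ∧ C = A ∪ reverse A'

/-- The program that adds a pair of trees without `y` to the output, rooted at the least other
vertex. -/
def addTreePair (y : Fin k) : LoopProgram k :=
  all (ite (.least (Fin.last k) (.ne (Fin.last k) y.castSucc)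
      (.ne (Fin.last (k + 1)) y.castSucc.castSucc))
    (seq (addTree false y.castSucc (Fin.last k)) (addTree true y.castSucc (Fin.last k))) skip)

theorem exists_addsEdges_addTreePair [Nontrivial (Fin n)] {y : Fin k}
    (hy : ¬ IsStrongArticulationPoint (edgesOf (B 0)) (env y)) :
    ∃ C, IsTreePair (edgesOf (B 0)) (env y) C ∧ AddsEdges B ((addTreePair y).eval env B) C := by
  obtain ⟨q, hq⟩ := exists_isLeast (exists_ne (env y))
  have hqy : q ≠ env y := hq.1
  have hleast (B' : State n) (i : Fin n) : (Formula.least (Fin.last k)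
      (.ne (Fin.last k) y.castSucc) (.ne (Fin.last (k + 1)) y.castSucc.castSucc)).Realize B'
        (push env i) ↔ i = q := by
    rw [Formula.realize_least (Q := fun v => v ≠ env y) (by simp) (by simp), push_last]
    exact ⟨fun h => h.unique hq, fun h => h ▸ hq⟩
  rw [addTreePair, eval_all_ite_unique (hleast _) (hleast _), eval_seq]
  obtain ⟨A, hA, hadd⟩ := exists_addsEdges_addTree (B := B) (b := false) (env := push env q)
    (y := y.castSucc) (q := Fin.last k) (by simpa using hqy) (by
      simpa using fun x => not_isStrongArticulationPoint_iff.1 hy q x hqy)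
  obtain ⟨A', hA', hadd'⟩ := exists_addsEdges_addTree (b := true) (env := push env q)
    (B := (addTree false y.castSucc (Fin.last k)).eval (push env q) B)
    (y := y.castSucc) (q := Fin.last k) (by simpa using hqy) (by
      simpa [hadd.graph_eq, edgesOf_swap] using fun x => not_isStrongArticulationPoint_iff.1
        (not_isStrongArticulationPoint_reverse hy) q x hqy)
  rw [oriented_true, hadd.graph_eq, edgesOf_swap, push_castSucc, push_last] at hA'
  rw [oriented_false, push_castSucc, push_last] at hA
  exact ⟨_, ⟨q, A, A', hqy, hA, hA', rfl⟩, hadd.trans hadd'⟩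

end SpanningTrees

end LoopProgram

end AddingEdges

section Orders

variable {n k : ℕ} {R : Fin n → Fin n → Prop} {u v : Fin n} {E : Finset (Fin n × Fin n)}

/-- The relation that encodes the order encoded by `R` after `v` has been placed last. -/
def placeRel (R : Fin n → Fin n → Prop) (u v c x : Fin n) : Prop :=
  R c x ∨ x = v ∧ (c = v ∨ R c c ∧ c ≠ u)

theorem unplaced_placeRel : unplaced (placeRel R u v) u = unplaced R u \ {v} := by
  ext x
  simp only [unplaced, placeRel, Set.mem_ofPred_eq, Set.mem_sdiff, Set.mem_singleton_iff]
  tauto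

theorem before_placeRel (hv : v ∈ unplaced R u) :
    before (placeRel R u v) = placeLast u (unplaced R u) (before R) v := by
  funext c x
  have hne : R c c ∧ c ≠ u → c ≠ v := fun hc hcv => hv.2 (hcv ▸ hc.1)
  simp only [before, placeRel, placeLast, unplaced, Set.mem_ofPred_eq, eq_iff_iff]
  grind

/-- The relation `R` encodes a partially built low-high order of the flow graph `E` with
root `u`. -/
def EncodesOrder (E : Finset (Fin n × Fin n)) (u : Fin n) (R : Fin n → Fin n → Prop) : Prop :=
  IsPartialLowHighOrder (HasDominatingPred E u) (DerivedEdge E u) u (unplaced R u) (before R)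

theorem EncodesOrder.place (h : EncodesOrder E u R) (hv : v ∈ unplaced R u)
    (hp : Placeable (HasDominatingPred E u) (DerivedEdge E u) (unplaced R u) v) :
    EncodesOrder E u (placeRel R u v) := by
  rw [EncodesOrder, unplaced_placeRel, before_placeRel hv]
  exact IsPartialLowHighOrder.place h (fun _ _ => DerivedEdge.ne_root) hv hp

theorem EncodesOrder.exists_placeable (h : EncodesOrder E u R) (hr : ∀ x, Reach E u x)
    (hU : (unplaced R u).Nonempty) : ∃ v ∈ unplaced R u,
      Placeable (HasDominatingPred E u) (DerivedEdge E u) (unplaced R u) v :=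
  M2TC.exists_placeable hU (fun _ hXU hX => exists_hasDominatingPred_or_derivedEdge hr hX
    fun hu => h.root_notMem (hXU hu)) h.reachable

theorem encodesOrder_false (hr : ∀ x, Reach E u x) : EncodesOrder E u fun _ _ => False := by
  have hU : unplaced (fun _ _ => False) u = {u}ᶜ := by ext; simp [unplaced]
  have hlt : before (fun _ _ : Fin n => False) = fun _ _ => False := by funext; simp [before]
  rw [EncodesOrder, hU, hlt]
  exact isPartialLowHighOrder_empty
    fun X hX hu => exists_hasDominatingPred_or_derivedEdge hr hX hu

namespace LoopProgram

/-- The program that places `v` last in the order encoded by the relation number `o`. -/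
def place (o : Fin numRel) (w v : Fin k) : LoopProgram k :=
  setRel o (.or (.rel o (Fin.last k).castSucc (Fin.last (k + 1)))
    (.and (.eq (Fin.last (k + 1)) v.castSucc.castSucc)
      (.or (.eq (Fin.last k).castSucc v.castSucc.castSucc)
        (.and (.rel o (Fin.last k).castSucc (Fin.last k).castSucc)
          (.ne (Fin.last k).castSucc w.castSucc.castSucc)))))

/-- The program that places `v` if this is possible. -/
def orderStep (r : Fin numRel × Bool) (o : Fin numRel) (w v : Fin k) : LoopProgram k :=
  ite (.and (.isUnplaced o w v) (.placeable r o w v)) (place o w v) skip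

/-- The program that tries once to place each vertex. -/
def orderPass (r : Fin numRel × Bool) (o : Fin numRel) (w : Fin k) : LoopProgram k :=
  all (orderStep r o w.castSucc (Fin.last k))

/-- The program that builds a low-high order, with root `w`, of the graph whose adjacency relation
is `r`. Each pass places a vertex, hence `n` passes suffice. -/
def order (r : Fin numRel × Bool) (o : Fin numRel) (w : Fin k) : LoopProgram k :=
  all (orderPass r o w.castSucc)

variable {env : Fin k → Fin n} {B : State n} {r : Fin numRel × Bool} {o : Fin numRel} {w : Fin k}

theorem eval_place {v : Fin k} : (place o w v).eval env B =
    Function.update B o (placeRel (B o) (env w) (env v)) := by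
  classical
  refine eval_setRel fun D x y hxy => ?_
  simp only [Formula.realize_or, Formula.realize_and, Formula.realize_rel, Formula.realize_eq,
    Formula.realize_ne, Function.update_self, push_castSucc, push_last, if_neg hxy, placeRel]
  split_ifs <;> tauto

theorem eval_orderStep_of_placeable {v : Fin k} (hr : r.1 ≠ o) (hv : env v ∈ unplaced R (env w))
    (hp : Placeable (HasDominatingPred (edgesOf (oriented B r)) (env w))
      (DerivedEdge (edgesOf (oriented B r)) (env w)) (unplaced R (env w)) (env v)) :
    (orderStep r o w v).eval env (Function.update B o R) =
      Function.update B o (placeRel R (env w) (env v)) := by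
  rw [orderStep, eval_ite_pos, eval_place, Function.update_self, Function.update_idem]
  simpa [Formula.realize_placeable, oriented_update hr] using ⟨hv, hp⟩

theorem eval_orderStep_of_not_placeable {v : Fin k} (hr : r.1 ≠ o)
    (h : ¬ (env v ∈ unplaced R (env w) ∧
      Placeable (HasDominatingPred (edgesOf (oriented B r)) (env w))
        (DerivedEdge (edgesOf (oriented B r)) (env w)) (unplaced R (env w)) (env v))) :
    (orderStep r o w v).eval env (Function.update B o R) = Function.update B o R := by
  refine eval_ite_neg ?_
  simpa [Formula.realize_placeable, oriented_update hr] using h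

theorem exists_eval_orderPass (hr : r.1 ≠ o)
    (hreach : ∀ x, Reach (edgesOf (oriented B r)) (env w) x)
    (hR : EncodesOrder (edgesOf (oriented B r)) (env w) R) :
    ∃ R', (orderPass r o w).eval env (Function.update B o R) = Function.update B o R' ∧
      EncodesOrder (edgesOf (oriented B r)) (env w) R' ∧
      (unplaced R' (env w) = ∅ ∨ unplaced R' (env w) ⊂ unplaced R (env w)) := by
  set E := edgesOf (oriented B r)
  set u := env w
  have key := all_induction (P := orderStep r o w.castSucc (Fin.last k)) (env := env)
    (B := Function.update B o R) (Inv := fun D B' => ∃ R', B' = Function.update B o R' ∧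
      EncodesOrder E u R' ∧ ((R' = R ∧ ∀ v ∈ D, v ∈ unplaced R u →
        ¬ Placeable (HasDominatingPred E u) (DerivedEdge E u) (unplaced R u) v) ∨
      unplaced R' u ⊂ unplaced R u)) ⟨R, rfl, hR, .inl ⟨rfl, by simp⟩⟩ ?_
  · obtain ⟨R', heval, hR', ⟨rfl, hstuck⟩ | hlt⟩ := key
    · refine ⟨R', heval, hR', .inl (Set.not_nonempty_iff_eq_empty.1 fun hU => ?_)⟩
      obtain ⟨v, hv, hp⟩ := hR'.exists_placeable hreach hU
      exact hstuck v trivial hv hp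
    · exact ⟨R', heval, hR', .inr hlt⟩
  rintro D i B' - ⟨R', rfl, hR', hprogress⟩
  by_cases hi : i ∈ unplaced R' u ∧
      Placeable (HasDominatingPred E u) (DerivedEdge E u) (unplaced R' u) i
  · refine ⟨placeRel R' u i, ?_, hR'.place hi.1 hi.2, .inr ?_⟩
    · simpa using eval_orderStep_of_placeable (B := B) (env := push env i) (w := w.castSucc)
        (v := Fin.last k) hr (by simpa using hi.1) (by simpa using hi.2)
    · rw [unplaced_placeRel]
      exact (Set.sdiff_singleton_ssubset.2 hi.1).trans_subset
        (hprogress.elim (fun h => h.1 ▸ subset_rfl) fun h => h.subset)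
  · refine ⟨R', eval_orderStep_of_not_placeable hr (by simpa using hi), hR', ?_⟩
    refine hprogress.imp_left fun ⟨hRR, hstuck⟩ => ⟨hRR, ?_⟩
    rintro v (rfl | hv)
    · exact fun hv hp => hi (hRR ▸ ⟨hv, hp⟩)
    · exact hstuck v hv

theorem exists_eval_order (hr : r.1 ≠ o) (ho : B o = fun _ _ => False)
    (hreach : ∀ x, Reach (edgesOf (oriented B r)) (env w) x) :
    ∃ R, (order r o w).eval env B = Function.update B o R ∧
      IsPartialLowHighOrder (HasDominatingPred (edgesOf (oriented B r)) (env w))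
        (DerivedEdge (edgesOf (oriented B r)) (env w)) (env w) ∅ (before R) := by
  have key := foldl_finRange_induction (n := n) (X := B)
    (f := fun B i => (orderPass r o w.castSucc).eval (push env i) B)
    (P := fun i B' => ∃ R, B' = Function.update B o R ∧
      EncodesOrder (edgesOf (oriented B r)) (env w) R ∧ (unplaced R (env w)).ncard + i ≤ n)
    ⟨_, (Function.update_eq_self o B).symm, ho ▸ encodesOrder_false hreach, by
      simpa using Set.ncard_le_card (unplaced (B o) (env w))⟩ ?_
  · obtain ⟨R, heval, hR, hcard⟩ := key
    have hU : unplaced R (env w) = ∅ := (Set.ncard_eq_zero (Set.toFinite _)).1 (by omega)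
    exact ⟨R, heval, hU ▸ hR⟩
  rintro i B' ⟨R, rfl, hR, hcard⟩
  obtain ⟨R', heval, hR', hU | hU⟩ := exists_eval_orderPass (B := B) (env := push env i)
    (w := w.castSucc) hr (by simpa using hreach) (by simpa using hR)
  · refine ⟨R', heval, by simpa using hR', ?_⟩
    rw [push_castSucc] at hU
    simp [hU]
  · have hlt := Set.ncard_lt_ncard hU (Set.toFinite _)
    rw [push_castSucc] at hlt hR'
    exact ⟨R', heval, hR', by omega⟩

end LoopProgram

end Orders

section IndependentTrees

variable {n k : ℕ}

namespace LoopProgram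

/-- The program that adds to the output two independent spanning trees, rooted at `w`, of the graph
and the reversals of two such trees of the reversed graph. Both pairs are obtained from low-high
orders. -/
def addIndependentTrees (w : Fin k) : LoopProgram k :=
  seq (order (0, false) 4 w)
  (seq (order (0, true) 5 w)
  (addEdges (.or
    (.or (.isLeastParentCandidate (0, false) (4, false) w.castSucc.castSucc
        (Fin.last k).castSucc (Fin.last (k + 1)))
      (.isLeastParentCandidate (0, false) (4, true) w.castSucc.castSucc
        (Fin.last k).castSucc (Fin.last (k + 1))))
    (.or (.isLeastParentCandidate (0, true) (5, false) w.castSucc.castSucc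
        (Fin.last (k + 1)) (Fin.last k).castSucc)
      (.isLeastParentCandidate (0, true) (5, true) w.castSucc.castSucc
        (Fin.last (k + 1)) (Fin.last k).castSucc)))))

theorem exists_addsEdges_addIndependentTrees {env : Fin k → Fin n} {B : State n} {w : Fin k}
    (hB : StronglyConnected (edgesOf (B 0))) (h4 : B 4 = fun _ _ => False)
    (h5 : B 5 = fun _ _ => False) : ∃ A₁ A₂ B₁ B₂,
      AreIndependentTrees (edgesOf (B 0)) (env w) A₁ A₂ ∧
      AreIndependentTrees (reverse (edgesOf (B 0))) (env w) B₁ B₂ ∧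
      AddsEdges B ((addIndependentTrees w).eval env B) ((A₁ ∪ A₂) ∪ reverse (B₁ ∪ B₂)) := by
  obtain ⟨R, heval, hR⟩ := exists_eval_order (B := B) (env := env) (w := w) (r := (0, false))
    (o := 4) (by decide) h4 (hB _)
  obtain ⟨R', heval', hR'⟩ := exists_eval_order (B := Function.update B 4 R) (env := env) (w := w)
    (r := (0, true)) (o := 5) (by decide) (by simpa using h5) (by
      simpa [edgesOf_swap] using hB.reverse (env w))
  rw [oriented_update (by decide : (0 : Fin numRel) ≠ 4), oriented_true, edgesOf_swap] at hR'
  have hreach' := hB.reverse (env w)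
  refine ⟨_, _, _, _, hR.areIndependentTrees_leastParentTree (hB _),
    hR'.areIndependentTrees_leastParentTree hreach', ?_⟩
  rw [addIndependentTrees, eval_seq, eval_seq, heval, heval']
  refine .of_update (a := 4) (by decide) (.of_update (a := 5) (by decide)
    (addsEdges_addEdges fun S x y => ?_))
  simp [Formula.realize_isLeastParentCandidate, before_swap, edgesOf_swap, mem_reverse,
    oriented, or_assoc]

end LoopProgram

end IndependentTrees

section Algorithm

variable {n k : ℕ}

open Classical in
/-- The set whose indicator is the first column of `R`. The input stores the set `T` in this way in
the relation number `1`. -/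
noncomputable def firstColumn (R : Fin n → Fin n → Prop) : Finset (Fin n) :=
  Finset.univ.filter fun x => ∃ z, IsMin z ∧ R x z

/-- Membership in the set stored in the relation number `1`. -/
def Formula.memFirstColumn (x : Fin k) : Formula k :=
  ex (and (all (not (lt (Fin.last (k + 1)) (Fin.last k).castSucc))) (rel 1 x.castSucc (Fin.last k)))

/-- The set stored in the relation number `1` contains all vertices. -/
def Formula.firstColumnEqUniv : Formula k := all (memFirstColumn (Fin.last k))

/-- The set stored in the relation number `1` is empty. -/
def Formula.firstColumnEqEmpty : Formula k := all (not (memFirstColumn (Fin.last k)))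

/-- The set stored in the relation number `1` has more than two elements. -/
def Formula.twoLtCardFirstColumn : Formula k :=
  ex (and (memFirstColumn (Fin.last k)) (ex (and (memFirstColumn (Fin.last (k + 1)))
    (ex (and (memFirstColumn (Fin.last (k + 2)))
      (and (ne (Fin.last k).castSucc.castSucc (Fin.last (k + 1)).castSucc)
        (and (ne (Fin.last k).castSucc.castSucc (Fin.last (k + 2)))
          (ne (Fin.last (k + 1)).castSucc (Fin.last (k + 2))))))))))

@[simp] theorem Formula.realize_memFirstColumn {B : State n} {env : Fin k → Fin n} {x : Fin k} :
    (memFirstColumn x).Realize B env ↔ env x ∈ firstColumn (B 1) := by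
  simp [memFirstColumn, firstColumn, isMin_iff_forall_not_lt]

theorem Formula.realize_firstColumnEqUniv {B : State n} {env : Fin k → Fin n} :
    firstColumnEqUniv.Realize B env ↔ firstColumn (B 1) = Finset.univ := by
  simp [firstColumnEqUniv, Finset.eq_univ_iff_forall]

theorem Formula.realize_firstColumnEqEmpty {B : State n} {env : Fin k → Fin n} :
    firstColumnEqEmpty.Realize B env ↔ firstColumn (B 1) = ∅ := by
  simp [firstColumnEqEmpty, Finset.eq_empty_iff_forall_notMem]

theorem Formula.realize_twoLtCardFirstColumn {B : State n} {env : Fin k → Fin n} :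
    twoLtCardFirstColumn.Realize B env ↔ 2 < (firstColumn (B 1)).card := by
  simp [twoLtCardFirstColumn, Finset.two_lt_card]

namespace LoopProgram

/-- The program that puts into the output a subset of the edges of the graph that is minimal with
the property expressed by `φ`. -/
def minimalSubgraph (φ : Formula (k + 2)) : LoopProgram k :=
  seq (setRel 2 (.rel 0 (Fin.last k).castSucc (Fin.last (k + 1)))) (greedy 2 φ)

/-- The program for `|T| ≤ 2`. -/
def addTreePairs : LoopProgram k :=
  all (ite (.memFirstColumn (Fin.last k)) (addTreePair (Fin.last k)) skip)

/-- The program for `|T| > 2`. The root is the least vertex that is not in `T`. -/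
def addIndependentTreesOutside : LoopProgram k :=
  all (ite (.least (Fin.last k) (.not (.memFirstColumn (Fin.last k)))
    (.not (.memFirstColumn (Fin.last (k + 1))))) (addIndependentTrees (Fin.last k)) skip)

/-- The part of the algorithm that adds edges to a minimal `2`-edge-connected subgraph. -/
def augment : LoopProgram k :=
  ite .firstColumnEqEmpty skip
    (ite .twoLtCardFirstColumn addIndependentTreesOutside addTreePairs)

/-- Algorithm 1, with least roots, greedy minimal subgraphs and independent trees from low-high
orders as its choices. -/
def main : LoopProgram 0 :=
  ite .firstColumnEqUniv (minimalSubgraph (.twoVertexConnected (2, false)))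
    (seq (minimalSubgraph (.twoEdgeConnected (2, false))) augment)

variable {B : State n} {env : Fin k → Fin n}

theorem exists_eval_minimalSubgraph {φ : Formula (k + 2)} {P : Finset (Fin n × Fin n) → Prop}
    (hφ : ∀ F x y, φ.Realize (Function.update B 2 (memRel F)) (push (push env x) y) ↔ P F)
    (hP : Monotone P) (hB : P (edgesOf (B 0))) :
    ∃ F ⊆ edgesOf (B 0), (P F ∧ ∀ e ∈ F, ¬ P (F.erase e)) ∧
      (minimalSubgraph φ).eval env B = Function.update B 2 (memRel F) := by
  have hcopy : (setRel 2 (.rel 0 (Fin.last k).castSucc (Fin.last (k + 1)))).eval env B =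
      Function.update B 2 (B 0) := eval_setRel fun D x y _ => by simp
  obtain ⟨F, hF, hmin, heval⟩ := eval_greedy (a := 2) (B := Function.update B 2 (B 0)) (env := env)
    (φ := φ) (P := P) (by simpa using hφ) hP (by simpa using hB)
  refine ⟨F, by simpa using hF,
    (Finset.minimal_iff_forall_erase fun _ _ h hst => hP hst h).1 hmin, ?_⟩
  rw [minimalSubgraph, eval_seq, hcopy, heval, Function.update_idem]

theorem exists_addsEdges_addTreePairs [Nontrivial (Fin n)]
    (hT : ∀ y ∈ firstColumn (B 1), ¬ IsStrongArticulationPoint (edgesOf (B 0)) y) :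
    ∃ C, (∀ y ∈ firstColumn (B 1), IsTreePair (edgesOf (B 0)) y (C y)) ∧
      AddsEdges B (addTreePairs.eval env B) ((firstColumn (B 1)).biUnion C) := by
  obtain ⟨C, hC, hadd⟩ := exists_addsEdges_all (B := B) (env := env)
    (P := ite (.memFirstColumn (Fin.last k)) (addTreePair (Fin.last k)) skip)
    (Q := fun y C => (y ∈ firstColumn (B 1) → IsTreePair (edgesOf (B 0)) y C) ∧
      (y ∉ firstColumn (B 1) → C = ∅)) fun y B' h0 h1 => by
    by_cases hy : y ∈ firstColumn (B 1)
    · obtain ⟨C, hC, hadd⟩ := exists_addsEdges_addTreePair (B := B') (env := push env y)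
        (y := Fin.last k) (by simpa [h0] using hT y hy)
      rw [push_last, h0] at hC
      refine ⟨C, ⟨fun _ => hC, absurd hy⟩, ?_⟩
      rwa [eval_ite_pos (by simpa [h1] using hy)]
    · refine ⟨∅, ⟨fun h => absurd h hy, fun _ => rfl⟩, ?_⟩
      rw [eval_ite_neg (by simpa [h1] using hy)]
      exact .refl B'
  have hunion : (firstColumn (B 1)).biUnion C = Finset.univ.biUnion C :=
    (Finset.biUnion_subset_biUnion_of_subset_left C (Finset.subset_univ _)).antisymm <|
      Finset.biUnion_subset.2 fun y _ => by
        by_cases hy : y ∈ firstColumn (B 1)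
        · exact Finset.subset_biUnion_of_mem C hy
        · simp [(hC y).2 hy]
  exact ⟨C, fun y => (hC y).1, hunion ▸ hadd⟩

theorem exists_addsEdges_addIndependentTreesOutside (hB : StronglyConnected (edgesOf (B 0)))
    (hT : firstColumn (B 1) ≠ Finset.univ) (h4 : B 4 = fun _ _ => False)
    (h5 : B 5 = fun _ _ => False) : ∃ w ∉ firstColumn (B 1), ∃ A₁ A₂ B₁ B₂,
      AreIndependentTrees (edgesOf (B 0)) w A₁ A₂ ∧
      AreIndependentTrees (reverse (edgesOf (B 0))) w B₁ B₂ ∧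
      AddsEdges B (addIndependentTreesOutside.eval env B) ((A₁ ∪ A₂) ∪ reverse (B₁ ∪ B₂)) := by
  have hne : ∃ v, v ∉ firstColumn (B 1) := by simpa [Finset.eq_univ_iff_forall] using hT
  obtain ⟨w, hw⟩ := exists_isLeast (s := {v | v ∉ firstColumn (B 1)}) hne
  obtain ⟨A₁, A₂, B₁, B₂, hA, hB, hadd⟩ :=
    exists_addsEdges_addIndependentTrees (env := push env w) (w := Fin.last k) hB h4 h5
  have hleast (B' : State n) (h1 : B' 1 = B 1) (i : Fin n) : (Formula.least (Fin.last k)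
      (.not (.memFirstColumn (Fin.last k))) (.not (.memFirstColumn (Fin.last (k + 1))))).Realize B'
        (push env i) ↔ i = w := by
    rw [Formula.realize_least (Q := (· ∉ firstColumn (B 1))) (by simp [h1]) (by simp [h1]),
      push_last]
    exact ⟨fun h => h.unique hw, fun h => h ▸ hw⟩
  rw [push_last] at hA hB
  refine ⟨w, hw.1, A₁, A₂, B₁, B₂, hA, hB, ?_⟩
  rwa [addIndependentTreesOutside,
    eval_all_ite_unique (hleast _ rfl) (hleast _ hadd.vertexSet_eq)]

theorem algorithmOutput_eval_augment [Nontrivial (Fin n)]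
    (hB : TwoTConnected (edgesOf (B 0)) (firstColumn (B 1)))
    (hF : IsMinimalTwoEdgeConnectedSubgraph (edgesOf (B 0)) (edgesOf (B 2)))
    (hT : firstColumn (B 1) ≠ Finset.univ) (h4 : B 4 = fun _ _ => False)
    (h5 : B 5 = fun _ _ => False) : AlgorithmOutput (edgesOf (B 0)) (firstColumn (B 1))
      (edgesOf (augment.eval env B 2)) := by
  by_cases hempty : firstColumn (B 1) = ∅
  · rw [augment, eval_ite_pos (Formula.realize_firstColumnEqEmpty.2 hempty)]
    exact .empty hempty _ hF
  rw [augment, eval_ite_neg (mt Formula.realize_firstColumnEqEmpty.1 hempty)]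
  by_cases hcard : 2 < (firstColumn (B 1)).card
  · rw [eval_ite_pos (Formula.realize_twoLtCardFirstColumn.2 hcard)]
    obtain ⟨w, hw, A₁, A₂, B₁, B₂, hA, hB, hadd⟩ :=
      exists_addsEdges_addIndependentTreesOutside (env := env) hB.1 hT h4 h5
    rw [hadd.edgesOf_eq, ← Finset.union_assoc]
    exact .large hempty hT (by omega) _ hF w hw A₁ A₂ B₁ B₂ hA hB
  · rw [eval_ite_neg (mt Formula.realize_twoLtCardFirstColumn.1 hcard)]
    obtain ⟨C, hC, hadd⟩ := exists_addsEdges_addTreePairs (env := env) hB.2.2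
    choose! q A A' hq hA hA' hCA using hC
    rw [hadd.edgesOf_eq, Finset.biUnion_congr rfl hCA]
    exact .small hempty hT ⟨Finset.card_pos.2 (Finset.nonempty_iff_ne_empty.2 hempty),
      not_lt.1 hcard⟩ _ hF q A A' hq hA hA'

theorem algorithmOutput_eval_main {env : Fin 0 → Fin n} (hn : 3 ≤ n)
    (hB : TwoTConnected (edgesOf (B 0)) (firstColumn (B 1))) (h4 : B 4 = fun _ _ => False)
    (h5 : B 5 = fun _ _ => False) : AlgorithmOutput (edgesOf (B 0)) (firstColumn (B 1))
      (edgesOf (main.eval env B 2)) := by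
  have : Nontrivial (Fin n) := Fin.nontrivial_iff_two_le.2 (by omega)
  by_cases hT : firstColumn (B 1) = Finset.univ
  · rw [main, eval_ite_pos (Formula.realize_firstColumnEqUniv.2 hT)]
    obtain ⟨F, hF, hmin, heval⟩ := exists_eval_minimalSubgraph (B := B) (env := env)
      (φ := .twoVertexConnected (2, false)) (P := TwoVertexConnected)
      (fun F x y => by simp [Formula.realize_twoVertexConnected hn])
      (fun F F' h hF => hF.mono h)
      ⟨by simpa using hn, hB.1, fun w => hB.2.2 w (hT ▸ Finset.mem_univ w)⟩
    rw [heval, Function.update_self, edgesOf_memRel]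
    exact .full (hT ▸ Finset.univ_nonempty.ne_empty) hT F ⟨hF, hmin⟩
  · rw [main, eval_ite_neg (mt Formula.realize_firstColumnEqUniv.1 hT), eval_seq]
    obtain ⟨F, hF, hmin, heval⟩ := exists_eval_minimalSubgraph (B := B) (env := env)
      (φ := .twoEdgeConnected (2, false)) (P := TwoEdgeConnected)
      (fun F x y => by simp [Formula.realize_twoEdgeConnected (show 0 < n by omega)])
      (fun F F' h hF => hF.mono h) hB.2.1
    rw [heval]
    exact algorithmOutput_eval_augment (B := Function.update B 2 (memRel F)) hB
      (by simpa using ⟨hF, hmin⟩) hT h4 h5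

end LoopProgram

end Algorithm

section Implementation

variable {n : ℕ} {E : Finset (Fin n × Fin n)} {T : Finset (Fin n)}

/-- The relations that the arrays of the input contain. -/
def inputState (n : ℕ) (E : Finset (Fin n × Fin n)) (T : Finset (Fin n)) : State n :=
  fun a i j => (inputStore n E T).arr a i j ≠ 0

theorem represents_inputState {env : Fin 0 → Fin n} :
    Represents (inputState n E T) env (inputStore n E T) where
  size := rfl
  env i := i.elim0
  arr _ _ _ := Iff.rfl

theorem edgesOf_inputState : edgesOf (inputState n E T 0) = E := by
  ext ⟨x, y⟩
  simp [inputState, inputStore]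

theorem firstColumn_inputState : firstColumn (inputState n E T 1) = T := by
  ext x
  have hmin (z : Fin n) : IsMin z ↔ (z : ℕ) = 0 := by
    rw [isMin_iff_forall_not_lt]
    exact ⟨fun h => by_contra fun hz => h ⟨0, x.pos⟩ (Fin.mk_lt_of_lt_val (by omega)),
      fun h v hv => by simp [Fin.lt_def, h] at hv⟩
  simp only [firstColumn, inputState, inputStore, hmin]
  simpa using fun _ => ⟨⟨0, x.pos⟩, rfl⟩

theorem inputState_eq_false {a : Fin numRel} (ha : 2 ≤ a) :
    inputState n E T a = fun _ _ => False := by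
  have ha : 2 ≤ (a : ℕ) := ha
  have h0 : (a : ℕ) ≠ 0 := by omega
  have h1 : (a : ℕ) ≠ 1 := by omega
  funext x y
  simp [inputState, inputStore, h0, h1]

theorem main_implementsInPolynomialTime :
    ImplementsInPolynomialTime LoopProgram.main.compile := by
  obtain ⟨p, hp⟩ := LoopProgram.main.exists_correct
  refine ⟨p, fun n E T hn hE => ?_⟩
  obtain ⟨s, ⟨m, hm, hexec⟩, -, hs⟩ := hp n _ Fin.elim0 _ (represents_inputState (E := E) (T := T))
  have hout : outputEdges n s =
      edgesOf (LoopProgram.main.eval Fin.elim0 (inputState n E T) 2) := by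
    ext ⟨x, y⟩
    simp only [outputEdges, Finset.mem_filter, Finset.mem_univ, true_and, mem_edgesOf]
    exact hs.arr 2 x y
  refine ⟨m, s, hexec, hm, ?_⟩
  have halg := LoopProgram.algorithmOutput_eval_main (B := inputState n E T) (env := Fin.elim0) hn
    (by rwa [edgesOf_inputState, firstColumn_inputState]) (inputState_eq_false (by decide))
    (inputState_eq_false (by decide))
  rwa [edgesOf_inputState, firstColumn_inputState, ← hout] at halg

end Implementation

end M2TC

theorem mainTheorem1 :
    (∀ (V : Type*) [Fintype V] [DecidableEq V] (E : Finset (V × V)) (T : Finset V),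
      3 ≤ Fintype.card V → TwoTConnected E T →
        2 * Fintype.card V ≤ E.card ∧
        ∀ F : Finset (V × V), AlgorithmOutput E T F →
          F.card ≤ 8 * Fintype.card V ∧
          IsFeasible E T F ∧
          ∀ F' : Finset (V × V), IsOptimal E T F' → F.card ≤ 4 * F'.card) ∧
    ∃ P : Prog, ImplementsInPolynomialTime P := by
  refine ⟨fun V _ _ E T hn hE => ?_, _, main_implementsInPolynomialTime⟩
  have : Nontrivial V := Fintype.one_lt_card_iff_nontrivial.1 (by lia)
  refine ⟨hE.2.1.two_mul_card_le, fun F hF => ⟨hF.card_le, hF.isFeasible hE, fun F' hF' => ?_⟩⟩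
  calc F.card ≤ 4 * (2 * Fintype.card V) := by linarith [hF.card_le]
    _ ≤ 4 * F'.card := Nat.mul_le_mul_left 4 hF'.1.2.2.1.two_mul_card_le
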